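/- Let $m,k\ge 0$, $G=SO(m+k+1,\mathbf C)=\{X: X^tX=I,\ \det X=1\}$, $P=\mathrm{diag}(I_m,-I_{k+1})$, $Q=\mathrm{diag}(I_{m+1},-I_k)$. Let $\Lambda G$ be the group of holomorphic maps $\mathbf C^*\to G$, with the operations $$(\sigma X)(\lambda)=P X(-\lambda)P^{-1},\qquad (\mu X)(\lambda)=Q X(1/\lambda)Q^{-1},$$ $$(\rho_1X)(\lambda)=\overline{X(-\bar\lambda)},\quad (\rho_2X)(\lambda)=\overline{X(\bar\lambda)},\quad (\rho_3X)(\lambda)=\overline{X(1/\bar\lambda)} .$$ For $c\in\mathbf R\setminus\{0,1\}$ let $\rho=\rho_1$ if $c<0$, $\rho=\rho_2$ if $0<c<1$, $\rho=\rho_3$ if $c>1$. Let $\mathcal H_{\rho\mu}$ be the subgroup of $\Lambda G$ fixed by $\sigma,\mu$ and $\rho$, and $\mathcal H^0_{\rho\mu}=SO(m)\times 1\times SO(k)$ its subgroup of constant loops $\mathrm{diag}(A,1,B)$ with $A\in SO(m,\mathbf R)$, $B\in SO(k,\mathbf R)$. For a smooth manifold $M$ with base point $p$, let $\frac{\mathcal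 H_{\rho\mu}}{\mathcal H^0_{\rho\mu}}(M)_{-1}^1$ be the set of maps $F$ from $M$ to the quotient $\mathcal H_{\rho\mu}/\mathcal H^0_{\rho\mu}$ (by right multiplication) such that $F(p)$ is the class of the identity and every point of $M$ has an open neighbourhood $U$ on which $F$ is represented by a map $\Phi:U\to\mathcal H_{\rho\mu}$, smooth in $(x,\lambda)\in U\times\mathbf C^*$, whose Maurer--Cartan form is $\Phi_\lambda^{-1}\,\mathrm d\Phi_\lambda=\lambda^{-1}A_{-1}+A_0+\lambda A_1$ with $A_{-1},A_0,A_1$ independent of $\lambda$. The $(m+1)$-th column of a loop depends only on its class modulo $\mathcal H^0_{\rho\mu}$. **Lemma.** Let $M$ be a simply connected (Hausdorff, smooth) manifold of dimension $m$, $p\in M$, and let $f:M\to S^{m+k}\subset\mathbf R^{m+k+1}$ be a smooth immersion with flat normal bundle in $S^{m+k}$ whose induced metric has constant sectional curvature $c$, where $0\ne c\ne1$. Assume the normalisation that $f(p)=E_{m+1}$ and $\mathrm df_p(T_pM)=\mathrm{span}(E_1,\dots,E_m)$, where $E_1,\dots,E_{m+k+1}$ is the standard basis. Then, for any choice of the complex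 square roots in $$\lambda_0=\frac{1}{\sqrt c}\bigl(1+\sqrt{1-c}\bigr),$$ there is a unique $F\in\frac{\mathcal H_{\rho\mu}}{\mathcal H^0_{\rho\mu}}(M)_{-1}^1$ whose $(m+1)$-th column, evaluated at $\lambda=\lambda_0$, is $f$. (No global adapted frame of $f$ on $M$ is assumed to exist.) -/

import Mathlib

open scoped Manifold ContDiff InnerProductSpace

noncomputable section

namespace SpaceForm

/-! ## Geometry of immersions into the unit sphere -/

/-- Index set of the coordinates of `ℝ^{m+k+1}`, split into blocks of sizes `m`, `1`, `k`. -/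
abbrev Idx (m k : ℕ) : Type := Fin m ⊕ Unit ⊕ Fin k

/-- The `(m+1)`-st index. -/
abbrev mid (m k : ℕ) : Idx m k := Sum.inr (Sum.inl ())

/-- Parameter space of an `m`-dimensional chart. -/
abbrev Coord (m : ℕ) : Type := EuclideanSpace ℝ (Fin m)

/-- The ambient Euclidean space `ℝ^{m+k+1}`. -/
abbrev Ambient (m k : ℕ) : Type := EuclideanSpace ℝ (Idx m k)

/-- The partial derivative `∂_i h`. -/
def pd {m : ℕ} {V : Type*} [NormedAddCommGroup V] [NormedSpace ℝ V]
    (i : Fin m) (h : Coord m → V) (y : Coord m) : V :=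
  fderiv ℝ h y (EuclideanSpace.single i 1)

/-- The metric induced by a parametrised submanifold `φ`, `g_ij = ⟪∂_i φ, ∂_j φ⟫`. -/
def metric {m k : ℕ} (φ : Coord m → Ambient m k) (y : Coord m) : Matrix (Fin m) (Fin m) ℝ :=
  Matrix.of fun i j => ⟪pd i φ y, pd j φ y⟫_ℝ

/-- Christoffel symbols `Γ^l_{ij}` of a metric `g`. -/
def christoffel {m : ℕ} (g : Coord m → Matrix (Fin m) (Fin m) ℝ)
    (l i j : Fin m) (y : Coord m) : ℝ :=
  (1 / 2) * ∑ q, (g y)⁻¹ l q *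
    (pd i (fun z => g z j q) y + pd j (fun z => g z i q) y - pd q (fun z => g z i j) y)

/-- Components of the Riemann curvature tensor, `R(∂_i, ∂_j) ∂_h = ∑_l R^l_{hij} ∂_l`, where
`R(X, Y) = ∇_X ∇_Y - ∇_Y ∇_X - ∇_{[X, Y]}` for the Levi-Civita connection of `g`. -/
def riemann {m : ℕ} (g : Coord m → Matrix (Fin m) (Fin m) ℝ)
    (l h i j : Fin m) (y : Coord m) : ℝ :=
  pd i (christoffel g l j h) y - pd j (christoffel g l i h) y
    + ∑ q, (christoffel g l i q y * christoffel g q j h y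
        - christoffel g l j q y * christoffel g q i h y)

/-- `g(X, Y)` at the point `y`. -/
def metricPair {m : ℕ} (g : Coord m → Matrix (Fin m) (Fin m) ℝ) (y : Coord m)
    (X Y : Fin m → ℝ) : ℝ :=
  ∑ i, ∑ j, g y i j * X i * Y j

/-- The vector `R(X, Y) Z` at the point `y`. -/
def riemannVec {m : ℕ} (g : Coord m → Matrix (Fin m) (Fin m) ℝ) (y : Coord m)
    (X Y Z : Fin m → ℝ) : Fin m → ℝ :=
  fun l => ∑ h, ∑ i, ∑ j, riemann g l h i j y * X i * Y j * Z h

/-- The sectional curvature of the plane spanned by `X` and `Y`,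
`g(R(X, Y) Y, X) / (g(X, X) g(Y, Y) - g(X, Y)^2)`. -/
def sectional {m : ℕ} (g : Coord m → Matrix (Fin m) (Fin m) ℝ) (y : Coord m)
    (X Y : Fin m → ℝ) : ℝ :=
  metricPair g y (riemannVec g y X Y Y) X /
    (metricPair g y X X * metricPair g y Y Y - metricPair g y X Y ^ 2)

/-- The normal space at `φ y`, inside the tangent space of the unit sphere, of a parametrised
submanifold `φ` of the unit sphere. -/
def normalSpace {m k : ℕ} (φ : Coord m → Ambient m k) (y : Coord m) :
    Submodule ℝ (Ambient m k) :=
  (Submodule.span ℝ {φ y} ⊔ LinearMap.range (fderiv ℝ φ y : Coord m →ₗ[ℝ] Ambient m k))ᗮ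

/-- The normal connection `∇^⊥_v ξ`: the orthogonal projection to the normal space of the
derivative of `ξ` along the constant coordinate field `v`. -/
def normalDeriv {m k : ℕ} (φ : Coord m → Ambient m k) (v : Coord m)
    (ξ : Coord m → Ambient m k) (y : Coord m) : Ambient m k :=
  (normalSpace φ y).starProjection (fderiv ℝ ξ y v)

section Immersion

variable {m k : ℕ} {M : Type*} [TopologicalSpace M] [ChartedSpace (Coord m) M]

/-- `f` is a smooth immersion of `M` into the unit sphere `S^{m+k}` of `ℝ^{m+k+1}`. -/
structure IsSphereImmersion (f : M → Ambient m k) : Prop where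
  smooth : ContMDiff (𝓡 m) 𝓘(ℝ, Ambient m k) ∞ f
  mem_sphere : ∀ x, f x ∈ Metric.sphere (0 : Ambient m k) 1
  injective_mfderiv : ∀ x, Function.Injective (mfderiv (𝓡 m) 𝓘(ℝ, Ambient m k) f x)

/-- The metric induced by `f` on `M` has constant sectional curvature `c`. -/
def HasConstCurvature (f : M → Ambient m k) (c : ℝ) : Prop :=
  ∀ e ∈ atlas (Coord m) M, ∀ y ∈ e.target, ∀ X Y : Fin m → ℝ, LinearIndependent ℝ ![X, Y] →
    sectional (metric (f ∘ e.symm)) y X Y = c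

/-- The normal bundle of `f` in the sphere is flat: the curvature
`∇^⊥_v ∇^⊥_w ξ - ∇^⊥_w ∇^⊥_v ξ` of the normal connection vanishes for all local normal fields `ξ`
and all (commuting) coordinate fields `v`, `w`. -/
def HasFlatNormalBundle (f : M → Ambient m k) : Prop :=
  ∀ e ∈ atlas (Coord m) M, ∀ ξ : Coord m → Ambient m k, ContDiffOn ℝ ∞ ξ e.target →
    (∀ y ∈ e.target, ξ y ∈ normalSpace (f ∘ e.symm) y) →
    ∀ v w : Coord m, ∀ y ∈ e.target,
      normalDeriv (f ∘ e.symm) v (normalDeriv (f ∘ e.symm) w ξ) y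
        = normalDeriv (f ∘ e.symm) w (normalDeriv (f ∘ e.symm) v ξ) y

end Immersion

/-! ## Loop groups -/

/-- All maps `ℂ^* → GL(m+k+1, ℂ)`, with pointwise multiplication. -/
abbrev Maps (m k : ℕ) : Type := ℂˣ → GL (Idx m k) ℂ

/-- `ΛG` for `G = SO(m+k+1, ℂ) = {X | Xᵀ X = 1, det X = 1}`: loops holomorphic on `ℂ^*`. -/
def loopGroup (m k : ℕ) : Subgroup (Maps m k) where
  carrier := {X | (∀ i j, MDifferentiable 𝓘(ℂ, ℂ) 𝓘(ℂ, ℂ)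
      fun l : ℂˣ => (X l : Matrix (Idx m k) (Idx m k) ℂ) i j) ∧
    ∀ l, (X l : Matrix (Idx m k) (Idx m k) ℂ).transpose * (X l : Matrix _ _ ℂ) = 1 ∧
      (X l : Matrix (Idx m k) (Idx m k) ℂ).det = 1}
  one_mem' := by
    refine ⟨fun i j => ?_, fun l => by simp⟩
    simp only [Pi.one_apply, Units.val_one]
    exact mdifferentiable_const
  mul_mem' := by
    rintro X Y ⟨hX, hX'⟩ ⟨hY, hY'⟩
    refine ⟨fun i j => ?_, fun l => ⟨?_, ?_⟩⟩
    · simp only [Pi.mul_apply, Units.val_mul, Matrix.mul_apply]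
      have h : ∀ s : Finset (Idx m k), MDifferentiable 𝓘(ℂ, ℂ) 𝓘(ℂ, ℂ) fun l : ℂˣ =>
          ∑ q ∈ s, (X l : Matrix (Idx m k) (Idx m k) ℂ) i q *
            (Y l : Matrix (Idx m k) (Idx m k) ℂ) q j := by
        intro s
        induction s using Finset.induction_on with
        | empty => simpa using mdifferentiable_const
        | insert a s ha ih =>
          simp only [Finset.sum_insert ha]
          exact ((hX i a).mul (hY a j)).add ih
      exact h _
    · simp only [Pi.mul_apply, Units.val_mul, Matrix.transpose_mul]
      rw [Matrix.mul_assoc, ← Matrix.mul_assoc _ (X l : Matrix (Idx m k) (Idx m k) ℂ), (hX' l).1,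
        Matrix.one_mul, (hY' l).1]
    · simp [Matrix.det_mul, (hX' l).2, (hY' l).2]
  inv_mem' := by
    rintro X ⟨hX, hX'⟩
    have h : ∀ l, ((X⁻¹) l : Matrix (Idx m k) (Idx m k) ℂ)
        = (X l : Matrix (Idx m k) (Idx m k) ℂ).transpose := fun l =>
      (Units.inv_eq_of_mul_eq_one_left (hX' l).1)
    refine ⟨fun i j => ?_, fun l => ⟨?_, ?_⟩⟩
    · simp only [h, Matrix.transpose_apply]
      exact hX j i
    · rw [h, Matrix.transpose_transpose]
      exact mul_eq_one_comm.mp (hX' l).1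
    · rw [h, Matrix.det_transpose]
      exact (hX' l).2

/-- A diagonal matrix with entries `±1`, as an invertible matrix. -/
def signDiag {m k : ℕ} (d : Idx m k → ℤˣ) : GL (Idx m k) ℂ where
  val := Matrix.diagonal fun i => ((d i : ℤ) : ℂ)
  inv := Matrix.diagonal fun i => ((d i : ℤ) : ℂ)
  val_inv := by
    rw [Matrix.diagonal_mul_diagonal, ← Matrix.diagonal_one]
    congr 1; funext i
    exact_mod_cast (Int.isUnit_mul_self (d i).isUnit)
  inv_val := by
    rw [Matrix.diagonal_mul_diagonal, ← Matrix.diagonal_one]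
    congr 1; funext i
    exact_mod_cast (Int.isUnit_mul_self (d i).isUnit)

/-- `P = diag(I_m, -I_{k+1})`. -/
def matP (m k : ℕ) : GL (Idx m k) ℂ := signDiag (Sum.elim (fun _ => 1) (fun _ => -1))

/-- `Q = diag(I_{m+1}, -I_k)`. -/
def matQ (m k : ℕ) : GL (Idx m k) ℂ :=
  signDiag (Sum.elim (fun _ => 1) (Sum.elim (fun _ => 1) (fun _ => -1)))

/-- The twisting `(σ X)(λ) = Ad_P X(-λ)`. -/
def sigma (m k : ℕ) : Maps m k →* Maps m k :=
  MonoidHom.pi fun l => (MulAut.conj (matP m k)).toMonoidHom.comp (Pi.evalMonoidHom _ (-l))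

/-- The involution `(μ X)(λ) = Ad_Q X(1/λ)`. -/
def muInv (m k : ℕ) : Maps m k →* Maps m k :=
  MonoidHom.pi fun l => (MulAut.conj (matQ m k)).toMonoidHom.comp (Pi.evalMonoidHom _ l⁻¹)

/-- For a map `r` of `ℂ^*` to itself, the operation `X ↦ (λ ↦ conj (X (r λ)))`. -/
def conjAlong (m k : ℕ) (r : ℂˣ → ℂˣ) : Maps m k →* Maps m k :=
  MonoidHom.pi fun l =>
    (Matrix.GeneralLinearGroup.map (starRingEnd ℂ)).comp (Pi.evalMonoidHom _ (r l))

/-- `(ρ₁ X)(λ) = conj (X (-conj λ))`. -/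
def rho₁ (m k : ℕ) : Maps m k →* Maps m k := conjAlong m k fun l => -star l

/-- `(ρ₂ X)(λ) = conj (X (conj λ))`. -/
def rho₂ (m k : ℕ) : Maps m k →* Maps m k := conjAlong m k fun l => star l

/-- `(ρ₃ X)(λ) = conj (X (1 / conj λ))`. -/
def rho₃ (m k : ℕ) : Maps m k →* Maps m k := conjAlong m k fun l => (star l)⁻¹

/-- The reality condition appropriate for the curvature `c`: `ρ₁` for `c < 0`, `ρ₂` for
`0 < c < 1`, `ρ₃` for `c > 1`. -/
def rho (m k : ℕ) (c : ℝ) : Maps m k →* Maps m k :=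
  if c < 0 then rho₁ m k else if c < 1 then rho₂ m k else rho₃ m k

/-- `H_{ρμ}`: the loops in `ΛG` fixed by `σ`, `μ` and `ρ`. -/
def twistedLoops (m k : ℕ) (c : ℝ) : Subgroup (Maps m k) :=
  loopGroup m k ⊓ (sigma m k).eqLocus (MonoidHom.id _) ⊓ (muInv m k).eqLocus (MonoidHom.id _)
    ⊓ (rho m k c).eqLocus (MonoidHom.id _)

/-- The homomorphism `(A, B) ↦ diag(A, 1, B)` from `SO(m) × SO(k)` to complex matrices. -/
def blockHom (m k : ℕ) :
    Matrix.specialOrthogonalGroup (Fin m) ℝ × Matrix.specialOrthogonalGroup (Fin k) ℝ →*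
      Matrix (Idx m k) (Idx m k) ℂ where
  toFun g := Matrix.fromBlocks ((g.1 : Matrix (Fin m) (Fin m) ℝ).map (algebraMap ℝ ℂ)) 0 0
    (Matrix.fromBlocks 1 0 0 ((g.2 : Matrix (Fin k) (Fin k) ℝ).map (algebraMap ℝ ℂ)))
  map_one' := by simp [Matrix.map_one]
  map_mul' g h := by
    rw [Matrix.fromBlocks_multiply, Matrix.fromBlocks_multiply]
    simp only [Prod.fst_mul, Prod.snd_mul, Submonoid.coe_mul, Matrix.map_mul]
    simp

/-- The subgroup `SO(m) × 1 × SO(k)` of constant loops `diag(A, 1, B)`. -/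
def constLoops (m k : ℕ) : Subgroup (Maps m k) :=
  (MonoidHom.pi fun _ : ℂˣ => (blockHom m k).toHomUnits).range

/-- `H_{ρμ}^0`, as a subgroup of `H_{ρμ}`. -/
def twistedConst (m k : ℕ) (c : ℝ) : Subgroup (twistedLoops m k c) :=
  (constLoops m k).subgroupOf (twistedLoops m k c)

/-- `H_{ρμ} / H_{ρμ}^0`, the quotient by right multiplication. -/
abbrev LoopQuot (m k : ℕ) (c : ℝ) : Type := twistedLoops m k c ⧸ twistedConst m k c

/-- The `(m+1)`-st column at the parameter value `l`, for classes of loops. -/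
def midColumn {m k : ℕ} {c : ℝ} (l : ℂˣ) (F : LoopQuot m k c) : Idx m k → ℂ :=
  Quotient.liftOn' F (fun X i => ((X : Maps m k) l : Matrix (Idx m k) (Idx m k) ℂ) i (mid m k))
    (by
      intro X Y h
      rw [QuotientGroup.leftRel_apply] at h
      obtain ⟨g, hg⟩ := h
      have hY : (Y : Maps m k) = (X : Maps m k) *
          (MonoidHom.pi fun _ : ℂˣ => (blockHom m k).toHomUnits) g := by
        rw [hg]; simp
      have hB : (((MonoidHom.pi fun _ : ℂˣ => (blockHom m k).toHomUnits) g : Maps m k) l :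
          Matrix (Idx m k) (Idx m k) ℂ) = blockHom m k g := rfl
      funext i
      simp only [hY, Pi.mul_apply, Units.val_mul, hB, Matrix.mul_apply]
      simp [blockHom, Fintype.sum_sum_type])

section Maps

variable {m k : ℕ} {c : ℝ} {M : Type*} [TopologicalSpace M] [ChartedSpace (Coord m) M]

/-- `Φ` is, on the set `U`, a smooth map into the loop group: its entries depend smoothly on
`(x, λ) ∈ U × ℂ^*` (they are holomorphic in `λ` by the definition of the loop group). -/
def SmoothFrameOn (Φ : M → twistedLoops m k c) (U : Set M) : Prop :=
  ∀ i j, ContMDiffOn ((𝓡 m).prod 𝓘(ℝ, ℂ)) 𝓘(ℝ, ℂ) ∞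
    (fun q : M × ℂˣ => ((Φ q.1 : Maps m k) q.2 : Matrix (Idx m k) (Idx m k) ℂ) i j)
    (U ×ˢ Set.univ)

/-- The Maurer-Cartan form `Φ_λ⁻¹ dΦ_λ` at the point `x`, applied to the tangent vector `v`. -/
def maurerCartan (Φ : M → twistedLoops m k c) (x : M) (v : TangentSpace (𝓡 m) x) (l : ℂˣ) :
    Matrix (Idx m k) (Idx m k) ℂ :=
  (((Φ x : Maps m k) l)⁻¹ : GL (Idx m k) ℂ).val * Matrix.of fun i j =>
    mfderiv (𝓡 m) 𝓘(ℝ, ℂ)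
      (fun y => ((Φ y : Maps m k) l : Matrix (Idx m k) (Idx m k) ℂ) i j) x v

/-- The Fourier series in `λ` of the Maurer-Cartan form of `Φ` has, at all points of `U`, only
terms of degrees between `a` and `b`. -/
def HasConnectionOrderOn (a b : ℤ) (Φ : M → twistedLoops m k c) (U : Set M) : Prop :=
  ∀ x ∈ U, ∀ v : TangentSpace (𝓡 m) x, ∃ A : ℤ → Matrix (Idx m k) (Idx m k) ℂ,
    ∀ l : ℂˣ, maurerCartan Φ x v l = ∑ n ∈ Finset.Icc a b, ((l : ℂ) ^ n) • A n

/-- `F` is an element of `(H_{ρμ} / H_{ρμ}^0)(M)_a^b` with base point `p`: a map into the quotient,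
normalised to the identity class at `p`, which around each point is represented by a smooth
map into the loop group of connection order `(a, b)`. -/
def IsConnectionOrderMap (a b : ℤ) (p : M) (F : M → LoopQuot m k c) : Prop :=
  F p = QuotientGroup.mk 1 ∧
  ∀ x, ∃ U : Set M, IsOpen U ∧ x ∈ U ∧ ∃ Φ : M → twistedLoops m k c,
    SmoothFrameOn Φ U ∧ HasConnectionOrderOn a b Φ U ∧ ∀ y ∈ U, F y = QuotientGroup.mk (Φ y)

end Maps

end SpaceForm

end

/-!
Let `T` be the field of orthogonal projections to the tangent spaces of `f`, as a matrix-valued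
function on `M`. The form `ρ = [dT, T]` splits as `ρ = θ + β`, where `θ` exchanges the tangent
space with the position line and `β` exchanges it with the normal space. Neither needs a frame, so
both are globally defined. They satisfy `dθ = 2 [θ, θ]`, `[θ, β] = 0` and `dβ = 2 [β, β]`
(`d_theta`, `mixed_bracket`, `d_beta`), and constant curvature `c` together with a flat normal
bundle amounts to `[β, β] = (c - 1) [θ, θ]` (`betaForm_bracket`). Hence the equation
`dX = X (a θ + b β)` is integrable for all `(a, b)` on the quadric
`a (a + 2) + (c - 1) b (b + 2) = 0` (`IsLocalImmersion.flat`). This quadric is parametrised by the loop parameter `λ ∈ ℂ^*`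
(`spectral`), its symmetries `σ`, `μ` and complex conjugation become the twisting of loops
(`spectral_neg`, `spectral_inv`, `conj_spectral`), and `λ₀` is the point over `(0, 0)`, where all
solutions are constant (`spectral_zero`).

In a chart the equation is solved along rays, as a Volterra equation with parameters, which gives
solutions that are smooth in all variables and holomorphic in `(a, b)`, and parallel in all
directions where the form is flat (`exists_radial_transport`, `fderiv_radial_transport_of_flat`).
Different local solutions differ by locally constant loops, so that on a simply connected manifold
they can be glued to a global family `Ψ_λ` with `Ψ_λ(p) = 1` (`exists_glue_of_locallyConstant`,
`IsSphereImmersion.exists_global_parallel`).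

For existence, let `F(x)` be the class of `λ ↦ Ψ_λ(x) E`, where `E` is a frame adapted to `f` at
`x`. Two such frames differ by an element of `O(m) × 1 × O(k)` of determinant one; the sign of the
determinant of the first block is fixed by transporting `E` to `p` with `Ψ_1`, which commutes with
the reflection `Q` up to the reflection in the tangent space and position line (`IsAdaptedFrame`,
`upperDet`). This makes `F(x)` independent of `E`, without a global adapted frame. Frames exist at
all points by connectedness (`exists_adaptedFrame`), and local smooth frames come from parallel
transport along rays for `ρ`, the parameter `(a, b) = (-1, -1)`. Since `Ψ_{λ₀} = 1`, the middle
column of `F` at `λ₀` is `f` (`exists_connectionOrderMap`).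

For uniqueness, let `Φ` be a local lift of a solution. Its value at `λ₀` is real, because the
reality involution fixes `λ₀`, and the twisting together with the shape of the Maurer–Cartan form
shows that it is an adapted frame, where the normalisation at `p` fixes the orientation. The loop
`Φ_λ Φ_{λ₀}⁻¹` depends only on the class of `Φ`, and it solves `dX = X (a θ + b β)` with value `1`
at `p` (`IsLift.isParallelAt`). So it is `Ψ_λ`, and the class of `Φ = Ψ Φ_{λ₀}` is determined
(`exists_adaptedFrame_of_connectionOrderMap`).
-/

open scoped Manifold ContDiff InnerProductSpace unitInterval

noncomputable section

set_option linter.unusedSectionVars false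

namespace SpaceForm

/-! ### Volterra equations with parameters -/

/-- If the operators `g ↦ J (g * A)` are quasi-nilpotent, then `g = 1 + J (g * A)` has a unique
solution, which depends smoothly on `A`. -/
lemma exists_contDiff_resolvent {𝓒 : Type*} [NormedRing 𝓒] [NormedAlgebra ℂ 𝓒] [CompleteSpace 𝓒]
    (J : 𝓒 → 𝓒) (hadd : ∀ g h, J (g + h) = J g + J h) (hsmul : ∀ (z : ℂ) g, J (z • g) = z • J g)
    (hJ : ∀ g, ‖J g‖ ≤ 1 * ‖g‖)
    (hq : ∀ A, ∃ n, ∃ κ : ℝ, 0 ≤ κ ∧ κ < 1 ∧ ∀ g, ‖(fun g => J (g * A))^[n] g‖ ≤ κ * ‖g‖) :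
    ∃ sol : 𝓒 → 𝓒, ContDiff ℂ ∞ sol ∧ (∀ A, sol A = 1 + J (sol A * A)) ∧
      ∀ A g, g = 1 + J (g * A) → g = sol A := by
  set W : 𝓒 →L[ℂ] 𝓒 →L[ℂ] 𝓒 :=
    (ContinuousLinearMap.compL ℂ 𝓒 𝓒 𝓒 (LinearMap.mkContinuous ⟨⟨J, hadd⟩, hsmul⟩ 1 hJ)).comp
      (ContinuousLinearMap.mul ℂ 𝓒).flip with hW
  have hWa : ∀ A g, W A g = J (g * A) := fun _ _ => rfl
  -- `1 - W A` divides `1 - (W A) ^ n`, which is invertible by the Neumann series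
  have hunit : ∀ A, IsUnit (1 - W A) := by
    intro A
    obtain ⟨n, κ, hκ, hκ1, hn⟩ := hq A
    have hle : ‖W A ^ n‖ ≤ κ := ContinuousLinearMap.opNorm_le_bound _ hκ fun g => by
      rw [show (W A ^ n) g = (W A)^[n] g from congrFun (FunLike.coe_pow_eq_iterate _ _) g]; exact hn g
    have hu : IsUnit (1 - W A ^ n) := isUnit_one_sub_of_norm_lt_one (hle.trans_lt hκ1)
    rw [← mul_neg_geom_sum] at hu
    refine (Commute.isUnit_mul_iff ?_).1 hu |>.1
    exact (Commute.one_left _).sub_left (Commute.sum_right _ _ _ fun i _ => Commute.pow_right rfl i)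
  refine ⟨fun A => Ring.inverse (1 - W A) 1, ?_, fun A => ?_, fun A g h => ?_⟩
  · rw [contDiff_iff_contDiffAt]
    intro A
    have h1 : ContDiffAt ℂ ∞ (fun A : 𝓒 => 1 - W A) A :=
      contDiffAt_const.sub W.contDiff.contDiffAt
    obtain ⟨u, hu⟩ := hunit A
    have h2 : ContDiffAt ℂ ∞ Ring.inverse (1 - W A) := hu ▸ contDiffAt_ringInverse ℂ u
    exact (h2.comp A h1).clm_apply contDiffAt_const
  · have h := congrArg (fun L : 𝓒 →L[ℂ] 𝓒 => L 1) (Ring.mul_inverse_cancel _ (hunit A))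
    simp only [mul_apply_eq_comp, sub_apply, one_apply_eq_self, hWa] at h
    rwa [sub_eq_iff_eq_add] at h
  · have h1 : (1 - W A) g = 1 := by
      simp only [sub_apply, one_apply_eq_self, hWa]
      rw [sub_eq_iff_eq_add]; exact h
    have h2 := congrArg (fun L : 𝓒 →L[ℂ] 𝓒 => L g) (Ring.inverse_mul_cancel _ (hunit A))
    simp only [mul_apply_eq_comp, h1, one_apply_eq_self] at h2
    exact h2.symm

section Volterra

attribute [local instance] NormedAlgebra.toNormedSpace

variable {𝔸 : Type*} [NormedRing 𝔸] [NormedAlgebra ℝ 𝔸] [NormedAlgebra ℂ 𝔸] [IsScalarTower ℝ ℂ 𝔸]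

/-- The primitive `t ↦ ∫₀ᵗ g` of a continuous function on the unit interval. -/
def primitive : C(I, 𝔸) →ₗ[ℂ] C(I, 𝔸) where
  toFun g :=
    { toFun := fun t => ∫ u in (0 : ℝ)..t, Set.IccExtend zero_le_one g u
      continuous_toFun := by
        have h : Continuous (Set.IccExtend (zero_le_one' ℝ) g) := g.continuous.Icc_extend'
        exact (intervalIntegral.continuous_primitive
          (fun a b => h.intervalIntegrable a b) 0).comp continuous_subtype_val }
  map_add' g h := by
    ext t
    have hg : Continuous (Set.IccExtend (zero_le_one' ℝ) g) := g.continuous.Icc_extend'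
    have hh : Continuous (Set.IccExtend (zero_le_one' ℝ) h) := h.continuous.Icc_extend'
    exact intervalIntegral.integral_add (hg.intervalIntegrable _ _) (hh.intervalIntegrable _ _)
  map_smul' z g := by
    ext t
    exact intervalIntegral.integral_smul z _

lemma primitive_apply (g : C(I, 𝔸)) (t : I) :
    primitive g t = ∫ u in (0 : ℝ)..t, Set.IccExtend zero_le_one g u := rfl

lemma norm_primitive_le (g : C(I, 𝔸)) : ‖primitive g‖ ≤ 1 * ‖g‖ := by
  rw [one_mul, ContinuousMap.norm_le _ (norm_nonneg _)]
  intro t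
  refine (intervalIntegral.norm_integral_le_of_norm_le_const (C := ‖g‖)
    fun u _ => g.norm_coe_le_norm _).trans ?_
  have h1 : |(t : ℝ) - 0| ≤ 1 := by rw [sub_zero, abs_of_nonneg t.2.1]; exact t.2.2
  exact mul_le_of_le_one_right (norm_nonneg _) h1

/-- The iterates of a Volterra operator decay factorially, so that it is quasi-nilpotent. -/
lemma norm_volterra_iterate_apply_le (A g : C(I, 𝔸)) (n : ℕ) (t : I) :
    ‖((fun g => primitive (g * A))^[n] g) t‖ ≤ (‖A‖ * t) ^ n / n.factorial * ‖g‖ := by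
  induction n generalizing t with
  | zero => simpa using g.norm_coe_le_norm t
  | succ n ih =>
    rw [Function.iterate_succ_apply', primitive_apply]
    have hb : ∀ u ∈ Set.Ioc (0 : ℝ) t,
        ‖Set.IccExtend zero_le_one (((fun g => primitive (g * A))^[n] g) * A) u‖ ≤
          ‖A‖ ^ (n + 1) / n.factorial * ‖g‖ * u ^ n := by
      intro u hu
      have hu' : u ∈ I := ⟨hu.1.le, hu.2.trans t.2.2⟩
      rw [Set.IccExtend_of_mem _ _ hu', ContinuousMap.mul_apply]
      refine (norm_mul_le _ _).trans ?_
      refine (mul_le_mul (ih ⟨u, hu'⟩) (A.norm_coe_le_norm _) (norm_nonneg _) (by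
        have := hu.1.le; positivity)).trans_eq ?_
      simp only [mul_pow, pow_succ]; ring
    have hc : Continuous fun u : ℝ => ‖A‖ ^ (n + 1) / n.factorial * ‖g‖ * u ^ n := by fun_prop
    refine (intervalIntegral.norm_integral_le_of_norm_le t.2.1
      (Filter.Eventually.of_forall hb) (hc.intervalIntegrable _ _)).trans_eq ?_
    rw [intervalIntegral.integral_const_mul, integral_pow, Nat.factorial_succ]
    push_cast
    have : (n.factorial : ℝ) ≠ 0 := by positivity
    field_simp
    ring

/-- The solution operator `A ↦ g` of the Volterra equation `g(t) = 1 + ∫₀ᵗ g A` is smooth. -/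
lemma exists_contDiff_volterra_solution [CompleteSpace 𝔸] :
    ∃ sol : C(I, 𝔸) → C(I, 𝔸), ContDiff ℂ ∞ sol ∧
    (∀ A, sol A = 1 + primitive (sol A * A)) ∧
    ∀ A g, g = 1 + primitive (g * A) → g = sol A := by
  refine exists_contDiff_resolvent (primitive (𝔸 := 𝔸))
    (map_add _) (map_smul _) norm_primitive_le fun A => ?_
  obtain ⟨n, hn⟩ := ((FloorSemiring.tendsto_pow_div_factorial_atTop ‖A‖).eventually_lt_const
    (zero_lt_one)).exists
  refine ⟨n, _, by positivity, hn, fun g => ?_⟩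
  rw [ContinuousMap.norm_le _ (by positivity)]
  intro t
  refine (norm_volterra_iterate_apply_le A g n t).trans ?_
  have h0 := t.2.1
  have : ‖A‖ * t ≤ ‖A‖ := mul_le_of_le_one_right (norm_nonneg _) t.2.2
  gcongr

end Volterra

section RayCurve

universe u

variable {X V : Type u} [NormedAddCommGroup X] [NormedSpace ℝ X] [NormedAddCommGroup V]

/-- The restriction `t ↦ h (t • y)` of `h` to the segment from `0` to `y`. -/
def rayCurve (h : C(X, V)) (y : X) : C(I, V) :=
  ⟨fun t => h ((t : ℝ) • y), by fun_prop⟩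

lemma continuous_rayCurve (h : C(X, V)) : Continuous (rayCurve h) := by
  refine ContinuousMap.continuous_of_continuous_uncurry _ ?_
  change Continuous fun q : X × I => h ((q.2 : ℝ) • q.1)
  fun_prop

variable [NormedSpace ℝ V]

/-- The linear map sending `g` to `v ↦ (t ↦ w t • g t v)`, for a weight function `w`. -/
def rayApply (w : C(I, ℝ)) : C(I, X →L[ℝ] V) →L[ℝ] X →L[ℝ] C(I, V) :=
  LinearMap.mkContinuous₂
    (LinearMap.mk₂ ℝ (fun (g : C(I, X →L[ℝ] V)) (v : X) =>
      (⟨fun t => w t • g t v, by fun_prop⟩ : C(I, V)))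
      (fun g g' v => by ext t; simp)
      (fun z g v => by ext t; exact smul_comm _ _ _)
      (fun g v v' => by ext t; simp)
      (fun z g v => by
        ext t
        change w t • g t (z • v) = z • w t • g t v
        rw [map_smul, smul_comm]))
    ‖w‖ (fun g v => by
      rw [ContinuousMap.norm_le _ (by positivity)]
      intro t
      change ‖w t • g t v‖ ≤ _
      rw [norm_smul, mul_assoc]
      gcongr
      · exact w.norm_coe_le_norm t
      · exact (g t).le_of_opNorm_le (g.norm_coe_le_norm t) v)

lemma contDiff_rayApply (w : C(I, ℝ)) {n : WithTop ℕ∞} :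
    ContDiff ℝ n (rayApply w : C(I, X →L[ℝ] V) → X →L[ℝ] C(I, V)) :=
  ContinuousLinearMap.contDiff (𝕜 := ℝ) (E := C(I, X →L[ℝ] V)) (F := X →L[ℝ] C(I, V)) _

/-- The inclusion of the unit interval into `ℝ`. -/
def coeInterval : C(I, ℝ) := ⟨Subtype.val, continuous_subtype_val⟩

lemma hasFDerivAt_rayCurve (h : C(X, V)) (h' : C(X, X →L[ℝ] V))
    (hh : ∀ x, HasFDerivAt h (h' x) x) (y : X) :
    HasFDerivAt (rayCurve h) (rayApply coeInterval (rayCurve h' y)) y := by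
  rw [hasFDerivAt_iff_isLittleO, Asymptotics.isLittleO_iff]
  intro ε hε
  obtain ⟨δ, hδ, hδ'⟩ := Metric.continuousAt_iff.1 (continuous_rayCurve h').continuousAt ε hε
  filter_upwards [Metric.ball_mem_nhds y hδ] with z hz
  rw [ContinuousMap.norm_le _ (by positivity)]
  intro t
  change ‖h ((t : ℝ) • z) - h ((t : ℝ) • y) - (t : ℝ) • h' ((t : ℝ) • y) (z - y)‖ ≤ _
  have key := Convex.norm_image_sub_le_of_norm_hasFDerivWithin_le'
    (f := fun w : X => h ((t : ℝ) • w)) (f' := fun w => (t : ℝ) • h' ((t : ℝ) • w))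
    (φ := (t : ℝ) • h' ((t : ℝ) • y)) (s := Metric.ball y δ) (C := ε) (x := y) (y := z)
    (fun w _ => by
      have := (hh ((t : ℝ) • w)).comp w ((hasFDerivAt_id w).const_smul (t : ℝ))
      refine (HasFDerivAt.congr_fderiv this ?_).hasFDerivWithinAt
      ext v; simp)
    (fun w hw => by
      rw [← smul_sub, norm_smul, Real.norm_of_nonneg t.2.1]
      have h1 := (hδ' hw).le
      rw [ContinuousMap.dist_le hε.le] at h1
      have h2 := h1 t
      rw [dist_eq_norm] at h2
      exact (mul_le_of_le_one_left (norm_nonneg _) t.2.2).trans h2)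
    (convex_ball y δ) (Metric.mem_ball_self hδ) hz
  simpa using key

lemma contDiff_rayCurve {n : ℕ} {h : X → V} (hh : ContDiff ℝ n h) :
    ContDiff ℝ n (rayCurve ⟨h, hh.continuous⟩) := by
  induction n generalizing V with
  | zero => exact contDiff_zero.2 (continuous_rayCurve _)
  | succ n ih =>
    have hd : ContDiff ℝ n (fderiv ℝ h) := hh.fderiv_right le_rfl
    refine (contDiff_succ_iff_hasFDerivAt (n := n)).2
      ⟨fun y => rayApply coeInterval (rayCurve ⟨fderiv ℝ h, hd.continuous⟩ y), ?_, fun y => ?_⟩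
    · exact (contDiff_rayApply _).comp (ih hd)
    · exact hasFDerivAt_rayCurve ⟨h, hh.continuous⟩ ⟨fderiv ℝ h, hd.continuous⟩
        (fun x => ((hh.differentiable (by simp)) x).hasFDerivAt) y

end RayCurve

/-! ### Parallel transport along rays -/

section Transport

attribute [local instance] NormedAlgebra.toNormedSpace

universe u

variable {X 𝔸 : Type u} [NormedAddCommGroup X] [NormedSpace ℝ X] [NormedRing 𝔸]
  [NormedAlgebra ℝ 𝔸]

/-- The restriction of a one-form to the ray through `y`, as the curve `t ↦ η (t • y) y`. -/
def formAlongRay (η : C(X, X →L[ℝ] 𝔸)) (y : X) : C(I, 𝔸) := rayApply 1 (rayCurve η y) y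

lemma formAlongRay_apply (η : C(X, X →L[ℝ] 𝔸)) (y : X) (t : I) :
    formAlongRay η y t = η ((t : ℝ) • y) y := one_smul _ _

lemma contDiff_formAlongRay {η : X → X →L[ℝ] 𝔸} (hη : ContDiff ℝ ∞ η) :
    ContDiff ℝ ∞ (formAlongRay ⟨η, hη.continuous⟩) := by
  refine contDiff_infty.2 fun n => ?_
  exact ((contDiff_rayApply 1).comp (contDiff_rayCurve (hη.of_le (by exact_mod_cast le_top)))).clm_apply
    contDiff_id

variable [NormedAlgebra ℂ 𝔸] [IsScalarTower ℝ ℂ 𝔸]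

/-- Solving `dH/dt = H (a θ + b β)` along all rays from the origin gives a function `H` that is
smooth in all variables and holomorphic in the parameters `a`, `b`. -/
theorem exists_radial_transport [CompleteSpace 𝔸] {θ β : X → X →L[ℝ] 𝔸} (hθ : ContDiff ℝ ∞ θ)
    (hβ : ContDiff ℝ ∞ β) :
    ∃ H : X → ℂ × ℂ → 𝔸, ContDiff ℝ ∞ (fun q : X × ℂ × ℂ => H q.1 q.2) ∧
      (∀ y, ContDiff ℂ ∞ (H y)) ∧ (∀ z, H 0 z = 1) ∧
      ∀ y z, ∀ t ∈ Set.Icc (0 : ℝ) 1, fderiv ℝ (H · z) (t • y) y =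
        H (t • y) z * (z.1 • θ (t • y) y + z.2 • β (t • y) y) := by
  obtain ⟨sol, hsol, hspec, huniq⟩ := exists_contDiff_volterra_solution (𝔸 := 𝔸)
  set A : X → ℂ × ℂ → C(I, 𝔸) := fun y z =>
    z.1 • formAlongRay ⟨θ, hθ.continuous⟩ y + z.2 • formAlongRay ⟨β, hβ.continuous⟩ y with hA
  have hAapp : ∀ y z (t : I), A y z t = z.1 • θ ((t : ℝ) • y) y + z.2 • β ((t : ℝ) • y) y := by
    intro y z t
    simp only [hA, ContinuousMap.add_apply, ContinuousMap.smul_apply, formAlongRay_apply]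
    rfl
  -- the solution along a shorter ray is the rescaled solution along the longer ray
  have hscale : ∀ y z (t s : I), sol (A ((t : ℝ) • y) z) s = sol (A y z) (t * s) := by
    intro y z t s
    set g : C(I, 𝔸) := (sol (A y z)).comp ⟨fun s : I => t * s, by fun_prop⟩ with hg
    have : g = sol (A ((t : ℝ) • y) z) := by
      refine huniq _ _ ?_
      ext s
      have h1 := congrArg (fun h : C(I, 𝔸) => h (t * s)) (hspec (A y z))
      simp only [ContinuousMap.add_apply, ContinuousMap.one_apply, primitive_apply] at h1
      simp only [ContinuousMap.add_apply, ContinuousMap.one_apply, primitive_apply]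
      refine h1.trans ?_
      congr 1
      have h2 := intervalIntegral.smul_integral_comp_mul_left (a := 0) (b := s)
        (Set.IccExtend zero_le_one ⇑(sol (A y z) * A y z)) (t : ℝ)
      rw [mul_zero] at h2
      rw [show ((t * s : I) : ℝ) = (t : ℝ) * s from rfl, ← h2, ← intervalIntegral.integral_smul]
      refine intervalIntegral.integral_congr fun u hu => ?_
      rw [Set.uIcc_of_le s.2.1] at hu
      have hu' : u ∈ I := ⟨hu.1, hu.2.trans s.2.2⟩
      have htu : (t : ℝ) * u ∈ I := (t * ⟨u, hu'⟩ : I).2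
      rw [Set.IccExtend_of_mem _ _ hu', Set.IccExtend_of_mem _ _ htu, ContinuousMap.mul_apply,
        ContinuousMap.mul_apply, hAapp, hAapp, ← mul_smul_comm]
      congr 1
      simp only [map_smul, smul_add, smul_smul, mul_comm u (t : ℝ)]
      rw [smul_comm (t : ℝ) z.1, smul_comm (t : ℝ) z.2]
    exact (congrArg (fun h : C(I, 𝔸) => h s) this).symm
  have hAsm : ContDiff ℝ ∞ (fun q : X × ℂ × ℂ => A q.1 q.2) := by
    have h1 := (contDiff_formAlongRay hθ).comp (contDiff_fst : ContDiff ℝ ∞ (Prod.fst : X × ℂ × ℂ → X))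
    have h2 := (contDiff_formAlongRay hβ).comp (contDiff_fst : ContDiff ℝ ∞ (Prod.fst : X × ℂ × ℂ → X))
    exact (contDiff_snd.fst.smul h1).add (contDiff_snd.snd.smul h2)
  have hev : ∀ (𝕜 : Type) [RCLike 𝕜] [NormedAlgebra 𝕜 𝔸] (t : I), ContDiff 𝕜 ∞ fun g : C(I, 𝔸) => g t := by
    intro 𝕜 _ _ t
    exact (ContinuousLinearMap.contDiff (𝕜 := 𝕜) (E := C(I, 𝔸)) (F := 𝔸) (ContinuousMap.evalCLM 𝕜 t))
  have hsm : ContDiff ℝ ∞ fun q : X × ℂ × ℂ => sol (A q.1 q.2) 1 :=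
    (hev ℝ 1).comp ((hsol.restrict_scalars ℝ).comp hAsm)
  refine ⟨fun y z => sol (A y z) 1, hsm, fun y => ?_, fun z => ?_, fun y z t ht => ?_⟩
  · refine (hev ℂ 1).comp (hsol.comp ?_)
    exact (contDiff_fst.smul contDiff_const).add (contDiff_snd.smul contDiff_const)
  · have h := hscale 0 z 0 1
    simp only [smul_zero, zero_mul] at h
    change sol (A 0 z) 1 = 1
    rw [h, hspec]
    simp [primitive_apply]
  · set G : ℝ → 𝔸 := Set.IccExtend zero_le_one ⇑(sol (A y z) * A y z) with hG
    have hGc : Continuous G := (sol (A y z) * A y z).continuous.Icc_extend'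
    have hval : ∀ u ∈ Set.Icc (0 : ℝ) 1, sol (A (u • y) z) 1 = 1 + ∫ s in (0 : ℝ)..u, G s := by
      intro u hu
      have := hscale y z ⟨u, hu⟩ 1
      rw [mul_one] at this
      refine this.trans ?_
      conv_lhs => rw [hspec]
      rfl
    have hder : HasDerivAt (fun u => 1 + ∫ s in (0 : ℝ)..u, G s) (G t) t :=
      (intervalIntegral.integral_hasDerivAt_right (hGc.intervalIntegrable _ _)
        (hGc.stronglyMeasurableAtFilter _ _) hGc.continuousAt).const_add 1
    have hGt : G t = sol (A (t • y) z) 1 * (z.1 • θ (t • y) y + z.2 • β (t • y) y) := by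
      have := hscale y z ⟨t, ht⟩ 1
      rw [mul_one] at this
      rw [hG, Set.IccExtend_of_mem _ _ ht, ContinuousMap.mul_apply, hAapp]
      rw [show sol (A (t • y) z) 1 = sol (A y z) ⟨t, ht⟩ from this]
    rw [← hGt]
    have hH : DifferentiableAt ℝ (fun y => sol (A y z) 1) (t • y) :=
      ((hsm.comp (contDiff_id.prodMk contDiff_const)).differentiable (by simp)) (t • y)
    have hcomp : HasDerivAt (fun u : ℝ => sol (A (u • y) z) 1)
        (fderiv ℝ (fun y => sol (A y z) 1) (t • y) y) t := by
      have h1 : HasDerivAt (fun u : ℝ => u • y) y t := by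
        simpa using (hasDerivAt_id t).smul_const y
      exact hH.hasFDerivAt.comp_hasDerivAt t h1
    exact (uniqueDiffOn_Icc zero_lt_one t ht).eq_deriv _ hcomp.hasDerivWithinAt
      (hder.hasDerivWithinAt.congr hval (hval t ht))

end Transport

section Uniqueness

variable {V : Type*} [NormedAddCommGroup V] [NormedSpace ℝ V]

/-- Uniqueness for homogeneous linear differential equations, from Grönwall's inequality. -/
lemma eq_zero_of_linear_ode {W : ℝ → V} {B : ℝ → V →L[ℝ] V} (hB : ContinuousOn B (Set.Icc 0 1))
    (hW : ∀ t ∈ Set.Icc (0 : ℝ) 1, HasDerivAt W (B t (W t)) t) (h0 : W 0 = 0) :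
    ∀ t ∈ Set.Icc (0 : ℝ) 1, W t = 0 := by
  obtain ⟨K, hK⟩ := isCompact_Icc.exists_bound_of_continuousOn hB
  exact eq_zero_of_abs_deriv_le_mul_abs_self_of_eq_zero_right
    (fun t ht => (hW t ht).continuousAt.continuousWithinAt)
    (fun t ht => (hW t ⟨ht.1, ht.2.le⟩).hasDerivWithinAt) h0
    (fun t ht => (B t).le_of_opNorm_le (hK t ⟨ht.1, ht.2.le⟩) (W t))

end Uniqueness

section Flat

variable {X 𝔸 : Type*} [NormedAddCommGroup X] [NormedSpace ℝ X] [NormedRing 𝔸]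
  [NormedAlgebra ℝ 𝔸]

lemma hasDerivAt_along_ray {V : Type*} [NormedAddCommGroup V] [NormedSpace ℝ V] {h : X → V}
    {y : X} {t : ℝ} (hh : DifferentiableAt ℝ h (t • y)) :
    HasDerivAt (fun u : ℝ => h (u • y)) (fderiv ℝ h (t • y) y) t := by
  have h1 : HasDerivAt (fun u : ℝ => u • y) y t := by
    simpa using (hasDerivAt_id t).smul_const y
  exact hh.hasFDerivAt.comp_hasDerivAt t h1

/-- If the connection form `η` is flat along the ray through `y`, then radial parallel transport
is parallel in all directions at `y`. -/
theorem fderiv_radial_transport_of_flat {H : X → 𝔸} {η : X → X →L[ℝ] 𝔸} (hH : ContDiff ℝ ∞ H)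
    (hη : ContDiff ℝ ∞ η)
    (hrad : ∀ y, ∀ t ∈ Set.Icc (0 : ℝ) 1, fderiv ℝ H (t • y) y = H (t • y) * η (t • y) y)
    (y : X) (hflat : ∀ t ∈ Set.Icc (0 : ℝ) 1, ∀ v w, fderiv ℝ η (t • y) v w -
      fderiv ℝ η (t • y) w v + (η (t • y) v * η (t • y) w - η (t • y) w * η (t • y) v) = 0)
    (v : X) : fderiv ℝ H y v = H y * η y v := by
  have hHd : Differentiable ℝ H := hH.differentiable (by simp)
  have hηd : Differentiable ℝ η := hη.differentiable (by simp)
  have hDH : Differentiable ℝ (fderiv ℝ H) :=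
    (hH.fderiv_right (m := ∞) (by simp)).differentiable (by simp)
  -- the radial equation, differentiated in the direction `v`
  have hG : ∀ x, fderiv ℝ (fderiv ℝ H) x v x + fderiv ℝ H x v =
      fderiv ℝ H x v * η x x + H x * (fderiv ℝ η x v x + η x v) := by
    intro x
    have e1 : HasFDerivAt (fun x => fderiv ℝ H x x) _ x :=
      (hDH x).hasFDerivAt.clm_apply (hasFDerivAt_id x)
    have e2 : HasFDerivAt (fun x => H x * η x x) _ x :=
      (hHd x).hasFDerivAt.mul' ((hηd x).hasFDerivAt.clm_apply (hasFDerivAt_id x))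
    have e3 : (fun x => fderiv ℝ H x x) = fun x => H x * η x x := by
      funext x
      have := hrad x 1 ⟨zero_le_one, le_rfl⟩
      rwa [one_smul] at this
    rw [e3] at e1
    have := congrArg (fun L => L v) (e1.unique e2)
    simp only [add_apply, ContinuousLinearMap.comp_apply, ContinuousLinearMap.flip_apply,
      smul_apply, ContinuousLinearMap.id_apply, smul_eq_mul, MulOpposite.smul_eq_mul_unop,
      MulOpposite.unop_op] at this
    rw [add_comm] at this
    rw [this]
    simp [add_comm]
  have hsymm : ∀ x, fderiv ℝ (fderiv ℝ H) x v y = fderiv ℝ (fderiv ℝ H) x y v := fun x =>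
    (hH.contDiffAt.isSymmSndFDerivAt (by
      rw [minSmoothness_of_isRCLikeNormedField]; exact WithTop.coe_le_coe.2 (le_top : (2 : ℕ∞) ≤ ⊤))) v y
  -- by flatness, `t (∂ᵥH - H η(v))` solves a homogeneous linear equation along the ray, and it
  -- vanishes at the origin
  have key := eq_zero_of_linear_ode
    (W := fun t => t • (fderiv ℝ H (t • y) v - H (t • y) * η (t • y) v))
    (B := fun t => (ContinuousLinearMap.mul ℝ 𝔸).flip (η (t • y) y)) ?_ ?_ (by simp) 1
    ⟨zero_le_one, le_rfl⟩
  · simpa [sub_eq_zero] using key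
  · have : Continuous fun t : ℝ => η (t • y) y := by
      have := hη.continuous
      fun_prop
    exact ((ContinuousLinearMap.mul ℝ 𝔸).flip.continuous.comp this).continuousOn
  · intro t ht
    have d1 : HasDerivAt (fun u : ℝ => fderiv ℝ H (u • y) v)
        (fderiv ℝ (fderiv ℝ H) (t • y) y v) t := by
      have := (hasDerivAt_along_ray (hDH (t • y))).clm_apply (hasDerivAt_const t v)
      simpa using this
    have d2 : HasDerivAt (fun u : ℝ => η (u • y) v) (fderiv ℝ η (t • y) y v) t := by
      have := (hasDerivAt_along_ray (hηd (t • y))).clm_apply (hasDerivAt_const t v)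
      simpa using this
    have d3 := (hasDerivAt_along_ray (hHd (t • y))).mul d2
    refine ((hasDerivAt_id t).smul (d1.sub d3)).congr_deriv ?_
    have g := hG (t • y)
    have f := hflat t ht v y
    rw [hrad y t ht]
    simp only [map_smul, hsymm] at g
    simp only [ContinuousLinearMap.flip_apply, ContinuousLinearMap.mul_apply', id, one_smul,
      Pi.sub_apply, Pi.mul_apply]
    generalize fderiv ℝ H (t • y) v = a at *
    generalize η (t • y) v = b at *
    generalize η (t • y) y = d at *
    generalize H (t • y) = h at *
    generalize fderiv ℝ η (t • y) v y = p at *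
    generalize fderiv ℝ η (t • y) y v = q at *
    generalize fderiv ℝ (fderiv ℝ H) (t • y) y v = r at *
    have f' : q = p + (b * d - d * b) := by rw [← sub_eq_zero, ← neg_eq_zero, ← f]; abel
    have g' : t • r = a * t • d + h * (t • p + b) - a := eq_sub_of_add_eq g
    rw [f', smul_sub, g']
    simp only [smul_sub, smul_add, mul_add, mul_sub, sub_mul, mul_smul_comm, smul_mul_assoc,
      mul_assoc]
    abel

end Flat

section LocalTransport

universe u

attribute [local instance] NormedAlgebra.toNormedSpace

lemma contDiff_smul_of_tsupport_subset {X V : Type*} [NormedAddCommGroup X] [NormedSpace ℝ X]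
    [NormedAddCommGroup V] [NormedSpace ℝ V] {χ : X → ℝ} {g : X → V} {Ω : Set X} (hΩ : IsOpen Ω)
    (hχ : ContDiff ℝ ∞ χ) (hsupp : tsupport χ ⊆ Ω) (hg : ContDiffOn ℝ ∞ g Ω) :
    ContDiff ℝ ∞ fun y => χ y • g y := by
  rw [contDiff_iff_contDiffAt]
  intro y
  by_cases hy : y ∈ Ω
  · exact hχ.contDiffAt.smul (hg.contDiffAt (hΩ.mem_nhds hy))
  · have h0 : χ =ᶠ[nhds y] 0 := notMem_tsupport_iff_eventuallyEq.1 fun h => hy (hsupp h)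
    refine (contDiffAt_const (c := (0 : V))).congr_of_eventuallyEq ?_
    filter_upwards [h0] with z hz
    rw [hz]
    simp

variable {X 𝔸 : Type u} [NormedAddCommGroup X] [NormedSpace ℝ X] [FiniteDimensional ℝ X]
  [NormedRing 𝔸] [NormedAlgebra ℝ 𝔸] [NormedAlgebra ℂ 𝔸] [IsScalarTower ℝ ℂ 𝔸] [CompleteSpace 𝔸]

/-- Local parallel transport along the rays from a point `y₀`, for the two-parameter family of
connection forms `a θ + b β`. Where a member of the family is flat, its radial transport is
parallel in all directions. -/
theorem exists_local_transport {θ β : X → X →L[ℝ] 𝔸} {Ω : Set X} (hΩ : IsOpen Ω)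
    (hθ : ContDiffOn ℝ ∞ θ Ω) (hβ : ContDiffOn ℝ ∞ β Ω) {y₀ : X} (hy₀ : y₀ ∈ Ω) :
    ∃ ρ > 0, Metric.ball y₀ ρ ⊆ Ω ∧ ∃ H : X → ℂ × ℂ → 𝔸,
      ContDiff ℝ ∞ (fun q : X × ℂ × ℂ => H q.1 q.2) ∧
      (∀ y, ContDiff ℂ ∞ (H y)) ∧ (∀ z, H y₀ z = 1) ∧
      (∀ u : X, ‖u‖ < ρ → ∀ z, ∀ t ∈ Set.Icc (0 : ℝ) 1,
        HasDerivAt (fun t : ℝ => H (y₀ + t • u) z) (H (y₀ + t • u) z *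
          (z.1 • θ (y₀ + t • u) u + z.2 • β (y₀ + t • u) u)) t) ∧
      ∀ z, (∀ y ∈ Ω, ∀ v w, fderiv ℝ (fun y => z.1 • θ y + z.2 • β y) y v w -
          fderiv ℝ (fun y => z.1 • θ y + z.2 • β y) y w v +
          ((z.1 • θ y v + z.2 • β y v) * (z.1 • θ y w + z.2 • β y w) -
            (z.1 • θ y w + z.2 • β y w) * (z.1 • θ y v + z.2 • β y v)) = 0) →
        ∀ y ∈ Metric.ball y₀ ρ, ∀ v,
          fderiv ℝ (H · z) y v = H y z * (z.1 • θ y v + z.2 • β y v) := by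
  obtain ⟨R, hR, hball⟩ := Metric.nhds_basis_closedBall.mem_iff.1 (hΩ.mem_nhds hy₀)
  -- the forms are cut off outside a small ball, to be defined on the whole space
  let χ : ContDiffBump y₀ := ⟨R / 2, R, by positivity, by linarith⟩
  have hsupp : tsupport χ ⊆ Ω := by rw [χ.tsupport_eq]; exact hball
  have hχ : ∀ y ∈ Metric.ball y₀ (R / 2), χ y = 1 := fun y hy =>
    χ.one_of_mem_closedBall (Metric.ball_subset_closedBall hy)
  have hsub : Metric.ball y₀ (R / 2) ⊆ Ω :=
    (Metric.ball_subset_closedBall.trans (Metric.closedBall_subset_closedBall (by linarith))).trans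
      hball
  have htr : ContDiff ℝ ∞ fun y : X => y₀ + y := contDiff_const.add contDiff_id
  set θ' : X → X →L[ℝ] 𝔸 := fun y => χ (y₀ + y) • θ (y₀ + y) with hθ'
  set β' : X → X →L[ℝ] 𝔸 := fun y => χ (y₀ + y) • β (y₀ + y) with hβ'
  have sθ : ContDiff ℝ ∞ θ' := (contDiff_smul_of_tsupport_subset hΩ χ.contDiff hsupp hθ).comp htr
  have sβ : ContDiff ℝ ∞ β' := (contDiff_smul_of_tsupport_subset hΩ χ.contDiff hsupp hβ).comp htr
  have eθ : ∀ y, y₀ + y ∈ Metric.ball y₀ (R / 2) → θ' y = θ (y₀ + y) := fun y hy => by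
    rw [hθ']; simp only; rw [hχ _ hy, one_smul]
  have eβ : ∀ y, y₀ + y ∈ Metric.ball y₀ (R / 2) → β' y = β (y₀ + y) := fun y hy => by
    rw [hβ']; simp only; rw [hχ _ hy, one_smul]
  obtain ⟨G, hG, hGz, hG0, hGr⟩ := exists_radial_transport sθ sβ
  have hGd : ∀ z, ContDiff ℝ ∞ (G · z) := fun z => hG.comp (contDiff_id.prodMk contDiff_const)
  have hmem : ∀ u : X, ‖u‖ < R / 2 → ∀ t ∈ Set.Icc (0 : ℝ) 1, y₀ + t • u ∈ Metric.ball y₀ (R / 2) := by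
    intro u hu t ht
    rw [Metric.mem_ball, dist_eq_norm, add_sub_cancel_left, norm_smul, Real.norm_of_nonneg ht.1]
    exact (mul_le_of_le_one_left (norm_nonneg _) ht.2).trans_lt hu
  refine ⟨R / 2, by positivity, hsub, fun y z => G (y - y₀) z, ?_, fun y => hGz _, fun z => ?_,
    fun u hu z t ht => ?_, fun z hflat y hy v => ?_⟩
  · exact hG.comp ((contDiff_fst.sub contDiff_const).prodMk contDiff_snd)
  · simp [hG0]
  · simp only [add_sub_cancel_left]
    have h1 := hasDerivAt_along_ray (h := (G · z)) (y := u) (t := t)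
      ((hGd z).differentiable (by simp) _)
    rw [hGr u z t ht, eθ _ (hmem u hu t ht), eβ _ (hmem u hu t ht)] at h1
    exact h1
  · rw [fderiv_comp_sub (f := (G · z)) y₀]
    have hu : ‖y - y₀‖ < R / 2 := by rwa [← dist_eq_norm]
    have hη : ContDiff ℝ ∞ fun y => z.1 • θ' y + z.2 • β' y :=
      ContDiff.add (f := fun y => z.1 • θ' y) (g := fun y => z.2 • β' y)
        (sθ.const_smul z.1) (sβ.const_smul z.2)
    have key := fderiv_radial_transport_of_flat (hGd z) hη
      (fun y t ht => by simpa using hGr y z t ht) (y - y₀) (fun t ht v w => ?_) v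
    · rw [key]
      have hy1 : y₀ + (y - y₀) ∈ Metric.ball y₀ (R / 2) := by rwa [add_sub_cancel]
      rw [eθ _ hy1, eβ _ hy1, add_sub_cancel]
      rfl
    · have hx := hmem _ hu t ht
      have hev : (fun y => z.1 • θ' y + z.2 • β' y) =ᶠ[nhds (t • (y - y₀))]
          fun y => (fun y => z.1 • θ y + z.2 • β y) (y₀ + y) := by
        have : ∀ᶠ y in nhds (t • (y - y₀)), y₀ + y ∈ Metric.ball y₀ (R / 2) :=
          (continuous_const.add continuous_id).continuousAt.eventually (Metric.isOpen_ball.mem_nhds hx)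
        filter_upwards [this] with y hy
        rw [eθ _ hy, eβ _ hy]
      have := hflat _ (hsub hx) v w
      rw [hev.fderiv_eq, fderiv_comp_add_left (f := fun y => z.1 • θ y + z.2 • β y), eθ _ hx, eβ _ hx]
      exact this

end LocalTransport

/-! ### Locally constant cocycles on simply connected spaces -/

/-- On a simply connected space, local sections `Ψ i` of a trivial bundle of groups which differ by
locally constant left factors can be glued, after multiplication by locally constant factors. The
local factors are sections of a covering space of `M`, which has a global section. -/
theorem exists_glue_of_locallyConstant {M G : Type*} [TopologicalSpace M] [SimplyConnectedSpace M]
    [LocallyPathConnectedSpace M] [Group G] (U : M → Set M) (hU : ∀ i, IsOpen (U i))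
    (hmem : ∀ i, i ∈ U i) (Ψ : M → M → G)
    (hΨ : ∀ i j, ∀ x ∈ U i ∩ U j, ∀ᶠ y in nhds x, Ψ i y * (Ψ j y)⁻¹ = Ψ i x * (Ψ j x)⁻¹) :
    ∃ Φ : M → G, ∀ i, ∀ x ∈ U i, ∀ᶠ y in nhds x, Φ y * (Ψ i y)⁻¹ = Φ x * (Ψ i x)⁻¹ := by
  let _ : TopologicalSpace G := ⊥
  have : DiscreteTopology G := ⟨rfl⟩
  -- the covering space whose sections over `U i` are the locally constant left factors of `Ψ i`
  let Z : FiberBundleCore M M G :=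
    { baseSet := U
      isOpen_baseSet := hU
      indexAt := id
      mem_baseSet_at := hmem
      coordChange := fun i j x g => g * (Ψ i x * (Ψ j x)⁻¹)
      coordChange_self := fun i x _ g => by simp
      continuousOn_coordChange := fun i j => by
        rintro ⟨x, g⟩ ⟨hx, -⟩
        refine ContinuousAt.continuousWithinAt ?_
        have h1 : (fun q : M × G => q.2 * (Ψ i q.1 * (Ψ j q.1)⁻¹)) =ᶠ[nhds (x, g)]
            fun q => q.2 * (Ψ i x * (Ψ j x)⁻¹) := by
          filter_upwards [(continuous_fst.tendsto (x, g)).eventually (hΨ i j x hx)] with q hq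
          rw [hq]
        refine ContinuousAt.congr ?_ h1.symm
        exact ((continuous_of_discreteTopology (f := fun g : G =>
          g * (Ψ i x * (Ψ j x)⁻¹))).comp continuous_snd).continuousAt
      coordChange_comp := fun i j l x _ g => by group }
  have hcov : IsCoveringMap (Bundle.TotalSpace.proj : Z.TotalSpace → M) :=
    FiberBundle.isCoveringMap (F := G) (E := Z.Fiber)
  obtain ⟨p⟩ : Nonempty M := inferInstance
  obtain ⟨s, ⟨-, hs⟩, -⟩ := hcov.existsUnique_continuousMap_lifts (ContinuousMap.id M) p
    (⟨p, (1 : G)⟩ : Z.TotalSpace) rfl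
  have hsx : ∀ x, (s x).1 = x := fun x => congrFun hs x
  refine ⟨fun x => (show G from (s x).2) * Ψ x x, fun i x hx => ?_⟩
  have hloc : ∀ y, ((Z.localTriv i) (s y)).2 = (show G from (s y).2) * Ψ y y * (Ψ i y)⁻¹ := by
    intro y
    rw [FiberBundleCore.localTriv_apply]
    change (show G from (s y).2) * (Ψ (s y).1 (s y).1 * (Ψ i (s y).1)⁻¹) = _
    rw [hsx y, mul_assoc]
  have hc : ContinuousAt (fun y => ((Z.localTriv i) (s y)).2) x := by
    refine continuous_snd.continuousAt.comp (ContinuousAt.comp ?_ s.continuous.continuousAt)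
    refine (Z.localTriv i).continuousAt ?_
    rw [FiberBundleCore.mem_localTriv_source, hsx]
    exact hx
  have := hc.eventually (IsOpen.mem_nhds (isOpen_discrete {((Z.localTriv i) (s x)).2}) rfl)
  filter_upwards [this] with y hy
  rw [← hloc, ← hloc]
  exact hy

/-! ### Pointwise algebra of the tangent projection -/

section TangentData

variable {X E : Type*} [NormedAddCommGroup X] [NormedSpace ℝ X] [NormedAddCommGroup E]
  [InnerProductSpace ℝ E]

/-- The first-order data at a point of a submanifold of the unit sphere: the position `f`, the
differential `D` of the immersion, the orthogonal projection `T` to the tangent space and the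
differential `T'` of `T`. -/
structure IsTangentData (f : E) (D : X →L[ℝ] E) (T : E →L[ℝ] E) (T' : X →L[ℝ] E →L[ℝ] E) :
    Prop where
  unit : ⟪f, f⟫_ℝ = 1
  inner_D : ∀ v, ⟪f, D v⟫_ℝ = 0
  proj_D : ∀ v, T (D v) = D v
  exists_D : ∀ u, ∃ v, T u = D v
  symm : ∀ a b, ⟪T a, b⟫_ℝ = ⟪a, T b⟫_ℝ
  proj_f : T f = 0
  leibniz : ∀ v u, T' v (T u) + T (T' v u) = T' v u
  symm' : ∀ v a b, ⟪T' v a, b⟫_ℝ = ⟪a, T' v b⟫_ℝ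
  deriv_f : ∀ v, T' v f = -D v
  deriv_D : ∀ v w, T' v (D w) = T' w (D v)

/-- The outer product `x ⊗ y`, that is `u ↦ ⟪y, u⟫ x`, as a real bilinear map. -/
def outer : E →L[ℝ] E →L[ℝ] E →L[ℝ] E :=
  LinearMap.mkContinuous₂ (LinearMap.mk₂ ℝ (fun x y : E => InnerProductSpace.rankOne ℝ x y)
    (fun x x' y => by ext; simp)
    (fun z x y => by ext1 u; exact smul_comm _ _ _)
    (fun x y y' => by ext; simp)
    (fun z x y => by ext; simp)) 1 (fun x y => by simp)

@[simp]
lemma outer_apply (x y u : E) : outer x y u = ⟪y, u⟫_ℝ • x := rfl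

/-- The infinitesimal rotation `y ⊗ x - x ⊗ y`, as a bilinear map of `x` and `y`. -/
def wedge : E →L[ℝ] E →L[ℝ] E →L[ℝ] E :=
  (outer (E := E)).flip - outer

lemma wedge_apply (x y : E) : wedge x y = outer y x - outer x y := rfl

/-- The part `θ` of the connection form, exchanging the tangent space and the position vector. -/
def thetaForm (f : E) (D : X →L[ℝ] E) : X →L[ℝ] E →L[ℝ] E :=
  wedge f ∘L D

lemma thetaForm_apply (f : E) (D : X →L[ℝ] E) (v : X) (u : E) :
    thetaForm f D v u = ⟪f, u⟫_ℝ • D v - ⟪D v, u⟫_ℝ • f := by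
  simp [thetaForm, wedge_apply]

lemma inner_thetaForm (f : E) (D : X →L[ℝ] E) (v : X) (a b : E) :
    ⟪thetaForm f D v a, b⟫_ℝ = -⟪a, thetaForm f D v b⟫_ℝ := by
  simp only [thetaForm_apply, inner_sub_left, inner_sub_right, inner_smul_left, inner_smul_right,
    conj_trivial]
  rw [real_inner_comm a f, real_inner_comm a (D v)]
  ring

/-- The commutator `[B, A]`, as a bilinear map of `A` and `B`. -/
def revCommutator : (E →L[ℝ] E) →L[ℝ] (E →L[ℝ] E) →L[ℝ] E →L[ℝ] E :=
  (ContinuousLinearMap.mul ℝ (E →L[ℝ] E)).flip - ContinuousLinearMap.mul ℝ (E →L[ℝ] E)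

/-- The commutator `[T', T]`: the part of the connection form that exchanges the tangent space
and its orthogonal complement. -/
def rhoForm (T : E →L[ℝ] E) (T' : X →L[ℝ] E →L[ℝ] E) : X →L[ℝ] E →L[ℝ] E :=
  revCommutator T ∘L T'

lemma rhoForm_apply (T : E →L[ℝ] E) (T' : X →L[ℝ] E →L[ℝ] E) (v : X) (u : E) :
    rhoForm T T' v u = T' v (T u) - T (T' v u) := rfl

/-- The part `β` of the connection form, exchanging the tangent space and the normal space. -/
def betaForm (f : E) (D : X →L[ℝ] E) (T : E →L[ℝ] E) (T' : X →L[ℝ] E →L[ℝ] E) :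
    X →L[ℝ] E →L[ℝ] E :=
  rhoForm T T' - thetaForm f D

lemma betaForm_apply (f : E) (D : X →L[ℝ] E) (T : E →L[ℝ] E) (T' : X →L[ℝ] E →L[ℝ] E) (v : X)
    (u : E) : betaForm f D T T' v u =
      T' v (T u) - T (T' v u) - (⟪f, u⟫_ℝ • D v - ⟪D v, u⟫_ℝ • f) := by
  rw [betaForm, sub_apply, sub_apply, rhoForm_apply, thetaForm_apply]

namespace IsTangentData

variable {f : E} {D : X →L[ℝ] E} {T : E →L[ℝ] E} {T' : X →L[ℝ] E →L[ℝ] E}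
  (h : IsTangentData f D T T')
include h

lemma inner_D' (v : X) : ⟪D v, f⟫_ℝ = 0 := by rw [real_inner_comm]; exact h.inner_D v

lemma proj_proj (u : E) : T (T u) = T u := by
  obtain ⟨v, hv⟩ := h.exists_D u
  rw [hv, h.proj_D]

lemma proj_deriv_proj (v : X) (u : E) : T (T' v (T u)) = 0 := by
  have := h.leibniz v (T u)
  rw [h.proj_proj] at this
  simpa using this

lemma proj_deriv_D (v w : X) : T (T' v (D w)) = 0 := by
  have := h.proj_deriv_proj v (D w)
  rwa [h.proj_D] at this

lemma norm_f : ‖f‖ = 1 := by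
  have := h.unit
  rw [real_inner_self_eq_norm_sq] at this
  exact (pow_eq_one_iff_of_nonneg (norm_nonneg _) two_ne_zero).1 this

lemma betaForm_f (v : X) : betaForm f D T T' v f = 0 := by
  simp [betaForm_apply, h.proj_f, h.deriv_f, h.proj_D, h.norm_f, h.inner_D']

lemma betaForm_D (v w : X) : betaForm f D T T' v (D w) = T' v (D w) + ⟪D v, D w⟫_ℝ • f := by
  simp [betaForm_apply, h.proj_D, h.proj_deriv_D, h.inner_D]

lemma betaForm_symm (v w : X) : betaForm f D T T' v (D w) = betaForm f D T T' w (D v) := by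
  rw [h.betaForm_D, h.betaForm_D, h.deriv_D, real_inner_comm]

lemma inner_betaForm (v : X) (a b : E) :
    ⟪betaForm f D T T' v a, b⟫_ℝ = -⟪a, betaForm f D T T' v b⟫_ℝ := by
  rw [betaForm, sub_apply, sub_apply, sub_apply, inner_sub_left, inner_sub_right,
    inner_thetaForm, rhoForm_apply, rhoForm_apply, inner_sub_left, inner_sub_right, h.symm',
    h.symm, h.symm, h.symm']
  ring

/-- The mixed bracket `[θ, β]` vanishes, by symmetry of the second fundamental form. -/
lemma mixed_bracket (v w : X) :
    thetaForm f D v * betaForm f D T T' w - betaForm f D T T' w * thetaForm f D v +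
      (betaForm f D T T' v * thetaForm f D w - thetaForm f D w * betaForm f D T T' v) = 0 := by
  have key : ∀ v w u, (thetaForm f D v * betaForm f D T T' w -
      betaForm f D T T' w * thetaForm f D v) u =
      ⟪betaForm f D T T' w (D v), u⟫_ℝ • f - ⟪f, u⟫_ℝ • betaForm f D T T' w (D v) := by
    intro v w u
    rw [sub_apply, mul_apply_eq_comp, mul_apply_eq_comp, thetaForm_apply, thetaForm_apply,
      map_sub, map_smul, map_smul, h.betaForm_f, h.inner_betaForm, ← neg_neg ⟪f, _⟫_ℝ,
      ← h.inner_betaForm, h.betaForm_f]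
    simp
  ext1 u
  have e : betaForm f D T T' v * thetaForm f D w - thetaForm f D w * betaForm f D T T' v =
    -(thetaForm f D w * betaForm f D T T' v - betaForm f D T T' v * thetaForm f D w) := by abel
  rw [e, add_apply, neg_apply, key, key, h.betaForm_symm]
  simp

lemma thetaForm_bracket_D (v w z : X) :
    (thetaForm f D v * thetaForm f D w - thetaForm f D w * thetaForm f D v) (D z) =
      ⟪D v, D z⟫_ℝ • D w - ⟪D w, D z⟫_ℝ • D v := by
  simp [thetaForm_apply, inner_smul_right, h.inner_D, h.inner_D', h.norm_f]
  abel

lemma inner_D_of_proj_eq_zero {n : E} (hn : T n = 0) (v : X) : ⟪D v, n⟫_ℝ = 0 := by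
  rw [← h.proj_D, h.symm, hn, inner_zero_right]

/-- The Gauss and Ricci equations for a submanifold of constant curvature `c` of the unit sphere
with flat normal bundle, as one equation for the brackets of `β` and `θ`. -/
theorem betaForm_bracket {c : ℝ}
    (gauss : ∀ v w z, T (T' v (T' w (D z)) - T' w (T' v (D z))) =
      c • (⟪D w, D z⟫_ℝ • D v - ⟪D v, D z⟫_ℝ • D w))
    (ricci : ∀ v w n, T n = 0 → ⟪f, n⟫_ℝ = 0 →
      T' v (T' w n) - T' w (T' v n) - T (T' v (T' w n) - T' w (T' v n))
        - ⟪f, T' v (T' w n) - T' w (T' v n)⟫_ℝ • f = 0) (v w : X) :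
    betaForm f D T T' v * betaForm f D T T' w - betaForm f D T T' w * betaForm f D T T' v =
      (c - 1) • (thetaForm f D v * thetaForm f D w - thetaForm f D w * thetaForm f D v) := by
  have inner_f : ∀ v n, ⟪f, T' v n⟫_ℝ = -⟪D v, n⟫_ℝ := fun v n => by
    rw [← h.symm', h.deriv_f, inner_neg_left]
  -- the values on tangent vectors, where the identity is the Gauss equation
  have hD : ∀ v w z, betaForm f D T T' v (betaForm f D T T' w (D z)) =
      ⟪D w, D z⟫_ℝ • D v - T (T' v (T' w (D z))) := by
    intro v w z
    rw [h.betaForm_D w, map_add, map_smul, h.betaForm_f, betaForm_apply, h.proj_deriv_D, inner_f,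
      h.inner_D_of_proj_eq_zero (h.proj_deriv_D w z)]
    simp
    abel
  -- the values on normal vectors, where the identity is the Ricci equation
  have hN : ∀ v w n, T n = 0 → ⟪f, n⟫_ℝ = 0 → betaForm f D T T' v (betaForm f D T T' w n) =
      -(T' v (T' w n)) - ⟪D v, T' w n⟫_ℝ • f := by
    intro v w n hn hfn
    have h0 : T (T' w n) = T' w n := by simpa [hn] using h.leibniz w n
    have h1 : betaForm f D T T' w n = -T' w n := by
      simp [betaForm_apply, hn, h0, hfn, h.inner_D_of_proj_eq_zero hn]
    obtain ⟨z, hz⟩ := h.exists_D (T' w n)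
    rw [h1, map_neg, ← h0, hz, h.betaForm_D]
    abel
  have hNN : ∀ v w n, T n = 0 → ⟪f, n⟫_ℝ = 0 → T' v (T' w n) - T' w (T' v n) = 0 := by
    intro v w n hn hfn
    have h0 : ∀ w, T (T' w n) = T' w n := fun w => by simpa [hn] using h.leibniz w n
    have h1 : ∀ v w, T (T' v (T' w n)) = 0 := fun v w => by
      rw [← h0 w]; exact h.proj_deriv_proj v _
    have h2 : ⟪f, T' v (T' w n) - T' w (T' v n)⟫_ℝ = 0 := by
      rw [inner_sub_right, inner_f, inner_f, ← h.symm', ← h.symm', h.deriv_D]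
      ring
    have := ricci v w n hn hfn
    rwa [h2, map_sub, h1, h1, sub_zero, sub_zero, zero_smul, sub_zero] at this
  ext1 u
  obtain ⟨z, hz⟩ := h.exists_D u
  have hdec : u = D z + ⟪f, u⟫_ℝ • f + (u - T u - ⟪f, u⟫_ℝ • f) := by rw [← hz]; abel
  have hn : T (u - T u - ⟪f, u⟫_ℝ • f) = 0 := by simp [h.proj_proj, h.proj_f]
  have hfn : ⟪f, u - T u - ⟪f, u⟫_ℝ • f⟫_ℝ = 0 := by
    rw [inner_sub_right, inner_sub_right, hz, h.inner_D, inner_smul_right, h.unit]; ring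
  generalize u - T u - ⟪f, u⟫_ℝ • f = n at hdec hn hfn
  generalize ⟪f, u⟫_ℝ = q at hdec
  have hDn : ∀ v, ⟪D v, n⟫_ℝ = 0 := h.inner_D_of_proj_eq_zero hn
  have tn : ∀ v, thetaForm f D v n = 0 := fun v => by simp [thetaForm_apply, hfn, hDn]
  have tf : ∀ v, thetaForm f D v f = D v := fun v => by simp [thetaForm_apply, h.norm_f, h.inner_D']
  have ttf : ∀ v w, thetaForm f D v (D w) = -⟪D v, D w⟫_ℝ • f := fun v w => by
    simp [thetaForm_apply, h.inner_D]
  rw [hdec, map_add, map_add, map_add, map_add, smul_apply, h.thetaForm_bracket_D]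
  have e1 : (betaForm f D T T' v * betaForm f D T T' w -
      betaForm f D T T' w * betaForm f D T T' v) (D z) =
      (c - 1) • (⟪D v, D z⟫_ℝ • D w - ⟪D w, D z⟫_ℝ • D v) := by
    rw [sub_apply, mul_apply_eq_comp, mul_apply_eq_comp, hD, hD]
    have := gauss v w z
    rw [map_sub, sub_eq_iff_eq_add] at this
    rw [this]
    module
  have e2 : (betaForm f D T T' v * betaForm f D T T' w -
      betaForm f D T T' w * betaForm f D T T' v) (q • f) = 0 := by
    simp [h.betaForm_f]
  have e3 : (betaForm f D T T' v * betaForm f D T T' w -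
      betaForm f D T T' w * betaForm f D T T' v) n = 0 := by
    rw [sub_apply, mul_apply_eq_comp, mul_apply_eq_comp, hN _ _ _ hn hfn, hN _ _ _ hn hfn,
      ← h.symm', ← h.symm', h.deriv_D v w, sub_eq_zero.1 (hNN v w n hn hfn)]
    abel
  have e4 : (thetaForm f D v * thetaForm f D w - thetaForm f D w * thetaForm f D v) (q • f) = 0 := by
    rw [map_smul, sub_apply, mul_apply_eq_comp, mul_apply_eq_comp, tf, tf, ttf, ttf,
      real_inner_comm]
    simp
  have e5 : (thetaForm f D v * thetaForm f D w - thetaForm f D w * thetaForm f D v) n = 0 := by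
    rw [sub_apply, mul_apply_eq_comp, mul_apply_eq_comp, tn, tn]; simp
  rw [e1, e2, e3, smul_apply, smul_apply, e4, e5]
  simp

end IsTangentData

end TangentData

/-- Polarisation: a bilinear expression with the symmetries of a product of second fundamental
forms is totally symmetric as soon as the associated sectional curvatures vanish. -/
lemma eq_of_sectional_eq {X : Type*} [Add X] {B : X → X → X → X → ℝ}
    (hadd : ∀ a a' b c d, B (a + a') b c d = B a b c d + B a' b c d)
    (h12 : ∀ a b c d, B a b c d = B b a c d) (hpair : ∀ a b c d, B a b c d = B c d a b)
    (hsec : ∀ v w, B w w v v = B v w v w) (w z v u : X) : B w z v u = B v z w u := by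
  have h34 : ∀ a b c d, B a b c d = B a b d c := fun a b c d => by
    rw [hpair, h12, hpair]
  have hadd2 : ∀ a b b' c d, B a (b + b') c d = B a b c d + B a b' c d := fun a b b' c d => by
    rw [h12, hadd, h12, h12 b']
  have hadd3 : ∀ a b c c' d, B a b (c + c') d = B a b c d + B a b c' d := fun a b c c' d => by
    rw [hpair, hadd, hpair, hpair c']
  have hadd4 : ∀ a b c d d', B a b c (d + d') = B a b c d + B a b c d' := fun a b c d d' => by
    rw [h34, hadd3, h34, h34 _ _ d']
  -- polarisation of `hsec` in `w`, and then in `v`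
  have s1 : ∀ w z v, B w z v v = B v w v z := by
    intro w z v
    have := hsec v (w + z)
    simp only [hadd, hadd2, hadd4] at this
    have a1 := hsec v w
    have a2 := hsec v z
    have a3 := h12 z w v v
    have a4 := hpair v z v w
    linarith
  have s2 : ∀ w z v u, 2 * B w z v u = B v w u z + B u w v z := by
    intro w z v u
    have := s1 w z (v + u)
    simp only [hadd, hadd3, hadd4] at this
    have a1 := s1 w z v
    have a2 := s1 w z u
    have a3 := h34 w z u v
    linarith
  have b1 := s2 w z v u
  have b2 := s2 v z w u
  have b3 := h12 w v u z
  have b4 := h12 u v w z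
  have b5 := hpair v u w z
  have b6 := h12 u w v z
  have b7 := hpair u w v z
  have b8 := h34 w z v u
  have b9 := h34 v z w u
  have c1 := h34 v z u w
  have c2 := h34 w z u v
  have c3 := h12 v w u z
  have c4 := hpair w z v u
  have c5 := h12 v u w z
  linarith

/-! ### The tangent projection of an immersion -/

section TangentProj

variable {X E : Type*} [NormedAddCommGroup X] [InnerProductSpace ℝ X] [FiniteDimensional ℝ X]
  [NormedAddCommGroup E] [InnerProductSpace ℝ E] [FiniteDimensional ℝ E]

/-- The orthogonal projection to the range of `D`. -/
def tangentProj {X : Type*} [AddCommGroup X] [Module ℝ X] [TopologicalSpace X] (D : X →L[ℝ] E) :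
    E →L[ℝ] E :=
  (LinearMap.range (D : X →ₗ[ℝ] E)).starProjection

lemma tangentProj_unique {X : Type*} [AddCommGroup X] [Module ℝ X] [TopologicalSpace X]
    (D : X →L[ℝ] E) {T : E →L[ℝ] E} (h1 : ∀ u, ∃ v, T u = D v)
    (h2 : ∀ u v, ⟪D v, u - T u⟫_ℝ = 0) : tangentProj D = T := by
  ext1 u
  obtain ⟨v, hv⟩ := h1 u
  refine Submodule.eq_starProjection_of_mem_of_inner_eq_zero
    (K := LinearMap.range (D : X →ₗ[ℝ] E)) (u := u) (v := T u) ?_ ?_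
  · exact ⟨v, hv.symm⟩
  · rintro _ ⟨w, rfl⟩
    rw [real_inner_comm]
    exact h2 u w

lemma isUnit_gram {D : X →L[ℝ] E} (hD : Function.Injective D) :
    IsUnit (ContinuousLinearMap.adjoint D ∘L D) := by
  have hinj : Function.Injective (ContinuousLinearMap.adjoint D ∘L D) := by
    rw [injective_iff_map_eq_zero]
    intro v hv
    have : ⟪D v, D v⟫_ℝ = 0 := by
      rw [← ContinuousLinearMap.adjoint_inner_right]
      simp only [ContinuousLinearMap.comp_apply] at hv
      rw [hv, inner_zero_right]
    exact hD (by rw [inner_self_eq_zero.1 this, map_zero])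
  exact ContinuousLinearMap.isUnit_iff_bijective.2
    ⟨hinj, LinearMap.surjective_of_injective
      (f := ((ContinuousLinearMap.adjoint D ∘L D : X →L[ℝ] X) : X →ₗ[ℝ] X)) hinj⟩

/-- The coordinates, with respect to `D`, of the tangential part of a vector. -/
def tangentCoord (D : X →L[ℝ] E) : E →L[ℝ] X :=
  Ring.inverse (ContinuousLinearMap.adjoint D ∘L D) ∘L ContinuousLinearMap.adjoint D

lemma gram_tangentCoord {D : X →L[ℝ] E} (hD : Function.Injective D) (u : E) :
    ContinuousLinearMap.adjoint D (D (tangentCoord D u)) = ContinuousLinearMap.adjoint D u :=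
  congrArg (fun L : X →L[ℝ] X => L (ContinuousLinearMap.adjoint D u))
    (Ring.mul_inverse_cancel _ (isUnit_gram hD))

lemma tangentProj_eq {D : X →L[ℝ] E} (hD : Function.Injective D) :
    tangentProj D = D ∘L tangentCoord D := by
  refine tangentProj_unique D (fun u => ⟨_, rfl⟩) fun u v => ?_
  rw [← ContinuousLinearMap.adjoint_inner_right, map_sub, ContinuousLinearMap.comp_apply,
    gram_tangentCoord hD, sub_self, inner_zero_right]

lemma tangentProj_comp {X' : Type*} [AddCommGroup X'] [Module ℝ X'] [TopologicalSpace X']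
    {X'' : Type*} [AddCommGroup X''] [Module ℝ X''] [TopologicalSpace X'']
    (D : X' →L[ℝ] E) {J : X'' →L[ℝ] X'}
    (hJ : Function.Surjective J) : tangentProj (D ∘L J) = tangentProj D := by
  refine tangentProj_unique _ (fun u => ?_) fun u v => ?_
  · obtain ⟨v, hv⟩ := Submodule.starProjection_apply_mem (LinearMap.range (D : X' →ₗ[ℝ] E)) u
    obtain ⟨w, rfl⟩ := hJ v
    exact ⟨w, hv.symm⟩
  · exact Submodule.inner_right_of_mem_orthogonal (K := LinearMap.range (D : X' →ₗ[ℝ] E))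
      ⟨J v, rfl⟩ (Submodule.sub_starProjection_mem_orthogonal u)

variable {φ : X → E} {Ω : Set X}

lemma contDiffOn_fderiv (hΩ : IsOpen Ω) {V : Type*} [NormedAddCommGroup V] [NormedSpace ℝ V]
    {h : X → V} (hh : ContDiffOn ℝ ∞ h Ω) : ContDiffOn ℝ ∞ (fderiv ℝ h) Ω :=
  hh.fderiv_of_isOpen hΩ (by simp)

lemma contDiffOn_adjoint {D : X → X →L[ℝ] E} (hD : ContDiffOn ℝ ∞ D Ω) :
    ContDiffOn ℝ ∞ (fun y => ContinuousLinearMap.adjoint (D y)) Ω := by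
  let L : (X →L[ℝ] E) →L[ℝ] (E →L[ℝ] X) :=
    LinearMap.toContinuousLinearMap
      { toFun := fun D => ContinuousLinearMap.adjoint D
        map_add' := fun a b => map_add _ a b
        map_smul' := fun z a => by simp }
  exact L.contDiff.comp_contDiffOn hD

lemma contDiffOn_tangentCoord {D : X → X →L[ℝ] E} (hD : ContDiffOn ℝ ∞ D Ω)
    (hinj : ∀ y ∈ Ω, Function.Injective (D y)) : ContDiffOn ℝ ∞ (fun y => tangentCoord (D y)) Ω := by
  have ha := contDiffOn_adjoint hD
  refine ContDiffOn.clm_comp ?_ ha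
  intro y hy
  obtain ⟨g, hg⟩ := isUnit_gram (hinj y hy)
  have h1 : ContDiffAt ℝ ∞ Ring.inverse (ContinuousLinearMap.adjoint (D y) ∘L D y) :=
    hg ▸ contDiffAt_ringInverse ℝ g
  exact h1.comp_contDiffWithinAt y ((ha.clm_comp hD) y hy)

lemma contDiffOn_tangentProj {D : X → X →L[ℝ] E} (hD : ContDiffOn ℝ ∞ D Ω)
    (hinj : ∀ y ∈ Ω, Function.Injective (D y)) : ContDiffOn ℝ ∞ (fun y => tangentProj (D y)) Ω :=
  (hD.clm_comp (contDiffOn_tangentCoord hD hinj)).congr fun y hy => tangentProj_eq (hinj y hy)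

/-- An immersion of an open set into the unit sphere. -/
structure IsLocalImmersion (φ : X → E) (Ω : Set X) : Prop where
  isOpen : IsOpen Ω
  smooth : ContDiffOn ℝ ∞ φ Ω
  unit : ∀ y ∈ Ω, ⟪φ y, φ y⟫_ℝ = 1
  injective : ∀ y ∈ Ω, Function.Injective (fderiv ℝ φ y)

/-- The field of tangent projections of a parametrised submanifold. -/
def projField (φ : X → E) (y : X) : E →L[ℝ] E := tangentProj (fderiv ℝ φ y)

namespace IsLocalImmersion

variable (h : IsLocalImmersion φ Ω)
include h

lemma smooth_fderiv : ContDiffOn ℝ ∞ (fderiv ℝ φ) Ω := contDiffOn_fderiv h.isOpen h.smooth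

lemma smooth_proj : ContDiffOn ℝ ∞ (projField φ) Ω :=
  contDiffOn_tangentProj h.smooth_fderiv h.injective

lemma smooth_fderiv_proj : ContDiffOn ℝ ∞ (fderiv ℝ (projField φ)) Ω :=
  contDiffOn_fderiv h.isOpen h.smooth_proj

variable {y : X} (hy : y ∈ Ω)
include hy

lemma hasFDerivAt {V : Type*} [NormedAddCommGroup V] [NormedSpace ℝ V]
    {g : X → V} (hg : ContDiffOn ℝ ∞ g Ω) : HasFDerivAt g (fderiv ℝ g y) y :=
  ((hg.differentiableOn (by simp)).differentiableAt (h.isOpen.mem_nhds hy)).hasFDerivAt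

lemma eventually_mem : ∀ᶠ z in nhds y, z ∈ Ω := h.isOpen.mem_nhds hy

lemma fderiv_symm {V : Type*} [NormedAddCommGroup V] [NormedSpace ℝ V]
    {g : X → V} (hg : ContDiffOn ℝ ∞ g Ω) (v w : X) :
    fderiv ℝ (fderiv ℝ g) y v w = fderiv ℝ (fderiv ℝ g) y w v :=
  (hg.contDiffAt (h.isOpen.mem_nhds hy)).isSymmSndFDerivAt (by
    rw [minSmoothness_of_isRCLikeNormedField]
    exact WithTop.coe_le_coe.2 (le_top : (2 : ℕ∞) ≤ ⊤)) v w

lemma inner_fderiv (v : X) : ⟪φ y, fderiv ℝ φ y v⟫_ℝ = 0 := by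
  have h1 := (h.hasFDerivAt hy h.smooth).inner ℝ (h.hasFDerivAt hy h.smooth)
  have h2 : HasFDerivAt (fun z => ⟪φ z, φ z⟫_ℝ) (0 : X →L[ℝ] ℝ) y :=
    (hasFDerivAt_const (1 : ℝ) y).congr_of_eventuallyEq
      ((h.eventually_mem hy).mono fun z hz => h.unit z hz)
  have := congrArg (fun L : X →L[ℝ] ℝ => L v) (h1.unique h2)
  simp only [ContinuousLinearMap.comp_apply, ContinuousLinearMap.prod_apply,
    fderivInnerCLM_apply, zero_apply] at this
  rw [real_inner_comm (φ y)] at this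
  linarith

lemma proj_fderiv (v : X) : projField φ y (fderiv ℝ φ y v) = fderiv ℝ φ y v :=
  Submodule.starProjection_eq_self_iff.2 ⟨v, rfl⟩

lemma proj_self : projField φ y (φ y) = 0 := by
  rw [projField, tangentProj, Submodule.starProjection_apply_eq_zero_iff,
    Submodule.mem_orthogonal']
  rintro _ ⟨v, rfl⟩
  exact h.inner_fderiv hy v

lemma fderiv_proj_fderiv (v w : X) : fderiv ℝ (projField φ) y v (fderiv ℝ φ y w) +
    projField φ y (fderiv ℝ (fderiv ℝ φ) y v w) = fderiv ℝ (fderiv ℝ φ) y v w := by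
  have hD := (h.hasFDerivAt hy h.smooth_fderiv).clm_apply (hasFDerivAt_const w y)
  have h1 := (h.hasFDerivAt hy h.smooth_proj).clm_apply hD
  have h2 := hD.congr_of_eventuallyEq
    ((h.eventually_mem hy).mono fun z hz => h.proj_fderiv hz w)
  have := congrArg (fun L : X →L[ℝ] E => L v) (h1.unique h2)
  simpa [add_comm] using this

lemma isTangentData :
    IsTangentData (φ y) (fderiv ℝ φ y) (projField φ y) (fderiv ℝ (projField φ) y) where
  unit := h.unit y hy
  inner_D := h.inner_fderiv hy
  proj_D := h.proj_fderiv hy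
  exists_D u := by
    obtain ⟨v, hv⟩ := Submodule.starProjection_apply_mem
      (LinearMap.range (fderiv ℝ φ y : X →ₗ[ℝ] E)) u
    exact ⟨v, hv.symm⟩
  symm a b := Submodule.inner_starProjection_left_eq_right _ a b
  proj_f := h.proj_self hy
  leibniz v u := by
    have h0 := (h.hasFDerivAt hy h.smooth_proj).clm_apply (hasFDerivAt_const u y)
    have h1 := (h.hasFDerivAt hy h.smooth_proj).clm_apply h0
    have hpp : ∀ z, projField φ z (projField φ z u) = projField φ z u := fun z =>
      Submodule.starProjection_eq_self_iff.2
        (Submodule.starProjection_apply_mem (LinearMap.range (fderiv ℝ φ z : X →ₗ[ℝ] E)) u)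
    have h2 := h0.congr_of_eventuallyEq (f₁ := fun z => projField φ z (projField φ z u))
      (Filter.Eventually.of_forall hpp)
    have := congrArg (fun L : X →L[ℝ] E => L v) (h1.unique h2)
    simpa [add_comm] using this
  symm' v a b := by
    have h0 := (h.hasFDerivAt hy h.smooth_proj).clm_apply (hasFDerivAt_const a y)
    have h1 := (h.hasFDerivAt hy h.smooth_proj).clm_apply (hasFDerivAt_const b y)
    have h2 := h0.inner ℝ (hasFDerivAt_const b y)
    have h3 := (hasFDerivAt_const a y).inner ℝ h1
    have h4 : (fun z => ⟪projField φ z a, b⟫_ℝ) = fun z => ⟪a, projField φ z b⟫_ℝ := by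
      funext z
      exact Submodule.inner_starProjection_left_eq_right _ a b
    rw [h4] at h2
    have := congrArg (fun L : X →L[ℝ] ℝ => L v) (h2.unique h3)
    simpa using this
  deriv_f v := by
    have h1 := (h.hasFDerivAt hy h.smooth_proj).clm_apply (h.hasFDerivAt hy h.smooth)
    have h2 := (hasFDerivAt_const (𝕜 := ℝ) (0 : E) y).congr_of_eventuallyEq
      (f₁ := fun z => projField φ z (φ z))
      ((h.eventually_mem hy).mono fun z hz => h.proj_self hz)
    have := congrArg (fun L : X →L[ℝ] E => L v) (h1.unique h2)
    simp only [add_apply, ContinuousLinearMap.comp_apply, ContinuousLinearMap.flip_apply,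
      zero_apply, h.proj_fderiv hy] at this
    exact eq_neg_of_add_eq_zero_right this
  deriv_D v w := by
    have h1 := h.fderiv_proj_fderiv hy v w
    have h2 := h.fderiv_proj_fderiv hy w v
    rw [h.fderiv_symm hy h.smooth w v] at h2
    exact add_right_cancel (h1.trans h2.symm)

end IsLocalImmersion

/-- The form `θ` of a parametrised submanifold. -/
def thetaField (φ : X → E) (y : X) : X →L[ℝ] E →L[ℝ] E := thetaForm (φ y) (fderiv ℝ φ y)

/-- The form `[T', T]` of a parametrised submanifold. -/
def rhoField (φ : X → E) (y : X) : X →L[ℝ] E →L[ℝ] E :=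
  rhoForm (projField φ y) (fderiv ℝ (projField φ) y)

/-- The form `β` of a parametrised submanifold. -/
def betaField (φ : X → E) (y : X) : X →L[ℝ] E →L[ℝ] E :=
  betaForm (φ y) (fderiv ℝ φ y) (projField φ y) (fderiv ℝ (projField φ) y)

lemma betaField_eq (φ : X → E) (y : X) : betaField φ y = rhoField φ y - thetaField φ y := rfl

namespace IsLocalImmersion

variable (h : IsLocalImmersion φ Ω)
include h

lemma smooth_theta : ContDiffOn ℝ ∞ (thetaField φ) Ω := by
  have hw : ContDiff ℝ ∞ (fun x : E => (wedge x : E →L[ℝ] E →L[ℝ] E)) :=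
    ContinuousLinearMap.contDiff (𝕜 := ℝ) (E := E) (F := E →L[ℝ] E →L[ℝ] E) wedge
  exact (hw.comp_contDiffOn h.smooth).clm_comp h.smooth_fderiv

lemma smooth_rho : ContDiffOn ℝ ∞ (rhoField φ) Ω := by
  have hw : ContDiff ℝ ∞ (fun A : E →L[ℝ] E => (revCommutator A : (E →L[ℝ] E) →L[ℝ] E →L[ℝ] E)) :=
    ContinuousLinearMap.contDiff (𝕜 := ℝ) (E := E →L[ℝ] E)
      (F := (E →L[ℝ] E) →L[ℝ] E →L[ℝ] E) revCommutator
  exact (hw.comp_contDiffOn h.smooth_proj).clm_comp h.smooth_fderiv_proj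

lemma smooth_beta : ContDiffOn ℝ ∞ (betaField φ) Ω := h.smooth_rho.sub h.smooth_theta

variable {y : X} (hy : y ∈ Ω)
include hy

/-- `dθ = 2 [θ, θ]`, in the sense that `dθ(v, w) = 2 [θ(v), θ(w)]`. -/
lemma d_theta (v w : X) : fderiv ℝ (thetaField φ) y v w - fderiv ℝ (thetaField φ) y w v =
    (2 : ℝ) • (thetaField φ y v * thetaField φ y w - thetaField φ y w * thetaField φ y v) := by
  have key : ∀ v w, fderiv ℝ (thetaField φ) y v w =
      wedge (φ y) (fderiv ℝ (fderiv ℝ φ) y v w) + wedge (fderiv ℝ φ y v) (fderiv ℝ φ y w) := by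
    intro v w
    have hD := (h.hasFDerivAt hy h.smooth_fderiv).clm_apply (hasFDerivAt_const w y)
    have hf := h.hasFDerivAt hy h.smooth
    have h1 := ContinuousLinearMap.hasFDerivAt_of_bilinear (𝕜 := ℝ) (E := E) (F := E)
      (G := E →L[ℝ] E) wedge hf hD
    have h2 := (h.hasFDerivAt hy h.smooth_theta).clm_apply (hasFDerivAt_const w y)
    have := congrArg (fun L : X →L[ℝ] E →L[ℝ] E => L v) (h2.unique h1)
    simpa using this
  rw [key, key, h.fderiv_symm hy h.smooth w v]
  have hT := h.isTangentData hy
  ext1 u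
  simp only [thetaField, wedge_apply, sub_apply, smul_apply, mul_apply_eq_comp, thetaForm_apply, add_apply,
    outer_apply, inner_sub_right, inner_smul_right, hT.inner_D, hT.inner_D', hT.unit,
    real_inner_comm (fderiv ℝ φ y v) (fderiv ℝ φ y w)]
  module

/-- `dρ = 2 [ρ, ρ]`. -/
lemma d_rho (v w : X) : fderiv ℝ (rhoField φ) y v w - fderiv ℝ (rhoField φ) y w v =
    (2 : ℝ) • (rhoField φ y v * rhoField φ y w - rhoField φ y w * rhoField φ y v) := by
  have key : ∀ v w, fderiv ℝ (rhoField φ) y v w =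
      fderiv ℝ (fderiv ℝ (projField φ)) y v w * projField φ y
        + fderiv ℝ (projField φ) y w * fderiv ℝ (projField φ) y v
      - (projField φ y * fderiv ℝ (fderiv ℝ (projField φ)) y v w
        + fderiv ℝ (projField φ) y v * fderiv ℝ (projField φ) y w) := by
    intro v w
    have hD := (h.hasFDerivAt hy h.smooth_fderiv_proj).clm_apply (hasFDerivAt_const w y)
    have hf := h.hasFDerivAt hy h.smooth_proj
    have h1 := (hD.mul' hf).sub (hf.mul' hD)
    have h2 := (h.hasFDerivAt hy h.smooth_rho).clm_apply (hasFDerivAt_const w y)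
    have := congrArg (fun L : X →L[ℝ] E →L[ℝ] E => L v) (h2.unique h1)
    simpa [add_comm] using this
  rw [key, key, h.fderiv_symm hy h.smooth_proj w v]
  have hT := h.isTangentData hy
  have hTT : projField φ y * projField φ y = projField φ y := by
    ext1 u; exact hT.proj_proj u
  have hl : ∀ v, fderiv ℝ (projField φ) y v * projField φ y =
      fderiv ℝ (projField φ) y v - projField φ y * fderiv ℝ (projField φ) y v := by
    intro v; ext1 u; exact eq_sub_of_add_eq (hT.leibniz v u)
  have hr : ∀ v, rhoField φ y v = fderiv ℝ (projField φ) y v * projField φ y -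
      projField φ y * fderiv ℝ (projField φ) y v := fun v => rfl
  have key2 : ∀ v w, rhoField φ y v * rhoField φ y w =
      -(fderiv ℝ (projField φ) y v * fderiv ℝ (projField φ) y w) := by
    intro v w
    rw [hr, hr]
    generalize projField φ y = t at hTT hl
    have hv := hl v
    have hw := hl w
    generalize fderiv ℝ (projField φ) y v = a at hv
    generalize fderiv ℝ (projField φ) y w = b at hw
    have e1 : t * a * t = 0 := by rw [mul_assoc, hv, mul_sub, ← mul_assoc, hTT, sub_self]
    have e2 : t * b * t = 0 := by rw [mul_assoc, hw, mul_sub, ← mul_assoc, hTT, sub_self]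
    calc (a * t - t * a) * (b * t - t * b)
        = a * (t * b * t) - a * (t * t) * b - t * a * (b * t) + (t * a * t) * b := by noncomm_ring
      _ = - (a * t * b + t * a * (b * t)) := by rw [e1, e2, hTT]; noncomm_ring
      _ = - (a * t * b + (t * a - t * a * t) * b) := by
          rw [hw, e1, mul_sub, ← mul_assoc (t * a) t b, e1]; noncomm_ring
      _ = - (a * b) := by rw [e1, hv]; noncomm_ring
  rw [key2, key2, two_smul]
  noncomm_ring

lemma rho_eq (v : X) : rhoField φ y v = thetaField φ y v + betaField φ y v := by
  rw [betaField_eq, sub_apply]; abel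

/-- `dβ = 2 [β, β]`. -/
lemma d_beta (v w : X) : fderiv ℝ (betaField φ) y v w - fderiv ℝ (betaField φ) y w v =
    (2 : ℝ) • (betaField φ y v * betaField φ y w - betaField φ y w * betaField φ y v) := by
  have e : fderiv ℝ (betaField φ) y = fderiv ℝ (rhoField φ) y - fderiv ℝ (thetaField φ) y :=
    ((h.hasFDerivAt hy h.smooth_rho).sub (h.hasFDerivAt hy h.smooth_theta)).fderiv
  have h1 := h.d_rho hy v w
  have h2 := h.d_theta hy v w
  have h3 := (h.isTangentData hy).mixed_bracket v w
  rw [h.rho_eq hy, h.rho_eq hy] at h1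
  change thetaField φ y v * betaField φ y w - betaField φ y w * thetaField φ y v +
      (betaField φ y v * thetaField φ y w - thetaField φ y w * betaField φ y v) = 0 at h3
  rw [e]
  simp only [sub_apply]
  rw [sub_sub_sub_comm, h1, h2, ← smul_sub]
  congr 1
  rw [← sub_eq_zero, ← h3]
  noncomm_ring

end IsLocalImmersion

end TangentProj

/-! ### The Gauss and Ricci equations -/

section GaussRicci

variable {m k : ℕ} {φ : Coord m → Ambient m k} {Ω : Set (Coord m)}

lemma coord_eq_sum (X : Coord m) : X = ∑ i, X i • (EuclideanSpace.single i (1 : ℝ) : Coord m) := by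
  have := (EuclideanSpace.basisFun (Fin m) ℝ).sum_repr X
  simpa using this.symm

lemma map_coord {V : Type*} [NormedAddCommGroup V] [NormedSpace ℝ V] (L : Coord m →L[ℝ] V)
    (X : Coord m) : L X = ∑ i, X i • L (EuclideanSpace.single i (1 : ℝ)) := by
  conv_lhs => rw [coord_eq_sum X]
  simp

lemma metricPair_eq (φ : Coord m → Ambient m k) (y X Y : Coord m) :
    metricPair (metric φ) y X Y = ⟪fderiv ℝ φ y X, fderiv ℝ φ y Y⟫_ℝ := by
  rw [map_coord _ X, map_coord _ Y, sum_inner]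
  refine Finset.sum_congr rfl fun i _ => ?_
  rw [inner_sum]
  refine Finset.sum_congr rfl fun j _ => ?_
  rw [inner_smul_left, inner_smul_right]
  simp [metric, pd]
  ring

namespace IsLocalImmersion

variable (h : IsLocalImmersion φ Ω) {y : Coord m} (hy : y ∈ Ω)
include h hy

lemma fderiv_metric (i j q : Fin m) : pd i (fun z => metric φ z j q) y =
    ⟪pd j φ y, fderiv ℝ (fderiv ℝ φ) y (EuclideanSpace.single i 1) (EuclideanSpace.single q 1)⟫_ℝ +
    ⟪fderiv ℝ (fderiv ℝ φ) y (EuclideanSpace.single i 1) (EuclideanSpace.single j 1), pd q φ y⟫_ℝ := by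
  have h1 : ∀ j : Fin m, HasFDerivAt (fun z => pd j φ z) _ y := fun j =>
    (h.hasFDerivAt hy h.smooth_fderiv).clm_apply
      (hasFDerivAt_const (EuclideanSpace.single j (1 : ℝ) : Coord m) y)
  have h2 : HasFDerivAt (fun z => metric φ z j q) _ y := (h1 j).inner ℝ (h1 q)
  rw [pd, h2.fderiv]
  simp [pd]

lemma metric_mulVec (X : Coord m) (q : Fin m) :
    (metric φ y).mulVec X q = ⟪fderiv ℝ φ y X, pd q φ y⟫_ℝ := by
  rw [map_coord (fderiv ℝ φ y) X, sum_inner]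
  change ∑ j, metric φ y q j * X j = _
  refine Finset.sum_congr rfl fun j _ => ?_
  rw [inner_smul_left]
  simp [metric, pd, real_inner_comm, mul_comm]

lemma isUnit_metric : IsUnit (metric φ y) := by
  rw [← Matrix.mulVec_injective_iff_isUnit]
  suffices hi : Function.Injective (Matrix.mulVecLin (metric φ y)) from hi
  rw [injective_iff_map_eq_zero]
  intro x hx
  have h1 : ∀ q, ⟪fderiv ℝ φ y (WithLp.toLp 2 x), pd q φ y⟫_ℝ = 0 := fun q => by
    rw [← h.metric_mulVec hy]; exact congrFun hx q
  have h2 : ⟪fderiv ℝ φ y (WithLp.toLp 2 x), fderiv ℝ φ y (WithLp.toLp 2 x)⟫_ℝ = 0 := by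
    have h0 := map_coord (fderiv ℝ φ y) (WithLp.toLp 2 x)
    nth_rewrite 2 [h0]
    rw [inner_sum]
    refine Finset.sum_eq_zero fun q _ => ?_
    rw [inner_smul_right]
    rw [show ⟪fderiv ℝ φ y (WithLp.toLp 2 x), fderiv ℝ φ y (EuclideanSpace.single q 1)⟫_ℝ = 0
      from h1 q, mul_zero]
  have h3 : (WithLp.toLp 2 x : Coord m) = 0 :=
    h.injective y hy (by rw [inner_self_eq_zero.1 h2, map_zero])
  simpa using h3

/-- The Christoffel symbols are the coordinates of the tangential part of the second derivative. -/
lemma christoffel_eq (l i j : Fin m) : christoffel (metric φ) l i j y =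
    tangentCoord (fderiv ℝ φ y) (fderiv ℝ (fderiv ℝ φ) y (EuclideanSpace.single i 1)
      (EuclideanSpace.single j 1)) l := by
  set u := fderiv ℝ (fderiv ℝ φ) y (EuclideanSpace.single i 1) (EuclideanSpace.single j 1) with hu
  set C := tangentCoord (fderiv ℝ φ y) u with hC
  have h1 : ∀ q, (metric φ y).mulVec C q = ⟪u, pd q φ y⟫_ℝ := fun q => by
    rw [h.metric_mulVec hy, pd, ← ContinuousLinearMap.adjoint_inner_left,
      gram_tangentCoord (h.injective y hy), ContinuousLinearMap.adjoint_inner_left]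
  have h2 : ∀ q, pd i (fun z => metric φ z j q) y + pd j (fun z => metric φ z i q) y
      - pd q (fun z => metric φ z i j) y = 2 * (metric φ y).mulVec C q := fun q => by
    rw [h1, h.fderiv_metric hy, h.fderiv_metric hy, h.fderiv_metric hy,
      h.fderiv_symm hy h.smooth (EuclideanSpace.single q 1),
      h.fderiv_symm hy h.smooth (EuclideanSpace.single q 1),
      h.fderiv_symm hy h.smooth (EuclideanSpace.single j 1) (EuclideanSpace.single i 1), ← hu,
      real_inner_comm (pd j φ y)]
    ring
  have h3 : ((metric φ y)⁻¹).mulVec ((metric φ y).mulVec C) = C := by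
    rw [Matrix.mulVec_mulVec, Matrix.nonsing_inv_mul _
      ((Matrix.isUnit_iff_isUnit_det _).1 (h.isUnit_metric hy)), Matrix.one_mulVec]
  rw [christoffel]
  simp_rw [h2]
  rw [← congrFun h3 l, Matrix.mulVec, dotProduct, Finset.mul_sum]
  refine Finset.sum_congr rfl fun q _ => ?_
  ring

/-- The covariant derivative of the tangential part of the second derivative of `φ`, which has the
Christoffel symbols as coordinates. The last term is symmetric in `v` and `w`, so that it does not
contribute to the curvature. -/
lemma fderiv_tangentCoord (v w x : Coord m) :
    fderiv ℝ φ y (fderiv ℝ (fun z => tangentCoord (fderiv ℝ φ z) (fderiv ℝ (fderiv ℝ φ) z w x)) y v +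
      tangentCoord (fderiv ℝ φ y) (fderiv ℝ (fderiv ℝ φ) y v
        (tangentCoord (fderiv ℝ φ y) (fderiv ℝ (fderiv ℝ φ) y w x)))) =
    projField φ y (fderiv ℝ (projField φ) y v (fderiv ℝ (projField φ) y w (fderiv ℝ φ y x))) +
      projField φ y (fderiv ℝ (fderiv ℝ (fderiv ℝ φ)) y v w x) := by
  have hT := h.isTangentData hy
  have s2 := contDiffOn_fderiv h.isOpen h.smooth_fderiv
  have hpc : ∀ z ∈ Ω, ∀ u, fderiv ℝ φ z (tangentCoord (fderiv ℝ φ z) u) = projField φ z u :=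
    fun z hz u => by rw [projField, tangentProj_eq (h.injective z hz)]; rfl
  have d2 := ((h.hasFDerivAt hy s2).clm_apply (hasFDerivAt_const w y)).clm_apply
    (hasFDerivAt_const x y)
  have sC : ContDiffOn ℝ ∞ (fun z => tangentCoord (fderiv ℝ φ z) (fderiv ℝ (fderiv ℝ φ) z w x)) Ω :=
    (contDiffOn_tangentCoord h.smooth_fderiv h.injective).clm_apply
      ((s2.clm_apply contDiffOn_const).clm_apply contDiffOn_const)
  have d1 := (h.hasFDerivAt hy h.smooth_fderiv).clm_apply (h.hasFDerivAt hy sC)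
  have d3 := ((h.hasFDerivAt hy h.smooth_proj).clm_apply d2).congr_of_eventuallyEq
    (f₁ := fun z => fderiv ℝ φ z (tangentCoord (fderiv ℝ φ z) (fderiv ℝ (fderiv ℝ φ) z w x)))
    ((h.eventually_mem hy).mono fun z hz => hpc z hz _)
  have e := congrArg (fun L : Coord m →L[ℝ] Ambient m k => projField φ y (L v)) (d1.unique d3)
  simp only [add_apply, ContinuousLinearMap.comp_apply, ContinuousLinearMap.flip_apply,
    zero_apply, zero_add, map_zero, map_add, h.proj_fderiv hy, hT.proj_proj] at e
  have e2 : projField φ y (fderiv ℝ (projField φ) y v (fderiv ℝ (fderiv ℝ φ) y w x)) =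
      projField φ y (fderiv ℝ (projField φ) y v (fderiv ℝ (projField φ) y w (fderiv ℝ φ y x))) := by
    rw [← h.fderiv_proj_fderiv hy w x, map_add, map_add, hT.proj_deriv_proj, add_zero]
  rw [map_add, hpc y hy, e, e2, add_comm]

/-- The curvature tensor is the commutator of derivatives of the tangent projection. -/
lemma riemannVec_eq (X Y Z : Coord m) :
    fderiv ℝ φ y (WithLp.toLp 2 (riemannVec (metric φ) y X Y Z)) =
    projField φ y (fderiv ℝ (projField φ) y X (fderiv ℝ (projField φ) y Y (fderiv ℝ φ y Z)) -
      fderiv ℝ (projField φ) y Y (fderiv ℝ (projField φ) y X (fderiv ℝ φ y Z))) := by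
  let e : Fin m → Coord m := fun i => EuclideanSpace.single i 1
  let C : Coord m → Coord m → Coord m → Coord m := fun w x z =>
    tangentCoord (fderiv ℝ φ z) (fderiv ℝ (fderiv ℝ φ) z w x)
  have s2 := contDiffOn_fderiv h.isOpen h.smooth_fderiv
  have sC : ∀ w x, ContDiffOn ℝ ∞ (C w x) Ω := fun w x =>
    (contDiffOn_tangentCoord h.smooth_fderiv h.injective).clm_apply
      ((s2.clm_apply contDiffOn_const).clm_apply contDiffOn_const)
  have hpd : ∀ l i j q, pd q (christoffel (metric φ) l i j) y = fderiv ℝ (C (e i) (e j)) y (e q) l := by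
    intro l i j q
    have h1 : HasFDerivAt (fun z => C (e i) (e j) z l) _ y :=
      (EuclideanSpace.proj (𝕜 := ℝ) l).hasFDerivAt.comp y (h.hasFDerivAt hy (sC (e i) (e j)))
    have h2 := h1.congr_of_eventuallyEq (f₁ := christoffel (metric φ) l i j)
      ((h.eventually_mem hy).mono fun z hz => h.christoffel_eq hz l i j)
    rw [pd, h2.fderiv]
    rfl
  have hq : ∀ l i j p, ∑ q, christoffel (metric φ) l i q y * christoffel (metric φ) q j p y =
      C (e i) (C (e j) (e p) y) y l := by
    intro l i j p
    have := map_coord (tangentCoord (fderiv ℝ φ y) ∘L fderiv ℝ (fderiv ℝ φ) y (e i)) (C (e j) (e p) y)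
    have := congrArg (fun X : Coord m => X l) this
    simp only [ContinuousLinearMap.comp_apply, WithLp.ofLp_sum, Finset.sum_apply,
      WithLp.ofLp_smul, Pi.smul_apply, smul_eq_mul] at this
    refine Eq.trans ?_ this.symm
    refine Finset.sum_congr rfl fun q _ => ?_
    rw [h.christoffel_eq hy, h.christoffel_eq hy, mul_comm]
  have hR : ∀ p i j, fderiv ℝ φ y (WithLp.toLp 2 fun l => riemann (metric φ) l p i j y) =
      projField φ y (fderiv ℝ (projField φ) y (e i) (fderiv ℝ (projField φ) y (e j) (fderiv ℝ φ y (e p))) -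
      fderiv ℝ (projField φ) y (e j) (fderiv ℝ (projField φ) y (e i) (fderiv ℝ φ y (e p)))) := by
    intro p i j
    have h1 : (WithLp.toLp 2 fun l => riemann (metric φ) l p i j y) =
        (fderiv ℝ (C (e j) (e p)) y (e i) + C (e i) (C (e j) (e p) y) y) -
        (fderiv ℝ (C (e i) (e p)) y (e j) + C (e j) (C (e i) (e p) y) y) := by
      ext l
      simp only [riemann, hpd, Finset.sum_sub_distrib, hq, PiLp.sub_apply, PiLp.add_apply]
      ring
    rw [h1, map_sub, h.fderiv_tangentCoord hy, h.fderiv_tangentCoord hy,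
      h.fderiv_symm hy h.smooth_fderiv (e j) (e i), map_sub]
    abel
  have h2 : (WithLp.toLp 2 (riemannVec (metric φ) y X Y Z) : Coord m) =
      ∑ p, ∑ i, ∑ j, (X i * Y j * Z p) • WithLp.toLp 2 fun l => riemann (metric φ) l p i j y := by
    ext l
    simp only [riemannVec, WithLp.ofLp_sum, Finset.sum_apply, WithLp.ofLp_smul, Pi.smul_apply,
      smul_eq_mul]
    refine Finset.sum_congr rfl fun p _ => Finset.sum_congr rfl fun i _ =>
      Finset.sum_congr rfl fun j _ => ?_
    ring
  rw [h2]
  simp only [map_sum, map_smul, hR]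
  rw [map_coord (fderiv ℝ (projField φ) y) X, map_coord (fderiv ℝ (projField φ) y) Y,
    map_coord (fderiv ℝ φ y) Z]
  simp only [sum_apply, smul_apply, map_sum, map_smul, map_sub,
    Finset.smul_sum, Finset.sum_sub_distrib, smul_sub, smul_smul]
  congr 1
  · refine Finset.sum_congr rfl fun p _ => Finset.sum_comm.trans ?_
    refine Finset.sum_congr rfl fun j _ => Finset.sum_congr rfl fun i _ => ?_
    congr 1
    ring
  · refine Finset.sum_congr rfl fun p _ => Finset.sum_congr rfl fun i _ =>
      Finset.sum_congr rfl fun j _ => ?_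
    congr 1
    ring

/-- The Gauss equation for a submanifold of constant sectional curvature. -/
theorem gauss {c : ℝ} (hc : ∀ X Y : Fin m → ℝ, LinearIndependent ℝ ![X, Y] →
    sectional (metric φ) y X Y = c) (v w z : Coord m) :
    projField φ y (fderiv ℝ (projField φ) y v (fderiv ℝ (projField φ) y w (fderiv ℝ φ y z)) -
      fderiv ℝ (projField φ) y w (fderiv ℝ (projField φ) y v (fderiv ℝ φ y z))) =
    c • (⟪fderiv ℝ φ y w, fderiv ℝ φ y z⟫_ℝ • fderiv ℝ φ y v -
      ⟪fderiv ℝ φ y v, fderiv ℝ φ y z⟫_ℝ • fderiv ℝ φ y w) := by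
  have hT := h.isTangentData hy
  have hinj := h.injective y hy
  have hR := h.riemannVec_eq hy
  have hsecX : ∀ v w : Coord m, LinearIndependent ℝ ![(v : Fin m → ℝ), w] →
      metricPair (metric φ) y (riemannVec (metric φ) y v w w) v / (metricPair (metric φ) y v v *
        metricPair (metric φ) y w w - metricPair (metric φ) y v w ^ 2) = c := fun v w => hc v w
  have hmp : ∀ v w : Coord m, metricPair (metric φ) y v w = ⟪fderiv ℝ φ y v, fderiv ℝ φ y w⟫_ℝ :=
    fun v w => metricPair_eq φ y v w
  have hmpR : ∀ v w : Coord m, metricPair (metric φ) y (riemannVec (metric φ) y v w w) v =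
      ⟪fderiv ℝ φ y (WithLp.toLp 2 (riemannVec (metric φ) y v w w)), fderiv ℝ φ y v⟫_ℝ :=
    fun v w => metricPair_eq φ y (WithLp.toLp 2 (riemannVec (metric φ) y v w w)) v
  simp only [hmpR, hmp, hR] at hsecX
  generalize fderiv ℝ φ y = D at *
  generalize projField φ y = T at *
  generalize fderiv ℝ (projField φ) y = T' at *
  have hK : ∀ v w z u, ⟪T (T' v (T' w (D z)) - T' w (T' v (D z))), D u⟫_ℝ =
      ⟪T' w (D z), T' v (D u)⟫_ℝ - ⟪T' v (D z), T' w (D u)⟫_ℝ := fun v w z u => by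
    rw [hT.symm, hT.proj_D, inner_sub_left, hT.symm' v (T' w (D z)), hT.symm' w (T' v (D z))]
  have hsec : ∀ v w, ⟪T' w (D w), T' v (D v)⟫_ℝ - ⟪T' v (D w), T' v (D w)⟫_ℝ =
      c * (⟪D v, D v⟫_ℝ * ⟪D w, D w⟫_ℝ - ⟪D v, D w⟫_ℝ ^ 2) := by
    intro v w
    by_cases hli : LinearIndependent ℝ ![(v : Fin m → ℝ), w]
    · have h1 := hsecX v w hli
      rw [hK, hT.deriv_D w v] at h1
      -- the Gram determinant does not vanish, so the quotient in `sectional` is no junk value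
      have hne : ⟪D v, D v⟫_ℝ * ⟪D w, D w⟫_ℝ - ⟪D v, D w⟫_ℝ ^ 2 ≠ 0 := by
        intro h0
        have hv : ⟪D v, D v⟫_ℝ ≠ 0 := by
          intro hv
          have : v = 0 := hinj (by rw [inner_self_eq_zero.1 hv, map_zero])
          exact hli.ne_zero 0 (by simp [this])
        have h2 : ⟪D (⟪D v, D v⟫_ℝ • w - ⟪D v, D w⟫_ℝ • v), D (⟪D v, D v⟫_ℝ • w - ⟪D v, D w⟫_ℝ • v)⟫_ℝ
            = 0 := by
          simp only [map_sub, map_smul, inner_sub_left, inner_sub_right, inner_smul_left,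
            inner_smul_right, conj_trivial, real_inner_comm (D v) (D w)]
          linear_combination ⟪D v, D v⟫_ℝ * h0
        have h3 : ⟪D v, D v⟫_ℝ • w - ⟪D v, D w⟫_ℝ • v = 0 :=
          hinj (by rw [inner_self_eq_zero.1 h2, map_zero])
        have h4 := LinearIndependent.pair_iff.1 hli (-⟪D v, D w⟫_ℝ) ⟪D v, D v⟫_ℝ (by
          have := congrArg (fun X : Coord m => (X : Fin m → ℝ)) h3
          simp only [WithLp.ofLp_sub, WithLp.ofLp_smul, WithLp.ofLp_zero] at this
          rw [← this]
          module)
        exact hv h4.2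
      rw [div_eq_iff hne] at h1
      exact h1
    -- both sides vanish on dependent vectors, where the hypothesis says nothing
    · rw [LinearIndependent.pair_iff] at hli
      push Not at hli
      obtain ⟨s, t, hst, hne⟩ := hli
      have hst' : s • v + t • w = 0 := by
        ext i
        exact congrFun hst i
      by_cases hs : s = 0
      · have ht := hne hs
        have hw : w = 0 := by
          rw [hs, zero_smul, zero_add] at hst'
          exact (smul_eq_zero.1 hst').resolve_left ht
        simp [hw]
      · have hv : v = (-(t / s)) • w := by
          have : v = s⁻¹ • (s • v + t • w) - (t / s) • w := by
            rw [smul_add, smul_smul, smul_smul, inv_mul_cancel₀ hs]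
            module
          rw [hst'] at this
          rw [this]; simp
        rw [hv]
        simp only [map_smul, smul_apply, inner_smul_left, inner_smul_right, conj_trivial]
        ring
  -- the curvature tensor is determined by the sectional curvatures
  have hB := eq_of_sectional_eq
    (B := fun a b p q => ⟪T' a (D b), T' p (D q)⟫_ℝ - c * (⟪D a, D b⟫_ℝ * ⟪D p, D q⟫_ℝ))
    (fun a a' b p q => by
      simp only [map_add, add_apply, inner_add_left]; ring)
    (fun a b p q => by simp only [hT.deriv_D a b, real_inner_comm (D a) (D b)])
    (fun a b p q => by
      simp only [real_inner_comm (T' a (D b)), mul_comm ⟪D a, D b⟫_ℝ])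
    (fun v w => by
      have := hsec v w
      linear_combination this)
  obtain ⟨x, hx⟩ := hT.exists_D (T' v (T' w (D z)) - T' w (T' v (D z)))
  have hKx := fun u => hK v w z u
  rw [hx] at hKx ⊢
  have hfin : ∀ u, ⟪D (x - c • (⟪D w, D z⟫_ℝ • v - ⟪D v, D z⟫_ℝ • w)), D u⟫_ℝ = 0 := by
    intro u
    have := hB w z v u
    simp only [map_sub, map_smul, inner_sub_left, inner_smul_left, conj_trivial]
    rw [hKx]
    linear_combination this
  have := inner_self_eq_zero.1 (hfin _)
  rw [map_sub, sub_eq_zero] at this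
  rw [this]
  simp

lemma starProjection_normalSpace (u : Ambient m k) : (normalSpace φ y).starProjection u =
    u - projField φ y u - ⟪φ y, u⟫_ℝ • φ y := by
  have hT := h.isTangentData hy
  refine Submodule.eq_starProjection_of_mem_of_inner_eq_zero (K := normalSpace φ y) ?_ ?_
  · rw [normalSpace, Submodule.mem_orthogonal]
    intro a ha
    obtain ⟨b, hb, d, hd, rfl⟩ := Submodule.mem_sup.1 ha
    obtain ⟨t, rfl⟩ := Submodule.mem_span_singleton.1 hb
    obtain ⟨v, rfl⟩ := hd
    have e1 : ⟪φ y, projField φ y u⟫_ℝ = 0 := by rw [← hT.symm, hT.proj_f, inner_zero_left]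
    have e2 : ⟪fderiv ℝ φ y v, projField φ y u⟫_ℝ = ⟪fderiv ℝ φ y v, u⟫_ℝ := by
      rw [← hT.symm, hT.proj_D]
    simp only [inner_add_left, inner_sub_right, inner_smul_left, inner_smul_right, conj_trivial,
      ContinuousLinearMap.coe_coe, e1, e2, hT.unit, hT.inner_D']
    ring
  · intro a ha
    rw [normalSpace, Submodule.mem_orthogonal] at ha
    obtain ⟨v, hv⟩ := hT.exists_D u
    have e1 := ha (φ y) (Submodule.mem_sup_left (Submodule.mem_span_singleton_self _))
    have e2 := ha (fderiv ℝ φ y v) (Submodule.mem_sup_right ⟨v, rfl⟩)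
    rw [hv]
    simp [inner_sub_left, inner_smul_left, e1, e2]

/-- The Ricci equation for a submanifold with flat normal bundle. -/
theorem ricci (hflat : ∀ ξ : Coord m → Ambient m k, ContDiffOn ℝ ∞ ξ Ω →
      (∀ y ∈ Ω, ξ y ∈ normalSpace φ y) → ∀ v w : Coord m, ∀ y ∈ Ω,
      normalDeriv φ v (normalDeriv φ w ξ) y = normalDeriv φ w (normalDeriv φ v ξ) y)
    (v w : Coord m) (n : Ambient m k) :
    fderiv ℝ (projField φ) y v (fderiv ℝ (projField φ) y w n) -
      fderiv ℝ (projField φ) y w (fderiv ℝ (projField φ) y v n) -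
      projField φ y (fderiv ℝ (projField φ) y v (fderiv ℝ (projField φ) y w n) -
      fderiv ℝ (projField φ) y w (fderiv ℝ (projField φ) y v n)) -
      ⟪φ y, fderiv ℝ (projField φ) y v (fderiv ℝ (projField φ) y w n) -
      fderiv ℝ (projField φ) y w (fderiv ℝ (projField φ) y v n)⟫_ℝ • φ y = 0 := by
  -- the normal part of a constant vector, as a section of the normal bundle
  set ξ : Coord m → Ambient m k := fun z => n - projField φ z n - ⟪φ z, n⟫_ℝ • φ z with hξ
  have sT := h.smooth_proj
  have sf := h.smooth
  have sT' := h.smooth_fderiv_proj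
  have hξs : ContDiffOn ℝ ∞ ξ Ω :=
    (contDiffOn_const.sub (sT.clm_apply contDiffOn_const)).sub
      ((sf.inner ℝ contDiffOn_const).smul sf)
  have hξn : ∀ z ∈ Ω, ξ z ∈ normalSpace φ z := fun z hz => by
    rw [hξ]
    simp only
    rw [← h.starProjection_normalSpace hz]
    exact Submodule.starProjection_apply_mem _ _
  have hdξ : ∀ z ∈ Ω, ∀ w, normalDeriv φ w ξ z = projField φ z (fderiv ℝ (projField φ) z w n)
      + ⟪φ z, fderiv ℝ (projField φ) z w n⟫_ℝ • φ z - fderiv ℝ (projField φ) z w n := by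
    intro z hz w
    have hT := h.isTangentData hz
    have d1 := (h.hasFDerivAt hz sT).clm_apply (hasFDerivAt_const n z)
    have d2 := (h.hasFDerivAt hz sf).inner ℝ (hasFDerivAt_const n z)
    have d3 : HasFDerivAt ξ _ z := ((hasFDerivAt_const n z).sub d1).sub (d2.smul (h.hasFDerivAt hz sf))
    rw [normalDeriv, d3.fderiv, h.starProjection_normalSpace hz]
    simp only [add_apply, sub_apply, neg_apply, zero_apply, smul_apply, ContinuousLinearMap.comp_apply,
      ContinuousLinearMap.flip_apply, ContinuousLinearMap.smulRight_apply, map_sub, map_add, map_smul,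
      fderivInnerCLM_apply, ContinuousLinearMap.prod_apply, inner_zero_right, map_zero, zero_add,
      zero_sub, map_neg, hT.proj_f, hT.proj_D, inner_add_right, inner_sub_right, inner_neg_right,
      inner_smul_right, hT.unit, hT.inner_D]
    module
  have hdd : ∀ v w, normalDeriv φ v (normalDeriv φ w ξ) y =
      fderiv ℝ (projField φ) y v (fderiv ℝ (projField φ) y w n)
      - projField φ y (fderiv ℝ (projField φ) y v (fderiv ℝ (projField φ) y w n))
      - ⟪φ y, fderiv ℝ (projField φ) y v (fderiv ℝ (projField φ) y w n)⟫_ℝ • φ y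
      - (fderiv ℝ (fderiv ℝ (projField φ)) y v w n
      - projField φ y (fderiv ℝ (fderiv ℝ (projField φ)) y v w n)
      - ⟪φ y, fderiv ℝ (fderiv ℝ (projField φ)) y v w n⟫_ℝ • φ y) := by
    intro v w
    have hT := h.isTangentData hy
    have d0 := ((h.hasFDerivAt hy sT').clm_apply (hasFDerivAt_const w y)).clm_apply
      (hasFDerivAt_const n y)
    have d1 := (h.hasFDerivAt hy sT).clm_apply d0
    have d2 := (h.hasFDerivAt hy sf).inner ℝ d0
    have d3 := (d1.add (d2.smul (h.hasFDerivAt hy sf))).sub d0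
    have d4 := d3.congr_of_eventuallyEq (f₁ := normalDeriv φ w ξ)
      ((h.eventually_mem hy).mono fun z hz => by
        rw [hdξ z hz w]; rfl)
    rw [normalDeriv, d4.fderiv, h.starProjection_normalSpace hy]
    simp only [add_apply, sub_apply, zero_apply, smul_apply, ContinuousLinearMap.comp_apply,
      ContinuousLinearMap.flip_apply, ContinuousLinearMap.smulRight_apply, map_sub, map_add, map_smul,
      fderivInnerCLM_apply, ContinuousLinearMap.prod_apply, map_zero, zero_add,
      hT.proj_proj, hT.proj_f, hT.proj_D, inner_add_right, inner_sub_right,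
      inner_smul_right, hT.unit, hT.inner_D]
    have e1 : ∀ u, ⟪φ y, projField φ y u⟫_ℝ = 0 := fun u => by
      rw [← hT.symm, hT.proj_f, inner_zero_left]
    rw [e1]
    module
  have := hflat ξ hξs hξn v w y hy
  rw [hdd, hdd, h.fderiv_symm hy sT w v, sub_left_inj] at this
  rw [map_sub, inner_sub_right, ← sub_eq_zero.2 this]
  module

end IsLocalImmersion

end GaussRicci

/-! ### Reflections in the tangent space and in its sum with the position line -/

section Reflections

variable {X E : Type*} [NormedAddCommGroup X] [NormedSpace ℝ X] [NormedAddCommGroup E]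
  [InnerProductSpace ℝ E]

/-- The reflection `2 T - 1` fixing the range of the projection `T`. -/
def reflTangent (T : E →L[ℝ] E) : E →L[ℝ] E := (2 : ℝ) • T - 1

/-- The reflection `2 (T + f ⊗ f) - 1` fixing the range of `T` and the unit vector `f`. -/
def reflCone (f : E) (T : E →L[ℝ] E) : E →L[ℝ] E := reflTangent T + (2 : ℝ) • outer f f

lemma reflTangent_apply (T : E →L[ℝ] E) (u : E) : reflTangent T u = (2 : ℝ) • T u - u := rfl

lemma reflCone_apply (f : E) (T : E →L[ℝ] E) (u : E) :
    reflCone f T u = (2 : ℝ) • T u - u + (2 : ℝ) • ⟪f, u⟫_ℝ • f := rfl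

namespace IsTangentData

variable {f : E} {D : X →L[ℝ] E} {T : E →L[ℝ] E} {T' : X →L[ℝ] E →L[ℝ] E}
  (h : IsTangentData f D T T')
include h

lemma inner_proj (u : E) : ⟪f, T u⟫_ℝ = 0 := by rw [← h.symm, h.proj_f, inner_zero_left]

lemma inner_D_proj (v : X) (u : E) : ⟪D v, T u⟫_ℝ = ⟪D v, u⟫_ℝ := by rw [← h.symm, h.proj_D]

lemma reflTangent_mul_self : reflTangent T * reflTangent T = 1 := by
  ext1 u
  simp only [mul_apply_eq_comp, reflTangent_apply, map_sub, map_smul, h.proj_proj,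
    one_apply_eq_self]
  module

lemma reflCone_mul_self : reflCone f T * reflCone f T = 1 := by
  ext1 u
  simp only [mul_apply_eq_comp, reflCone_apply, map_sub, map_add, map_smul, h.proj_proj, h.proj_f,
    one_apply_eq_self, inner_add_right, inner_sub_right, inner_smul_right, h.inner_proj, h.unit]
  module

lemma inner_reflTangent (a b : E) : ⟪reflTangent T a, b⟫_ℝ = ⟪a, reflTangent T b⟫_ℝ := by
  simp only [reflTangent_apply, inner_sub_left, inner_sub_right, inner_smul_left, inner_smul_right,
    h.symm, conj_trivial]

lemma inner_reflCone (a b : E) : ⟪reflCone f T a, b⟫_ℝ = ⟪a, reflCone f T b⟫_ℝ := by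
  simp only [reflCone_apply, inner_sub_left, inner_sub_right, inner_add_left, inner_add_right,
    inner_smul_left, inner_smul_right, h.symm, conj_trivial]
  rw [real_inner_comm a f]
  ring

lemma reflTangent_mul_theta (v : X) :
    reflTangent T * thetaForm f D v = -(thetaForm f D v * reflTangent T) := by
  ext1 u
  simp only [mul_apply_eq_comp, reflTangent_apply, neg_apply, thetaForm_apply, map_sub, map_smul,
    h.proj_D, h.proj_f, inner_sub_right, inner_smul_right, h.inner_proj, h.inner_D_proj]
  module

lemma reflTangent_mul_rho (v : X) :
    reflTangent T * rhoForm T T' v = -(rhoForm T T' v * reflTangent T) := by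
  ext1 u
  have h1 := h.leibniz v u
  simp only [mul_apply_eq_comp, reflTangent_apply, neg_apply, rhoForm_apply, map_sub, map_smul,
    h.proj_proj, h.proj_deriv_proj, smul_zero, sub_zero]
  module

lemma reflTangent_mul_beta (v : X) :
    reflTangent T * betaForm f D T T' v = -(betaForm f D T T' v * reflTangent T) := by
  rw [betaForm, sub_apply, mul_sub, sub_mul, h.reflTangent_mul_theta, h.reflTangent_mul_rho]
  abel

lemma reflCone_mul_theta (v : X) :
    reflCone f T * thetaForm f D v = thetaForm f D v * reflCone f T := by
  ext1 u
  simp only [mul_apply_eq_comp, reflCone_apply, thetaForm_apply, map_sub, map_smul, h.unit,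
    h.proj_D, h.proj_f, inner_sub_right, inner_add_right, inner_smul_right, h.inner_proj,
    h.inner_D_proj, h.inner_D, h.inner_D']
  module

lemma reflCone_mul_beta (v : X) :
    reflCone f T * betaForm f D T T' v = -(betaForm f D T T' v * reflCone f T) := by
  have e : reflCone f T = reflTangent T + (2 : ℝ) • outer f f := rfl
  have e1 : outer f f * betaForm f D T T' v = 0 := by
    ext1 u
    rw [mul_apply_eq_comp, outer_apply, ← neg_neg ⟪f, _⟫_ℝ, ← h.inner_betaForm, h.betaForm_f]
    simp
  have e2 : betaForm f D T T' v * outer f f = 0 := by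
    ext1 u
    rw [mul_apply_eq_comp, outer_apply, map_smul, h.betaForm_f]
    simp
  rw [e, add_mul, mul_add, h.reflTangent_mul_beta, smul_mul_assoc, mul_smul_comm, e1, e2]
  simp

lemma rhoForm_f (v : X) : rhoForm T T' v f = D v := by
  rw [rhoForm_apply, h.proj_f, h.deriv_f, map_neg, h.proj_D]
  simp

lemma inner_rhoForm (v : X) (u : E) : ⟪f, rhoForm T T' v u⟫_ℝ = -⟪D v, u⟫_ℝ := by
  rw [rhoForm_apply, inner_sub_right, h.inner_proj, ← h.symm', h.deriv_f, inner_neg_left,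
    h.inner_D_proj, sub_zero]

/-- The derivative of the reflection in the tangent space. -/
lemma deriv_reflTangent (v : X) : (2 : ℝ) • T' v =
    rhoForm T T' v * reflTangent T - reflTangent T * rhoForm T T' v := by
  rw [h.reflTangent_mul_rho, sub_neg_eq_add]
  ext1 u
  have h1 := h.leibniz v u
  simp only [add_apply, mul_apply_eq_comp, reflTangent_apply, rhoForm_apply, map_sub, map_smul,
    h.proj_proj, h.proj_deriv_proj, smul_apply]
  rw [← h1]
  simp only [map_add, h.proj_proj, h.proj_deriv_proj]
  module

/-- The derivative of the reflection in the sum of the tangent space and the position line. -/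
lemma deriv_reflCone (v : X) : (2 : ℝ) • T' v + (2 : ℝ) • (outer (D v) f + outer f (D v)) =
    rhoForm T T' v * reflCone f T - reflCone f T * rhoForm T T' v := by
  have e : reflCone f T = reflTangent T + (2 : ℝ) • outer f f := rfl
  rw [h.deriv_reflTangent, e, mul_add, add_mul, add_sub_add_comm, mul_smul_comm, smul_mul_assoc,
    ← smul_sub]
  congr 2
  ext1 u
  simp only [add_apply, sub_apply, mul_apply_eq_comp, outer_apply, map_smul, h.rhoForm_f,
    h.inner_rhoForm]
  module

lemma theta_mul_outer (v : X) (e : E) : thetaForm f D v * outer f e = outer (D v) e := by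
  ext1 u
  simp only [mul_apply_eq_comp, outer_apply, map_smul, thetaForm_apply, h.unit, h.inner_D']
  module

lemma beta_mul_outer (v : X) (e : E) : betaForm f D T T' v * outer f e = 0 := by
  ext1 u
  simp [h.betaForm_f]

/-- The same data in another parametrisation of the tangent space. -/
lemma of_comp {X' : Type*} [NormedAddCommGroup X'] [NormedSpace ℝ X'] {D : X' →L[ℝ] E}
    {T' : X' →L[ℝ] E →L[ℝ] E} {J : X →L[ℝ] X'} (hJ : Function.Surjective J)
    (h : IsTangentData f (D ∘L J) T (T' ∘L J)) : IsTangentData f D T T' where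
  unit := h.unit
  inner_D := hJ.forall.2 h.inner_D
  proj_D := hJ.forall.2 h.proj_D
  exists_D u := by obtain ⟨v, hv⟩ := h.exists_D u; exact ⟨J v, hv⟩
  symm := h.symm
  proj_f := h.proj_f
  leibniz := hJ.forall.2 h.leibniz
  symm' := hJ.forall.2 h.symm'
  deriv_f := hJ.forall.2 h.deriv_f
  deriv_D := hJ.forall₂.2 h.deriv_D

end IsTangentData

end Reflections

/-! ### The Banach algebra of complex matrices -/

section Complexify

variable {m k : ℕ}

/-- Complex square matrices of size `m + 1 + k`. -/
abbrev CMat (m k : ℕ) : Type := Matrix (Idx m k) (Idx m k) ℂ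

/-- Complex square matrices of size `m + 1 + k`, as a type of its own that carries the structure
of a Banach algebra. -/
def CAlg (m k : ℕ) : Type := CMat m k

/-- The Banach algebra norm on matrices, as a definition that instance unification does not
unfold. -/
def CAlg.normedRing : NormedRing (CAlg m k) := (Matrix.linftyOpNormedRing : NormedRing (CMat m k))

instance : NormedRing (CAlg m k) := CAlg.normedRing

/-- The complex algebra structure on matrices, as a definition that instance unification does not
unfold. -/
def CAlg.normedAlgebra : NormedAlgebra ℂ (CAlg m k) :=
  letI : NormedRing (CMat m k) := Matrix.linftyOpNormedRing
  (Matrix.linftyOpNormedAlgebra : NormedAlgebra ℂ (CMat m k))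

instance : NormedAlgebra ℂ (CAlg m k) := CAlg.normedAlgebra

instance : NormedAlgebra ℝ (CAlg m k) := NormedAlgebra.complexToReal

instance : NormedSpace ℝ (CAlg m k) := NormedAlgebra.toNormedSpace _

instance : FiniteDimensional ℂ (CAlg m k) :=
  inferInstanceAs (Module.Finite ℂ (CMat m k))

instance : CompleteSpace (CAlg m k) := FiniteDimensional.complete ℂ _

instance : FiniteDimensional ℝ (CAlg m k) := Module.Finite.trans ℂ _

namespace CAlg

/-- The matrix underlying an element of `CAlg m k`. -/
def toMat (A : CAlg m k) : CMat m k := A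

/-- A matrix as an element of the Banach algebra `CAlg m k`. -/
def ofMat (A : CMat m k) : CAlg m k := A

lemma toMat_mul (A B : CAlg m k) : (A * B).toMat = A.toMat * B.toMat := rfl

lemma toMat_one : (1 : CAlg m k).toMat = 1 := rfl

lemma toMat_injective : Function.Injective (toMat : CAlg m k → CMat m k) := fun _ _ h => h

lemma smul_apply_real (t : ℝ) (A : CAlg m k) (i j : Idx m k) :
    (t • A).toMat i j = (t : ℂ) * A.toMat i j := rfl

/-- A matrix entry as a continuous linear functional. -/
def entry (i j : Idx m k) : CAlg m k →L[ℂ] ℂ :=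
  LinearMap.toContinuousLinearMap
    { toFun := fun A => A.toMat i j, map_add' := fun _ _ => rfl, map_smul' := fun _ _ => rfl }

/-- Transposition. -/
def tr : CAlg m k →L[ℂ] CAlg m k :=
  LinearMap.toContinuousLinearMap
    { toFun := fun A => ofMat A.toMat.transpose
      map_add' := fun _ _ => rfl
      map_smul' := fun _ _ => rfl }

lemma toMat_tr (A : CAlg m k) : (tr A).toMat = A.toMat.transpose := rfl

lemma tr_mul (A B : CAlg m k) : tr (A * B) = tr B * tr A := Matrix.transpose_mul A.toMat B.toMat

lemma tr_tr (A : CAlg m k) : tr (tr A) = A := rfl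

lemma tr_one : tr (1 : CAlg m k) = 1 := Matrix.transpose_one

lemma tr_real_smul (t : ℝ) (A : CAlg m k) : tr (t • A) = t • tr A :=
  (tr.restrictScalars ℝ).map_smul t A

/-- Entrywise complex conjugation. -/
def cj : CAlg m k →L[ℝ] CAlg m k :=
  LinearMap.toContinuousLinearMap
    { toFun := fun A => ofMat (A.toMat.map (starRingEnd ℂ))
      map_add' := fun A B => toMat_injective (by ext; exact map_add (starRingEnd ℂ) _ _)
      map_smul' := fun t A => toMat_injective (by
        ext i j
        change (starRingEnd ℂ) ((t : ℂ) * A.toMat i j) = (t : ℂ) * (starRingEnd ℂ) (A.toMat i j)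
        rw [map_mul, Complex.conj_ofReal]) }

lemma toMat_cj (A : CAlg m k) : (cj A).toMat = A.toMat.map (starRingEnd ℂ) := rfl

lemma cj_smul (z : ℂ) (A : CAlg m k) : cj (z • A) = starRingEnd ℂ z • cj A :=
  toMat_injective (by ext i j; exact map_mul (starRingEnd ℂ) _ _)

lemma cj_mul (A B : CAlg m k) : cj (A * B) = cj A * cj B :=
  Matrix.map_mul (f := starRingEnd ℂ) (L := A.toMat) (M := B.toMat)

lemma cj_one : cj (1 : CAlg m k) = 1 :=
  Matrix.map_one (starRingEnd ℂ) (map_zero _) (map_one _)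

lemma tr_cj (A : CAlg m k) : tr (cj A) = cj (tr A) := rfl

/-- The determinant. -/
def det (A : CAlg m k) : ℂ := A.toMat.det

lemma det_mul (A B : CAlg m k) : det (A * B) = det A * det B := Matrix.det_mul _ _

lemma det_one : det (1 : CAlg m k) = 1 := Matrix.det_one

lemma det_tr (A : CAlg m k) : det (tr A) = det A := Matrix.det_transpose _

lemma continuous_det : Continuous (det : CAlg m k → ℂ) := by
  have h : Continuous (toMat : CAlg m k → CMat m k) :=
    continuous_matrix fun i j => (entry i j).continuous
  exact h.matrix_det

lemma mul_tr_eq_one {A : CAlg m k} (h : A * tr A = 1) : tr A * A = 1 :=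
  (mul_eq_one_comm (M := CMat m k)).1 h

/-- The derivative of `A N Cᵀ`. -/
lemma hasFDerivAt_mul_mul_tr {V : Type*} [NormedAddCommGroup V] [NormedSpace ℝ V]
    {A N C : V → CAlg m k} {A' N' C' : V →L[ℝ] CAlg m k} {y : V} (hA : HasFDerivAt A A' y)
    (hN : HasFDerivAt N N' y) (hC : HasFDerivAt C C' y)
    (h0 : ∀ v, A' v * N y * tr (C y) + A y * N' v * tr (C y) + A y * N y * tr (C' v) = 0) :
    HasFDerivAt (fun y => A y * N y * tr (C y)) (0 : V →L[ℝ] CAlg m k) y := by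
  have h := (hA.mul' hN).mul' ((tr.restrictScalars ℝ).hasFDerivAt.comp y hC)
  refine h.congr_fderiv ?_
  ext1 v
  change A y * N y * tr (C' v) + (A y * N' v + A' v * N y) * tr (C y) = 0
  rw [← h0 v, add_mul]
  abel

end CAlg

open CAlg

/-- The matrix of a real operator in the standard basis, with complex entries. -/
def complexify : (Ambient m k →L[ℝ] Ambient m k) →ₐ[ℝ] CAlg m k where
  toFun A := ofMat ((LinearMap.toMatrixAlgEquiv (EuclideanSpace.basisFun (Idx m k) ℝ).toBasis
    (A : Ambient m k →ₗ[ℝ] Ambient m k)).map (algebraMap ℝ ℂ))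
  map_one' := by
    rw [ContinuousLinearMap.toLinearMap_one, map_one]
    exact Matrix.map_one _ (map_zero _) (map_one _)
  map_mul' A B := by
    rw [ContinuousLinearMap.toLinearMap_mul, map_mul]
    exact Matrix.map_mul
  map_zero' := by
    rw [ContinuousLinearMap.toLinearMap_zero, map_zero]
    exact Matrix.map_zero _ (map_zero _)
  map_add' A B := by
    rw [ContinuousLinearMap.toLinearMap_add, map_add]
    exact Matrix.map_add _ (map_add _) _ _
  commutes' t := toMat_injective (by
    ext i j
    rw [Algebra.algebraMap_eq_smul_one (R := ℝ) (A := CAlg m k), smul_apply_real]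
    change ((LinearMap.toMatrixAlgEquiv (EuclideanSpace.basisFun (Idx m k) ℝ).toBasis
      ((algebraMap ℝ (Ambient m k →L[ℝ] Ambient m k) t : Ambient m k →L[ℝ] Ambient m k) :
        Ambient m k →ₗ[ℝ] Ambient m k) i j : ℝ) : ℂ) = t * (1 : CMat m k) i j
    rw [LinearMap.toMatrixAlgEquiv_apply]
    by_cases hij : i = j
    · subst hij
      simp [Algebra.algebraMap_eq_smul_one]
    · simp [hij, Algebra.algebraMap_eq_smul_one])

lemma complexify_apply (A : Ambient m k →L[ℝ] Ambient m k) (i j : Idx m k) :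
    (complexify A).toMat i j = ((A (EuclideanSpace.single j 1) i : ℝ) : ℂ) := by
  change ((LinearMap.toMatrixAlgEquiv (EuclideanSpace.basisFun (Idx m k) ℝ).toBasis
    (A : Ambient m k →ₗ[ℝ] Ambient m k) i j : ℝ) : ℂ) = _
  rw [LinearMap.toMatrixAlgEquiv_apply]
  simp

lemma tr_complexify {A B : Ambient m k →L[ℝ] Ambient m k}
    (h : ∀ a b, ⟪A a, b⟫_ℝ = ⟪a, B b⟫_ℝ) : tr (complexify A) = complexify B := by
  refine toMat_injective ?_
  ext i j
  have := h (EuclideanSpace.single i 1) (EuclideanSpace.single j 1)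
  rw [EuclideanSpace.inner_single_right, EuclideanSpace.inner_single_left] at this
  simp only [conj_trivial, one_mul] at this
  rw [toMat_tr, Matrix.transpose_apply, complexify_apply, complexify_apply, this]

lemma tr_complexify_of_skew {A : Ambient m k →L[ℝ] Ambient m k}
    (h : ∀ a b, ⟪A a, b⟫_ℝ = -⟪a, A b⟫_ℝ) : tr (complexify A) = -complexify A := by
  rw [tr_complexify (B := -A) fun a b => by rw [h, neg_apply, inner_neg_right], map_neg]

lemma cj_complexify (A : Ambient m k →L[ℝ] Ambient m k) :
    cj (complexify A) = complexify A := by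
  refine toMat_injective ?_
  ext i j
  rw [toMat_cj, Matrix.map_apply, complexify_apply, Complex.conj_ofReal]

/-- `complexify` as a continuous linear map. -/
def complexifyL : (Ambient m k →L[ℝ] Ambient m k) →L[ℝ] CAlg m k :=
  LinearMap.toContinuousLinearMap complexify.toLinearMap

lemma complexifyL_apply (A : Ambient m k →L[ℝ] Ambient m k) :
    complexifyL A = complexify A := rfl

end Complexify

/-! ### Matrix-valued connection forms -/

section MatrixForms

open CAlg

variable {m k : ℕ} {X : Type*} [NormedAddCommGroup X] [NormedSpace ℝ X]

/-- The form `θ` with values in complex matrices. -/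
def thetaMat (f : Ambient m k) (D : X →L[ℝ] Ambient m k) : X →L[ℝ] CAlg m k :=
  complexifyL ∘L thetaForm f D

/-- The form `β` with values in complex matrices. -/
def betaMat (f : Ambient m k) (D : X →L[ℝ] Ambient m k) (T : Ambient m k →L[ℝ] Ambient m k)
    (T' : X →L[ℝ] Ambient m k →L[ℝ] Ambient m k) : X →L[ℝ] CAlg m k :=
  complexifyL ∘L betaForm f D T T'

/-- The matrix of the reflection fixing the tangent space. -/
def reflTangentMat (T : Ambient m k →L[ℝ] Ambient m k) : CAlg m k := complexify (reflTangent T)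

/-- The matrix of the reflection fixing the tangent space and the position vector. -/
def reflConeMat (f : Ambient m k) (T : Ambient m k →L[ℝ] Ambient m k) : CAlg m k :=
  complexify (reflCone f T)

/-- The matrix with `f` in the middle column and zeros elsewhere, which makes statements about the
middle column of a matrix into identities in the algebra. -/
def positionMat (f : Ambient m k) : CAlg m k :=
  complexify (outer f (EuclideanSpace.single (mid m k) 1))

lemma positionMat_apply (f : Ambient m k) (i j : Idx m k) :
    (positionMat f).toMat i j = if j = mid m k then ((f i : ℝ) : ℂ) else 0 := by
  rw [positionMat, complexify_apply, outer_apply, EuclideanSpace.inner_single_left]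
  by_cases hj : j = mid m k
  · subst hj; simp
  · simp [hj, Pi.single_apply, Ne.symm hj]

lemma thetaMat_apply (f : Ambient m k) (D : X →L[ℝ] Ambient m k) (v : X) :
    thetaMat f D v = complexify (thetaForm f D v) := rfl

lemma betaMat_apply (f : Ambient m k) (D : X →L[ℝ] Ambient m k)
    (T : Ambient m k →L[ℝ] Ambient m k) (T' : X →L[ℝ] Ambient m k →L[ℝ] Ambient m k) (v : X) :
    betaMat f D T T' v = complexify (betaForm f D T T' v) := rfl

lemma hasFDerivAt_reflTangentMat (T : Ambient m k →L[ℝ] Ambient m k) :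
    HasFDerivAt (reflTangentMat (m := m) (k := k)) ((2 : ℝ) • complexifyL) T := by
  have h : HasFDerivAt (fun T : Ambient m k →L[ℝ] Ambient m k => (2 : ℝ) • T - 1)
      ((2 : ℝ) • ContinuousLinearMap.id ℝ (Ambient m k →L[ℝ] Ambient m k)) T :=
    ((hasFDerivAt_id T).const_smul (2 : ℝ)).sub_const 1
  refine (complexifyL.hasFDerivAt.comp T h).congr_fderiv ?_
  ext1 A
  change complexifyL ((2 : ℝ) • A) = (2 : ℝ) • complexifyL A
  rw [map_smul]

lemma hasFDerivAt_outer_self {V : Type*} [NormedAddCommGroup V] [InnerProductSpace ℝ V] (f : V) :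
    HasFDerivAt (fun f : V => outer f f) ((outer f : V →L[ℝ] V →L[ℝ] V) + (outer (E := V)).flip f)
      f := by
  refine (ContinuousLinearMap.hasFDerivAt_of_bilinear (𝕜 := ℝ) (E := V) (F := V) (G := V →L[ℝ] V)
    outer (hasFDerivAt_id f) (hasFDerivAt_id f)).congr_fderiv ?_
  ext1 w
  rfl

lemma hasFDerivAt_reflConeMat (q : Ambient m k × (Ambient m k →L[ℝ] Ambient m k)) :
    HasFDerivAt (fun q : Ambient m k × (Ambient m k →L[ℝ] Ambient m k) => reflConeMat q.1 q.2)
      (complexifyL ∘L ((2 : ℝ) • ContinuousLinearMap.snd ℝ _ _ + (2 : ℝ) •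
        (((outer q.1 : Ambient m k →L[ℝ] Ambient m k →L[ℝ] Ambient m k) +
          (outer (E := Ambient m k)).flip q.1) ∘L ContinuousLinearMap.fst ℝ _ _))) q := by
  have h1 := ((hasFDerivAt_snd (𝕜 := ℝ) (p := q)).const_smul (2 : ℝ)).sub_const 1
  have h2 := ((hasFDerivAt_outer_self q.1).comp q (hasFDerivAt_fst (𝕜 := ℝ) (p := q))).const_smul
    (2 : ℝ)
  exact complexifyL.hasFDerivAt.comp q (h1.add h2)

lemma hasFDerivAt_positionMat (f : Ambient m k) :
    HasFDerivAt (positionMat (m := m) (k := k)) (complexifyL ∘L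
      (outer (E := Ambient m k)).flip (EuclideanSpace.single (mid m k) 1)) f :=
  ContinuousLinearMap.hasFDerivAt (𝕜 := ℝ) (E := Ambient m k) (F := CAlg m k) (complexifyL ∘L
      (outer (E := Ambient m k)).flip (EuclideanSpace.single (mid m k) 1))

namespace IsTangentData

variable {f : Ambient m k} {D : X →L[ℝ] Ambient m k} {T : Ambient m k →L[ℝ] Ambient m k}
  {T' : X →L[ℝ] Ambient m k →L[ℝ] Ambient m k} (h : IsTangentData f D T T')
include h

lemma reflTangentMat_mul_self : reflTangentMat T * reflTangentMat T = 1 := by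
  rw [reflTangentMat, ← map_mul, h.reflTangent_mul_self, map_one]

lemma reflConeMat_mul_self : reflConeMat f T * reflConeMat f T = 1 := by
  rw [reflConeMat, ← map_mul, h.reflCone_mul_self, map_one]

lemma reflTangentMat_tr : tr (reflTangentMat T) = reflTangentMat T :=
  tr_complexify h.inner_reflTangent

lemma reflConeMat_tr : tr (reflConeMat f T) = reflConeMat f T :=
  tr_complexify h.inner_reflCone

lemma thetaMat_tr (v : X) : tr (thetaMat f D v) = -thetaMat f D v :=
  tr_complexify_of_skew fun _ _ => inner_thetaForm _ _ _ _ _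

lemma betaMat_tr (v : X) : tr (betaMat f D T T' v) = -betaMat f D T T' v :=
  tr_complexify_of_skew (h.inner_betaForm v)

lemma reflTangentMat_mul_theta (v : X) :
    reflTangentMat T * thetaMat f D v = -(thetaMat f D v * reflTangentMat T) := by
  rw [reflTangentMat, thetaMat_apply, ← map_mul, h.reflTangent_mul_theta, map_neg, map_mul]

lemma reflTangentMat_mul_beta (v : X) :
    reflTangentMat T * betaMat f D T T' v = -(betaMat f D T T' v * reflTangentMat T) := by
  rw [reflTangentMat, betaMat_apply, ← map_mul, h.reflTangent_mul_beta, map_neg, map_mul]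

lemma reflConeMat_mul_theta (v : X) :
    reflConeMat f T * thetaMat f D v = thetaMat f D v * reflConeMat f T := by
  rw [reflConeMat, thetaMat_apply, ← map_mul, h.reflCone_mul_theta, map_mul]

lemma reflConeMat_mul_beta (v : X) :
    reflConeMat f T * betaMat f D T T' v = -(betaMat f D T T' v * reflConeMat f T) := by
  rw [reflConeMat, betaMat_apply, ← map_mul, h.reflCone_mul_beta, map_neg, map_mul]

lemma complexify_rho (v : X) :
    complexify (rhoForm T T' v) = thetaMat f D v + betaMat f D T T' v := by
  rw [thetaMat_apply, betaMat_apply, ← map_add, betaForm, sub_apply, add_sub_cancel]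

lemma deriv_reflTangentMat (v : X) : (2 : ℝ) • complexifyL (T' v) =
    (thetaMat f D v + betaMat f D T T' v) * reflTangentMat T -
      reflTangentMat T * (thetaMat f D v + betaMat f D T T' v) := by
  rw [← h.complexify_rho, reflTangentMat, ← map_mul, ← map_mul, ← map_sub, ← h.deriv_reflTangent,
    complexifyL_apply, map_smul]

lemma deriv_reflConeMat (v : X) :
    complexifyL ((2 : ℝ) • T' v + (2 : ℝ) • (outer f (D v) + outer (D v) f)) =
    (thetaMat f D v + betaMat f D T T' v) * reflConeMat f T -
      reflConeMat f T * (thetaMat f D v + betaMat f D T T' v) := by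
  rw [← h.complexify_rho, reflConeMat, ← map_mul, ← map_mul, ← map_sub, ← h.deriv_reflCone,
    complexifyL_apply, add_comm (outer f (D v))]

lemma deriv_positionMat (v : X) : positionMat (D v) =
    (thetaMat f D v + betaMat f D T T' v) * positionMat f := by
  rw [← h.complexify_rho, positionMat, positionMat, ← map_mul, ← h.theta_mul_outer,
    ← add_zero (thetaForm f D v * _), ← h.beta_mul_outer v, ← add_mul]
  congr 2
  rw [betaForm, sub_apply, add_sub_cancel]

end IsTangentData

/-- If `A' = A B`, `C' = C B'` and `B N + N' + N B'ᵀ = 0`, then `A N Cᵀ` is constant. -/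
lemma mul_mul_tr_eq {A N C B N' B' : ℝ → CAlg m k}
    (hA : ∀ t ∈ Set.Icc (0 : ℝ) 1, HasDerivAt A (A t * B t) t)
    (hN : ∀ t ∈ Set.Icc (0 : ℝ) 1, HasDerivAt N (N' t) t)
    (hC : ∀ t ∈ Set.Icc (0 : ℝ) 1, HasDerivAt C (C t * B' t) t)
    (h0 : ∀ t ∈ Set.Icc (0 : ℝ) 1, B t * N t + N' t + N t * tr (B' t) = 0) :
    ∀ t ∈ Set.Icc (0 : ℝ) 1, A t * N t * tr (C t) = A 0 * N 0 * tr (C 0) := by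
  have hd : ∀ t ∈ Set.Icc (0 : ℝ) 1, HasDerivAt (fun t => A t * N t * tr (C t)) 0 t := by
    intro t ht
    have := hasFDerivAt_mul_mul_tr (hA t ht).hasFDerivAt (hN t ht).hasFDerivAt
      (hC t ht).hasFDerivAt (fun v => by
        change (v • (A t * B t)) * N t * tr (C t) + A t * (v • N' t) * tr (C t) +
          A t * N t * tr (v • (C t * B' t)) = 0
        have e : A t * B t * N t * tr (C t) + A t * N' t * tr (C t) +
            A t * N t * (tr (B' t) * tr (C t)) =
            A t * (B t * N t + N' t + N t * tr (B' t)) * tr (C t) := by noncomm_ring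
        rw [tr_real_smul, smul_mul_assoc, smul_mul_assoc, mul_smul_comm, mul_smul_comm,
          smul_mul_assoc, ← smul_add, ← smul_add, tr_mul, e, h0 t ht, mul_zero, zero_mul,
          smul_zero])
    refine (this.hasDerivAt).congr_deriv ?_
    rfl
  exact constant_of_has_deriv_right_zero (fun t ht => (hd t ht).continuousAt.continuousWithinAt)
    (fun t ht => (hd t (Set.Ico_subset_Icc_self ht)).hasDerivWithinAt)

end MatrixForms

/-! ### Flatness and parallel transport in a chart -/

section ChartTransport

open CAlg

variable {m k : ℕ} {φ : Coord m → Ambient m k} {Ω : Set (Coord m)}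

/-- The matrix-valued form `θ` of a parametrised submanifold. -/
def thetaMatField (φ : Coord m → Ambient m k) (y : Coord m) : Coord m →L[ℝ] CAlg m k :=
  thetaMat (φ y) (fderiv ℝ φ y)

/-- The matrix-valued form `β` of a parametrised submanifold. -/
def betaMatField (φ : Coord m → Ambient m k) (y : Coord m) : Coord m →L[ℝ] CAlg m k :=
  betaMat (φ y) (fderiv ℝ φ y) (projField φ y) (fderiv ℝ (projField φ) y)

/-- The parameters `(a, b)` for which `a θ + b β` is flat, for a submanifold of constant
curvature `c` with flat normal bundle. -/
def IsFlatParam (c : ℝ) (z : ℂ × ℂ) : Prop :=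
  z.1 * (z.1 + 2) + (c - 1) * (z.2 * (z.2 + 2)) = 0

/-- The algebra behind `IsLocalImmersion.flat`: `p`, `q` are the values of `θ`, and `b`, `g` those of
`β`, on two vectors, and the `uᵢ` are their derivatives. -/
lemma flat_of_brackets {A : Type*} [Ring A] [Algebra ℂ A] {p q b g u₁ u₂ u₃ u₄ : A} {c z₁ z₂ : ℂ}
    (hθ : u₁ - u₂ = (2 : ℂ) • (p * q - q * p)) (hβ : u₃ - u₄ = (2 : ℂ) • (b * g - g * b))
    (hmix : p * g - g * p + (b * q - q * b) = 0) (hbr : b * g - g * b = (c - 1) • (p * q - q * p))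
    (hz : z₁ * (z₁ + 2) + (c - 1) * (z₂ * (z₂ + 2)) = 0) :
    z₁ • u₁ + z₂ • u₃ - (z₁ • u₂ + z₂ • u₄) +
      ((z₁ • p + z₂ • b) * (z₁ • q + z₂ • g) - (z₁ • q + z₂ • g) * (z₁ • p + z₂ • b)) = 0 := by
  have e : z₁ • u₁ + z₂ • u₃ - (z₁ • u₂ + z₂ • u₄) +
      ((z₁ • p + z₂ • b) * (z₁ • q + z₂ • g) - (z₁ • q + z₂ • g) * (z₁ • p + z₂ • b)) =
      z₁ • (u₁ - u₂) + z₂ • (u₃ - u₄) + (z₁ * z₁) • (p * q - q * p) +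
      (z₂ * z₂) • (b * g - g * b) + (z₁ * z₂) • (p * g - g * p + (b * q - q * b)) := by
    simp only [mul_add, add_mul, smul_mul_assoc, mul_smul_comm]
    module
  rw [e, hθ, hβ, hmix, hbr, smul_zero, add_zero, smul_smul, smul_smul, smul_smul, smul_smul,
    ← add_smul, ← add_smul, ← add_smul, ← zero_smul ℂ (p * q - q * p), ← hz]
  congr 1
  ring

namespace IsLocalImmersion

variable (h : IsLocalImmersion φ Ω)
include h

lemma smooth_thetaMat : ContDiffOn ℝ ∞ (thetaMatField φ) Ω :=
  contDiffOn_const.clm_comp h.smooth_theta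

lemma smooth_betaMat : ContDiffOn ℝ ∞ (betaMatField φ) Ω :=
  contDiffOn_const.clm_comp h.smooth_beta

variable {y : Coord m} (hy : y ∈ Ω)
include hy

lemma hasFDerivAt_reflTangentMat : HasFDerivAt (fun y => reflTangentMat (projField φ y))
    (((2 : ℝ) • complexifyL) ∘L fderiv ℝ (projField φ) y) y :=
  (SpaceForm.hasFDerivAt_reflTangentMat _).comp y (h.hasFDerivAt hy h.smooth_proj)

lemma hasFDerivAt_reflConeMat : HasFDerivAt (fun y => reflConeMat (φ y) (projField φ y))
    ((complexifyL ∘L ((2 : ℝ) • ContinuousLinearMap.snd ℝ _ _ + (2 : ℝ) •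
        (((outer (φ y) : Ambient m k →L[ℝ] Ambient m k →L[ℝ] Ambient m k) +
          (outer (E := Ambient m k)).flip (φ y)) ∘L ContinuousLinearMap.fst ℝ _ _))) ∘L
      (fderiv ℝ φ y).prod (fderiv ℝ (projField φ) y)) y :=
  HasFDerivAt.comp (g := fun q : Ambient m k × (Ambient m k →L[ℝ] Ambient m k) =>
    reflConeMat q.1 q.2) (f := fun y => (φ y, projField φ y)) y
    (SpaceForm.hasFDerivAt_reflConeMat (φ y, projField φ y))
    ((h.hasFDerivAt hy h.smooth).prodMk (h.hasFDerivAt hy h.smooth_proj))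

lemma hasFDerivAt_positionMat : HasFDerivAt (fun y => positionMat (φ y))
    ((complexifyL ∘L (outer (E := Ambient m k)).flip (EuclideanSpace.single (mid m k) 1)) ∘L
      fderiv ℝ φ y) y :=
  (SpaceForm.hasFDerivAt_positionMat (φ y)).comp y (h.hasFDerivAt hy h.smooth)

/-- Flatness of `a θ + b β` for the parameters on the quadric `IsFlatParam c`. -/
lemma flat {c : ℝ} (hbr : ∀ v w, betaField φ y v * betaField φ y w -
      betaField φ y w * betaField φ y v = (c - 1) •
        (thetaField φ y v * thetaField φ y w - thetaField φ y w * thetaField φ y v))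
    {z : ℂ × ℂ} (hz : IsFlatParam c z) (v w : Coord m) :
    fderiv ℝ (fun y => z.1 • thetaMatField φ y + z.2 • betaMatField φ y) y v w -
      fderiv ℝ (fun y => z.1 • thetaMatField φ y + z.2 • betaMatField φ y) y w v +
      ((z.1 • thetaMatField φ y v + z.2 • betaMatField φ y v) *
        (z.1 • thetaMatField φ y w + z.2 • betaMatField φ y w) -
      (z.1 • thetaMatField φ y w + z.2 • betaMatField φ y w) *
        (z.1 • thetaMatField φ y v + z.2 • betaMatField φ y v)) = 0 := by
  have d1 := h.hasFDerivAt hy h.smooth_thetaMat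
  have d2 := h.hasFDerivAt hy h.smooth_betaMat
  have e1 : ∀ v w, fderiv ℝ (thetaMatField φ) y v w =
      complexify (fderiv ℝ (thetaField φ) y v w) := by
    intro v w
    have d := (hasFDerivAt_const (complexifyL (m := m) (k := k)) y).clm_comp
      (h.hasFDerivAt hy h.smooth_theta)
    have := congrArg (fun L : Coord m →L[ℝ] Coord m →L[ℝ] CAlg m k => L v w) (d1.unique d)
    rw [this]
    simp [complexifyL_apply]
  have e2 : ∀ v w, fderiv ℝ (betaMatField φ) y v w =
      complexify (fderiv ℝ (betaField φ) y v w) := by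
    intro v w
    have d := (hasFDerivAt_const (complexifyL (m := m) (k := k)) y).clm_comp
      (h.hasFDerivAt hy h.smooth_beta)
    have := congrArg (fun L : Coord m →L[ℝ] Coord m →L[ℝ] CAlg m k => L v w) (d2.unique d)
    rw [this]
    simp [complexifyL_apply]
  have d3 : ∀ v w, fderiv ℝ (fun y => z.1 • thetaMatField φ y + z.2 • betaMatField φ y) y v w =
      z.1 • fderiv ℝ (thetaMatField φ) y v w + z.2 • fderiv ℝ (betaMatField φ) y v w := by
    intro v w
    have d : HasFDerivAt (fun y => z.1 • thetaMatField φ y + z.2 • betaMatField φ y)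
        (z.1 • fderiv ℝ (thetaMatField φ) y + z.2 • fderiv ℝ (betaMatField φ) y) y :=
      (d1.const_smul z.1).add (d2.const_smul z.2)
    rw [d.fderiv]
    rfl
  have t1 := congrArg complexify (h.d_theta hy v w)
  have t2 := congrArg complexify (h.d_beta hy v w)
  have t3 := congrArg complexify ((h.isTangentData hy).mixed_bracket v w)
  have t4 := congrArg complexify (hbr v w)
  change complexify (thetaField φ y v * betaField φ y w - betaField φ y w * thetaField φ y v +
      (betaField φ y v * thetaField φ y w - thetaField φ y w * betaField φ y v)) = _ at t3
  have f1 : ∀ v, thetaMatField φ y v = complexify (thetaField φ y v) := fun v => rfl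
  have f2 : ∀ v, betaMatField φ y v = complexify (betaField φ y v) := fun v => rfl
  simp only [map_sub, map_add, map_smul, map_mul, map_zero] at t1 t2 t3 t4
  rw [d3, d3, e1, e1, e2, e2, f1, f1, f2, f2]
  refine flat_of_brackets ?_ ?_ t3 ?_ hz
  · rw [t1, ← Complex.coe_smul, Complex.ofReal_ofNat]
  · rw [t2, ← Complex.coe_smul, Complex.ofReal_ofNat]
  · rw [t4, ← Complex.coe_smul, Complex.ofReal_sub, Complex.ofReal_one]

omit hy in
lemma hasDerivAt_reflTangentMat {γ : ℝ → Coord m} {u : Coord m} {t : ℝ} (hγ : HasDerivAt γ u t)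
    (ht : γ t ∈ Ω) : HasDerivAt (fun t => reflTangentMat (projField φ (γ t)))
    ((thetaMatField φ (γ t) u + betaMatField φ (γ t) u) * reflTangentMat (projField φ (γ t)) -
      reflTangentMat (projField φ (γ t)) * (thetaMatField φ (γ t) u + betaMatField φ (γ t) u)) t :=
  ((h.hasFDerivAt_reflTangentMat ht).comp_hasDerivAt t hγ).congr_deriv
    ((h.isTangentData ht).deriv_reflTangentMat u)

omit hy in
lemma hasDerivAt_reflConeMat {γ : ℝ → Coord m} {u : Coord m} {t : ℝ} (hγ : HasDerivAt γ u t)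
    (ht : γ t ∈ Ω) : HasDerivAt (fun t => reflConeMat (φ (γ t)) (projField φ (γ t)))
    ((thetaMatField φ (γ t) u + betaMatField φ (γ t) u) *
        reflConeMat (φ (γ t)) (projField φ (γ t)) -
      reflConeMat (φ (γ t)) (projField φ (γ t)) *
        (thetaMatField φ (γ t) u + betaMatField φ (γ t) u)) t :=
  ((h.hasFDerivAt_reflConeMat ht).comp_hasDerivAt t hγ).congr_deriv
    ((h.isTangentData ht).deriv_reflConeMat u)

omit hy in
lemma hasDerivAt_positionMat {γ : ℝ → Coord m} {u : Coord m} {t : ℝ} (hγ : HasDerivAt γ u t)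
    (ht : γ t ∈ Ω) : HasDerivAt (fun t => positionMat (φ (γ t)))
    ((thetaMatField φ (γ t) u + betaMatField φ (γ t) u) * positionMat (φ (γ t))) t :=
  ((h.hasFDerivAt_positionMat ht).comp_hasDerivAt t hγ).congr_deriv
    ((h.isTangentData ht).deriv_positionMat u)

lemma tr_thetaMatField (v : Coord m) : tr (thetaMatField φ y v) = -thetaMatField φ y v :=
  (h.isTangentData hy).thetaMat_tr v

lemma tr_betaMatField (v : Coord m) : tr (betaMatField φ y v) = -betaMatField φ y v :=
  (h.isTangentData hy).betaMat_tr v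

end IsLocalImmersion

lemma cj_thetaMatField (φ : Coord m → Ambient m k) (y v : Coord m) :
    cj (thetaMatField φ y v) = thetaMatField φ y v := cj_complexify _

lemma cj_betaMatField (φ : Coord m → Ambient m k) (y v : Coord m) :
    cj (betaMatField φ y v) = betaMatField φ y v := cj_complexify _

/-- Local parallel transport for the family of connection forms `a θ + b β` of a submanifold of
constant curvature `c` with flat normal bundle. For `(a, b) = (-1, -1)` the transport along rays
carries the tangent space, its sum with the position line and the position vector at a point to
those at the centre. -/
theorem IsLocalImmersion.exists_transport (h : IsLocalImmersion φ Ω) {c : ℝ}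
    (hbr : ∀ y ∈ Ω, ∀ v w, betaField φ y v * betaField φ y w -
      betaField φ y w * betaField φ y v = (c - 1) •
        (thetaField φ y v * thetaField φ y w - thetaField φ y w * thetaField φ y v))
    {y₀ : Coord m} (hy₀ : y₀ ∈ Ω) :
    ∃ ρ > 0, Metric.ball y₀ ρ ⊆ Ω ∧ ∃ H : Coord m → ℂ × ℂ → CAlg m k,
      ContDiff ℝ ∞ (fun q : Coord m × ℂ × ℂ => H q.1 q.2) ∧ (∀ y, ContDiff ℂ ∞ (H y)) ∧
      (∀ z, H y₀ z = 1) ∧ ∀ y ∈ Metric.ball y₀ ρ,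
        (∀ z, H y z * tr (H y z) = 1) ∧ (∀ z, det (H y z) = 1) ∧
        (∀ z, cj (H y z) = H y (starRingEnd ℂ z.1, starRingEnd ℂ z.2)) ∧
        H y (-1, -1) * reflTangentMat (projField φ y) =
          reflTangentMat (projField φ y₀) * H y (-1, -1) ∧
        H y (-1, -1) * reflConeMat (φ y) (projField φ y) =
          reflConeMat (φ y₀) (projField φ y₀) * H y (-1, -1) ∧
        H y (-1, -1) * positionMat (φ y) = positionMat (φ y₀) ∧
        ∀ z, IsFlatParam c z → ∀ v, fderiv ℝ (H · z) y v =
          H y z * (z.1 • thetaMatField φ y v + z.2 • betaMatField φ y v) := by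
  obtain ⟨ρ, hρ, hsub, H, hH, hHz, hH0, hray, hflat⟩ :=
    exists_local_transport h.isOpen h.smooth_thetaMat h.smooth_betaMat hy₀
  refine ⟨ρ, hρ, hsub, H, hH, hHz, hH0, fun y hy => ?_⟩
  set u := y - y₀ with hu
  have hun : ‖u‖ < ρ := by rwa [hu, ← dist_eq_norm]
  have hmem : ∀ t ∈ Set.Icc (0 : ℝ) 1, y₀ + t • u ∈ Ω := by
    intro t ht
    refine hsub ?_
    rw [Metric.mem_ball, dist_eq_norm, add_sub_cancel_left, norm_smul, Real.norm_of_nonneg ht.1]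
    exact (mul_le_of_le_one_left (norm_nonneg _) ht.2).trans_lt hun
  have hγ : ∀ t : ℝ, HasDerivAt (fun t : ℝ => y₀ + t • u) u t := fun t => by
    simpa using ((hasDerivAt_id t).smul_const u).const_add y₀
  have hend : y₀ + (1 : ℝ) • u = y := by rw [one_smul, hu, add_sub_cancel]
  have hstart : y₀ + (0 : ℝ) • u = y₀ := by rw [zero_smul, add_zero]
  have hskew : ∀ z : ℂ × ℂ, ∀ t ∈ Set.Icc (0 : ℝ) 1,
      tr (z.1 • thetaMatField φ (y₀ + t • u) u + z.2 • betaMatField φ (y₀ + t • u) u) =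
        -(z.1 • thetaMatField φ (y₀ + t • u) u + z.2 • betaMatField φ (y₀ + t • u) u) := by
    intro z t ht
    rw [map_add, map_smul, map_smul, h.tr_thetaMatField (hmem t ht),
      h.tr_betaMatField (hmem t ht), smul_neg, smul_neg, neg_add]
  have h1 : (1 : ℝ) ∈ Set.Icc (0 : ℝ) 1 := by simp
  have horth : ∀ z, ∀ t ∈ Set.Icc (0 : ℝ) 1,
      H (y₀ + t • u) z * tr (H (y₀ + t • u) z) = 1 := by
    intro z t ht
    have := mul_mul_tr_eq (hray u hun z) (N := fun _ => 1) (N' := fun _ => 0)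
      (fun t _ => hasDerivAt_const t 1) (hray u hun z)
      (fun t ht => by rw [hskew z t ht, mul_one, one_mul, add_zero, add_neg_cancel]) t ht
    simpa only [hstart, hH0, mul_one, tr_one] using this
  have hreal : ∀ z, cj (H y z) = H y (starRingEnd ℂ z.1, starRingEnd ℂ z.2) := by
    intro z
    set z' : ℂ × ℂ := (starRingEnd ℂ z.1, starRingEnd ℂ z.2) with hz'
    have hcj : ∀ t ∈ Set.Icc (0 : ℝ) 1, HasDerivAt (fun t : ℝ => cj (H (y₀ + t • u) z))
        (cj (H (y₀ + t • u) z) * (z'.1 • thetaMatField φ (y₀ + t • u) u +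
          z'.2 • betaMatField φ (y₀ + t • u) u)) t := fun t ht => by
      refine ((cj (m := m) (k := k)).hasFDerivAt.comp_hasDerivAt t (hray u hun z t ht)).congr_deriv
        ?_
      rw [cj_mul, map_add, cj_smul, cj_smul, cj_thetaMatField, cj_betaMatField]
    have := mul_mul_tr_eq hcj (N := fun _ => 1) (N' := fun _ => 0)
      (fun t _ => hasDerivAt_const t 1) (hray u hun z')
      (fun t ht => by rw [hskew z' t ht, mul_one, one_mul, add_zero, add_neg_cancel]) 1 h1
    simp only [hstart, hend, hH0, mul_one, tr_one, cj_one] at this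
    have ho := horth z' 1 h1
    rw [hend] at ho
    rw [← mul_one (cj (H y z)), ← mul_tr_eq_one ho, ← mul_assoc, this, one_mul]
  -- transport for `-ρ` intertwines the values of any `N` with `dN = [ρ, N]`
  have hinter : ∀ N N' : ℝ → CAlg m k, (∀ t ∈ Set.Icc (0 : ℝ) 1, HasDerivAt N (N' t) t) →
      (∀ t ∈ Set.Icc (0 : ℝ) 1, N' t =
        (thetaMatField φ (y₀ + t • u) u + betaMatField φ (y₀ + t • u) u) * N t -
        N t * (thetaMatField φ (y₀ + t • u) u + betaMatField φ (y₀ + t • u) u)) →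
      H y (-1, -1) * N 1 = N 0 * H y (-1, -1) := by
    intro N N' hN hN'
    have := mul_mul_tr_eq (hray u hun (-1, -1)) hN (hray u hun (-1, -1))
      (fun t ht => by
        rw [hskew _ t ht, hN' t ht]
        simp only [neg_smul, one_smul, ← neg_add, neg_neg, neg_mul]
        abel) 1 h1
    simp only [hstart, hend, hH0, mul_one, one_mul, tr_one] at this
    have ho := horth (-1, -1) 1 h1
    rw [hend] at ho
    rw [← this, mul_assoc, mul_tr_eq_one ho, mul_one]
  refine ⟨fun z => ?_, fun z => ?_, hreal, ?_, ?_, ?_, fun z hz v => hflat z (fun y' hy' v w =>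
    h.flat hy' (hbr y' hy') hz v w) y hy v⟩
  · have := horth z 1 (by simp)
    rwa [hend] at this
  · have hcont : ContinuousOn (fun t : ℝ => det (H (y₀ + t • u) z)) (Set.Icc 0 1) := fun t ht =>
      (continuous_det.continuousAt.comp (hray u hun z t ht).continuousAt).continuousWithinAt
    have := isPreconnected_Icc.eq_of_sq_eq hcont (continuousOn_const (c := (1 : ℂ)))
      (fun t ht => by
        have := congrArg det (horth z t ht)
        rw [det_mul, det_tr, det_one] at this
        simpa [sq] using this)
      (fun _ => one_ne_zero) (y := 0) (by simp) (by rw [hstart, hH0, det_one]) h1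
    simpa only [hend] using this
  · have := hinter _ _ (fun t ht => h.hasDerivAt_reflTangentMat (hγ t) (hmem t ht)) fun t ht => rfl
    simpa only [hend, hstart] using this
  · have := hinter _ _ (fun t ht => h.hasDerivAt_reflConeMat (hγ t) (hmem t ht)) fun t ht => rfl
    simpa only [hend, hstart] using this
  · have := mul_mul_tr_eq (hray u hun (-1, -1))
      (fun t ht => h.hasDerivAt_positionMat (hγ t) (hmem t ht)) (C := fun _ => 1)
      (B' := fun _ => 0) (fun t _ => by simpa using hasDerivAt_const t (1 : CAlg m k))
      (fun t ht => by
        simp only [map_zero, mul_zero, neg_smul, one_smul, ← neg_add, neg_mul, add_zero]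
        exact neg_add_cancel _) 1 h1
    simpa only [hstart, hend, hH0, mul_one, one_mul, tr_one] using this

end ChartTransport

/-! ### Differentials of functions on a manifold -/

section Differential

variable {m : ℕ} {M : Type*} [TopologicalSpace M] [ChartedSpace (Coord m) M]
  {V W : Type*} [NormedAddCommGroup V] [NormedSpace ℝ V] [NormedAddCommGroup W] [NormedSpace ℝ W]

/-- The vector-valued function `h` has the differential `L` at `x`; tangent vectors are regarded
as elements of the model space. -/
def HasDifferential (h : M → V) (L : Coord m →L[ℝ] V) (x : M) : Prop :=
  HasMFDerivAt (𝓡 m) 𝓘(ℝ, V) h x L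

namespace HasDifferential

variable {h : M → V} {L L' : Coord m →L[ℝ] V} {x : M}

lemma unique (h₁ : HasDifferential h L x) (h₂ : HasDifferential h L' x) : L = L' :=
  hasMFDerivAt_unique h₁ h₂

lemma continuousAt (h₁ : HasDifferential h L x) : ContinuousAt h x := HasMFDerivAt.continuousAt h₁

lemma congr_of_eventuallyEq {g : M → V} (h₁ : HasDifferential h L x) (h₂ : g =ᶠ[nhds x] h) :
    HasDifferential g L x :=
  HasMFDerivAt.congr_of_eventuallyEq h₁ h₂

lemma comp_left {g : V → W} {g' : V →L[ℝ] W} (hg : HasFDerivAt g g' (h x))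
    (h₁ : HasDifferential h L x) : HasDifferential (fun x => g (h x)) (g' ∘L L) x :=
  HasMFDerivAt.comp x hg.hasMFDerivAt h₁

lemma const (v : V) (x : M) : HasDifferential (fun _ : M => v) (0 : Coord m →L[ℝ] V) x :=
  hasMFDerivAt_const v x

lemma mfderiv (h₁ : HasDifferential h L x) : mfderiv (𝓡 m) 𝓘(ℝ, V) h x = L :=
  HasMFDerivAt.mfderiv h₁

end HasDifferential

variable [IsManifold (𝓡 m) ∞ M] {e : OpenPartialHomeomorph M (Coord m)}

/-- The differential of the inverse of a chart. -/
def chartDeriv (e : OpenPartialHomeomorph M (Coord m)) (y : Coord m) : Coord m →L[ℝ] Coord m :=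
  _root_.mfderiv (𝓡 m) (𝓡 m) e.symm y

lemma mdifferentiable_chart (he : e ∈ atlas (Coord m) M) :
    e.MDifferentiable (𝓡 m) (𝓡 m) := by
  have : IsManifold (𝓡 m) 1 M := IsManifold.of_le (n := ∞) (by simp)
  exact mdifferentiable_of_mem_atlas he

lemma chartDeriv_surjective (he : e ∈ atlas (Coord m) M) {y : Coord m} (hy : y ∈ e.target) :
    Function.Surjective (chartDeriv e y) :=
  (mdifferentiable_chart he).symm.mfderiv_surjective hy

lemma chartDeriv_injective (he : e ∈ atlas (Coord m) M) {y : Coord m} (hy : y ∈ e.target) :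
    Function.Injective (chartDeriv e y) :=
  (mdifferentiable_chart he).symm.mfderiv_injective hy

lemma HasDifferential.comp_symm (he : e ∈ atlas (Coord m) M) {y : Coord m} (hy : y ∈ e.target)
    {h : M → V} {L : Coord m →L[ℝ] V} (h₁ : HasDifferential h L (e.symm y)) :
    HasFDerivAt (h ∘ e.symm) (L ∘L chartDeriv e y) y :=
  hasMFDerivAt_iff_hasFDerivAt.1 (HasMFDerivAt.comp (I' := 𝓡 m) y h₁
    ((mdifferentiable_chart he).mdifferentiableAt_symm hy).hasMFDerivAt)

lemma exists_hasDifferential_of_comp_symm (he : e ∈ atlas (Coord m) M) {y : Coord m}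
    (hy : y ∈ e.target) {h : M → V} {D : Coord m →L[ℝ] V} (h₁ : HasFDerivAt (h ∘ e.symm) D y) :
    ∃ L : Coord m →L[ℝ] V, HasDifferential h L (e.symm y) := by
  have hd := mdifferentiable_chart he
  have hx : e.symm y ∈ e.source := e.map_target hy
  have h3 : HasMFDerivAt (𝓡 m) 𝓘(ℝ, V) (h ∘ e.symm) (e (e.symm y)) D := by
    rw [e.right_inv hy]
    exact hasMFDerivAt_iff_hasFDerivAt.2 h₁
  have h4 := HasMFDerivAt.comp (e.symm y) h3 (hd.mdifferentiableAt hx).hasMFDerivAt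
  refine ⟨_, HasMFDerivAt.congr_of_eventuallyEq h4 ?_⟩
  filter_upwards [e.open_source.mem_nhds hx] with z hz
  simp [e.left_inv hz]

lemma HasDifferential.of_comp_symm (he : e ∈ atlas (Coord m) M) {y : Coord m} (hy : y ∈ e.target)
    {h : M → V} {L : Coord m →L[ℝ] V} (h₁ : HasFDerivAt (h ∘ e.symm) (L ∘L chartDeriv e y) y) :
    HasDifferential h L (e.symm y) := by
  obtain ⟨L', hL'⟩ := exists_hasDifferential_of_comp_symm he hy h₁
  have h2 := (hL'.comp_symm he hy).unique h₁
  convert hL' using 1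
  ext1 v
  obtain ⟨w, rfl⟩ := chartDeriv_surjective he hy v
  exact (DFunLike.congr_fun h2 w).symm

lemma exists_chart {m : ℕ} {M : Type*} [TopologicalSpace M] [ChartedSpace (Coord m) M] (x : M) :
    ∃ e ∈ atlas (Coord m) M, ∃ y ∈ e.target, e.symm y = x :=
  ⟨chartAt (Coord m) x, chart_mem_atlas _ x, _, mem_chart_target _ x,
    (chartAt (Coord m) x).left_inv (mem_chart_source _ x)⟩

/-- Around each point of an open set there is a neighbourhood on which all functions with
vanishing differential are constant. -/
lemma exists_nhds_constant {U : Set M} (hU : IsOpen U) {x : M} (hx : x ∈ U) :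
    ∃ N ∈ nhds x, N ⊆ U ∧ ∀ h : M → V,
      (∀ y ∈ U, HasDifferential h (0 : Coord m →L[ℝ] V) y) → ∀ y ∈ N, h y = h x := by
  set e := chartAt (Coord m) x with he
  have hea : e ∈ atlas (Coord m) M := chart_mem_atlas _ x
  have hxs : x ∈ e.source := mem_chart_source _ x
  have hO : IsOpen (e.target ∩ e.symm ⁻¹' U) := e.isOpen_inter_preimage_symm hU
  have hxO : e x ∈ e.target ∩ e.symm ⁻¹' U :=
    ⟨e.map_source hxs, by rwa [Set.mem_preimage, e.left_inv hxs]⟩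
  obtain ⟨ρ, hρ, hball⟩ := Metric.isOpen_iff.1 hO _ hxO
  refine ⟨e.source ∩ e ⁻¹' Metric.ball (e x) ρ,
    (e.isOpen_inter_preimage Metric.isOpen_ball).mem_nhds ⟨hxs, Metric.mem_ball_self hρ⟩, ?_, ?_⟩
  · rintro z ⟨hz, hz'⟩
    have := (hball hz').2
    rwa [Set.mem_preimage, e.left_inv hz] at this
  · rintro h hh z ⟨hz, hz'⟩
    have key : ∀ y ∈ Metric.ball (e x) ρ, HasFDerivAt (h ∘ e.symm) (0 : Coord m →L[ℝ] V) y := by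
      intro y hy
      simpa using (hh _ (hball hy).2).comp_symm hea (hball hy).1
    have := (convex_ball (e x) ρ).is_const_of_fderivWithin_eq_zero (𝕜 := ℝ)
      (fun y hy => (key y hy).differentiableAt.differentiableWithinAt)
      (fun y hy => by
        rw [fderivWithin_of_isOpen Metric.isOpen_ball hy]; exact (key y hy).fderiv)
      hz' (Metric.mem_ball_self hρ)
    simpa [e.left_inv hz, e.left_inv hxs] using this

/-- A function with vanishing differential on a connected manifold is constant. -/
lemma eq_of_hasDifferential_zero [PreconnectedSpace M] {h : M → V}
    (hh : ∀ y, HasDifferential h (0 : Coord m →L[ℝ] V) y) (x y : M) : h x = h y := by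
  refine IsLocallyConstant.apply_eq_of_preconnectedSpace ?_ x y
  rw [IsLocallyConstant.iff_eventually_eq]
  intro z
  obtain ⟨N, hN, -, h2⟩ := exists_nhds_constant (m := m) (V := V) isOpen_univ (Set.mem_univ z)
  filter_upwards [hN] with y hy using h2 h (fun y _ => hh y) y hy

lemma HasDifferential.prodMk {h : M → V} {L : Coord m →L[ℝ] V} {g : M → W}
    {K : Coord m →L[ℝ] W} {x : M} (h₁ : HasDifferential h L x) (h₂ : HasDifferential g K x) :
    HasDifferential (fun x => (h x, g x)) (L.prod K) x := by
  obtain ⟨e, he, y, hy, rfl⟩ := exists_chart (m := m) x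
  exact of_comp_symm he hy ((h₁.comp_symm he hy).prodMk (h₂.comp_symm he hy))

open CAlg in
/-- If `dA = A B`, `dC = C B'` and `B N + dN + N B'ᵀ = 0`, then `A N Cᵀ` has vanishing
differential. -/
lemma HasDifferential.mul_mul_tr {k : ℕ} {A N C : M → CAlg m k}
    {A' N' C' : Coord m →L[ℝ] CAlg m k} {B B' : Coord m → CAlg m k} {x : M}
    (hA : HasDifferential A A' x) (hN : HasDifferential N N' x) (hC : HasDifferential C C' x)
    (hA' : ∀ v, A' v = A x * B v) (hC' : ∀ v, C' v = C x * B' v)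
    (h0 : ∀ v, B v * N x + N' v + N x * tr (B' v) = 0) :
    HasDifferential (fun y => A y * N y * tr (C y)) (0 : Coord m →L[ℝ] CAlg m k) x := by
  obtain ⟨e, he, y, hy, rfl⟩ := exists_chart (m := m) x
  refine of_comp_symm he hy ?_
  rw [ContinuousLinearMap.zero_comp]
  refine hasFDerivAt_mul_mul_tr (hA.comp_symm he hy) (hN.comp_symm he hy) (hC.comp_symm he hy)
    fun v => ?_
  simp only [ContinuousLinearMap.comp_apply]
  generalize chartDeriv e y v = w
  have e : A (e.symm y) * B w * N (e.symm y) * tr (C (e.symm y)) +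
      A (e.symm y) * N' w * tr (C (e.symm y)) +
      A (e.symm y) * N (e.symm y) * (tr (B' w) * tr (C (e.symm y))) =
      A (e.symm y) * (B w * N (e.symm y) + N' w + N (e.symm y) * tr (B' w)) *
        tr (C (e.symm y)) := by noncomm_ring
  rw [hA', hC', tr_mul, e, h0, mul_zero, zero_mul]

end Differential

/-! ### Local solutions on a manifold -/

section SphereImmersion

open CAlg

variable {m k : ℕ} {M : Type*} [TopologicalSpace M] [ChartedSpace (Coord m) M]
  {f : M → Ambient m k}

/-- The differential of an immersion, on the model space. -/
def differential (f : M → Ambient m k) (x : M) : Coord m →L[ℝ] Ambient m k :=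
  mfderiv (𝓡 m) 𝓘(ℝ, Ambient m k) f x

/-- The field of orthogonal projections to the tangent spaces of an immersion. -/
def tangentField (f : M → Ambient m k) (x : M) : Ambient m k →L[ℝ] Ambient m k :=
  tangentProj (differential f x)

/-- The differential of `tangentField`. -/
def tangentFieldDeriv (f : M → Ambient m k) (x : M) :
    Coord m →L[ℝ] Ambient m k →L[ℝ] Ambient m k :=
  mfderiv (𝓡 m) 𝓘(ℝ, Ambient m k →L[ℝ] Ambient m k) (tangentField f) x

/-- The form `θ` of an immersion. -/
def theta (f : M → Ambient m k) (x : M) : Coord m →L[ℝ] CAlg m k :=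
  thetaMat (f x) (differential f x)

/-- The form `β` of an immersion. -/
def beta (f : M → Ambient m k) (x : M) : Coord m →L[ℝ] CAlg m k :=
  betaMat (f x) (differential f x) (tangentField f x) (tangentFieldDeriv f x)

/-- The matrix of the reflection fixing the tangent space of an immersion. -/
def reflT (f : M → Ambient m k) (x : M) : CAlg m k := reflTangentMat (tangentField f x)

/-- The matrix of the reflection fixing the tangent space and the position vector. -/
def reflC (f : M → Ambient m k) (x : M) : CAlg m k := reflConeMat (f x) (tangentField f x)

/-- The connection form `a θ + b β`. -/
def conn (f : M → Ambient m k) (z : ℂ × ℂ) (x : M) : Coord m →L[ℝ] CAlg m k :=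
  z.1 • theta f x + z.2 • beta f x

lemma conn_apply (f : M → Ambient m k) (z : ℂ × ℂ) (x : M) (v : Coord m) :
    conn f z x v = z.1 • theta f x v + z.2 • beta f x v := rfl

/-- `X` solves the equation `dX = X (a θ + b β)` at the point `x`. -/
def IsParallelAt (f : M → Ambient m k) (z : ℂ × ℂ) (X : M → CAlg m k) (x : M) : Prop :=
  HasDifferential X (ContinuousLinearMap.mul ℝ (CAlg m k) (X x) ∘L conn f z x) x

/-- `H` consists of local solutions of `dX = X (a θ + b β)` with value `1` at `x₀`, for all flat
parameters `z = (a, b)` simultaneously. At the parameter `(-1, -1)`, where `H` is only parallel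
along rays, it carries the tangent space, its sum with the position line and the position vector
at nearby points to those at `x₀`. -/
structure IsLocalParallel (f : M → Ambient m k) (c : ℝ) (x₀ : M) (U : Set M)
    (H : M → ℂ × ℂ → CAlg m k) : Prop where
  isOpen : IsOpen U
  mem : x₀ ∈ U
  smooth : ContMDiffOn ((𝓡 m).prod 𝓘(ℝ, ℂ × ℂ)) 𝓘(ℝ, CAlg m k) ∞
    (fun q : M × (ℂ × ℂ) => H q.1 q.2) (U ×ˢ Set.univ)
  holomorphic : ∀ x, ContDiff ℂ ∞ (H x)
  eq_one : ∀ z, H x₀ z = 1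
  spec : ∀ x ∈ U,
    (∀ z, H x z * tr (H x z) = 1) ∧ (∀ z, det (H x z) = 1) ∧
    (∀ z, cj (H x z) = H x (starRingEnd ℂ z.1, starRingEnd ℂ z.2)) ∧
    H x (-1, -1) * reflT f x = reflT f x₀ * H x (-1, -1) ∧
    H x (-1, -1) * reflC f x = reflC f x₀ * H x (-1, -1) ∧
    H x (-1, -1) * positionMat (f x) = positionMat (f x₀) ∧
    ∀ z, IsFlatParam c z → IsParallelAt f z (H · z) x

namespace IsLocalParallel

variable {c : ℝ} {x₀ : M} {U : Set M} {H : M → ℂ × ℂ → CAlg m k} (h : IsLocalParallel f c x₀ U H)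
include h

lemma mono {U' : Set M} (hU' : IsOpen U') (hx : x₀ ∈ U') (hsub : U' ⊆ U) :
    IsLocalParallel f c x₀ U' H :=
  ⟨hU', hx, h.smooth.mono (Set.prod_mono hsub subset_rfl), h.holomorphic, h.eq_one,
    fun x hx => h.spec x (hsub hx)⟩

variable {x : M} (hx : x ∈ U)
include hx

lemma mul_tr (z : ℂ × ℂ) : H x z * tr (H x z) = 1 := (h.spec x hx).1 z

lemma det_eq_one (z : ℂ × ℂ) : det (H x z) = 1 := (h.spec x hx).2.1 z

lemma cj_eq (z : ℂ × ℂ) : cj (H x z) = H x (starRingEnd ℂ z.1, starRingEnd ℂ z.2) :=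
  (h.spec x hx).2.2.1 z

lemma mul_reflT : H x (-1, -1) * reflT f x = reflT f x₀ * H x (-1, -1) := (h.spec x hx).2.2.2.1

lemma mul_reflC : H x (-1, -1) * reflC f x = reflC f x₀ * H x (-1, -1) := (h.spec x hx).2.2.2.2.1

lemma mul_positionMat : H x (-1, -1) * positionMat (f x) = positionMat (f x₀) :=
  (h.spec x hx).2.2.2.2.2.1

lemma isParallelAt {z : ℂ × ℂ} (hz : IsFlatParam c z) : IsParallelAt f z (H · z) x :=
  (h.spec x hx).2.2.2.2.2.2 z hz

end IsLocalParallel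

variable [IsManifold (𝓡 m) ∞ M]

namespace IsSphereImmersion

variable (hf : IsSphereImmersion f)
include hf

lemma hasDifferential (x : M) : HasDifferential f (differential f x) x :=
  ((hf.smooth x).mdifferentiableAt (by simp)).hasMFDerivAt

variable {e : OpenPartialHomeomorph M (Coord m)} (he : e ∈ atlas (Coord m) M)
include he

lemma fderiv_comp_symm {y : Coord m} (hy : y ∈ e.target) :
    fderiv ℝ (f ∘ e.symm) y = differential f (e.symm y) ∘L chartDeriv e y :=
  ((hf.hasDifferential _).comp_symm he hy).fderiv

lemma isLocalImmersion : IsLocalImmersion (f ∘ e.symm) e.target where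
  isOpen := e.open_target
  smooth := by
    have h1 : ContMDiffOn (𝓡 m) (𝓡 m) ∞ e.symm e.target :=
      contMDiffOn_symm_of_mem_maximalAtlas (IsManifold.subset_maximalAtlas he)
    exact contMDiffOn_iff_contDiffOn.1 (hf.smooth.comp_contMDiffOn h1)
  unit y hy := by
    have := hf.mem_sphere (e.symm y)
    rw [mem_sphere_zero_iff_norm] at this
    rw [real_inner_self_eq_norm_sq, Function.comp_apply, this, one_pow]
  injective y hy := by
    rw [hf.fderiv_comp_symm he hy]
    exact (hf.injective_mfderiv (e.symm y)).comp (chartDeriv_injective he hy)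

lemma projField_comp_symm {y : Coord m} (hy : y ∈ e.target) :
    projField (f ∘ e.symm) y = tangentField f (e.symm y) := by
  rw [projField, hf.fderiv_comp_symm he hy]
  exact tangentProj_comp _ (chartDeriv_surjective he hy)

omit he in
lemma hasDifferential_tangentField (x : M) :
    HasDifferential (tangentField f) (tangentFieldDeriv f x) x := by
  obtain ⟨e, he, y, hy, rfl⟩ := exists_chart (m := m) x
  have h := hf.isLocalImmersion he
  obtain ⟨L, hL⟩ := exists_hasDifferential_of_comp_symm he hy
    ((h.hasFDerivAt hy h.smooth_proj).congr_of_eventuallyEq (f₁ := tangentField f ∘ e.symm)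
    ((h.eventually_mem hy).mono fun z hz => (hf.projField_comp_symm he hz).symm))
  rw [tangentFieldDeriv, hL.mfderiv]
  exact hL

lemma fderiv_projField {y : Coord m} (hy : y ∈ e.target) :
    fderiv ℝ (projField (f ∘ e.symm)) y = tangentFieldDeriv f (e.symm y) ∘L chartDeriv e y := by
  have h := hf.isLocalImmersion he
  refine HasFDerivAt.fderiv ?_
  exact ((hf.hasDifferential_tangentField _).comp_symm he hy).congr_of_eventuallyEq
    ((h.eventually_mem hy).mono fun z hz => hf.projField_comp_symm he hz)

omit he in
lemma isTangentData (x : M) :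
    IsTangentData (f x) (differential f x) (tangentField f x) (tangentFieldDeriv f x) := by
  obtain ⟨e, he, y, hy, rfl⟩ := exists_chart (m := m) x
  have h := (hf.isLocalImmersion he).isTangentData hy
  rw [hf.fderiv_comp_symm he hy, hf.projField_comp_symm he hy, hf.fderiv_projField he hy] at h
  exact h.of_comp (chartDeriv_surjective he hy) h

lemma thetaMatField_comp_symm {y : Coord m} (hy : y ∈ e.target) :
    thetaMatField (f ∘ e.symm) y = theta f (e.symm y) ∘L chartDeriv e y := by
  rw [thetaMatField, hf.fderiv_comp_symm he hy]
  rfl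

lemma betaMatField_comp_symm {y : Coord m} (hy : y ∈ e.target) :
    betaMatField (f ∘ e.symm) y = beta f (e.symm y) ∘L chartDeriv e y := by
  rw [betaMatField, hf.fderiv_comp_symm he hy, hf.projField_comp_symm he hy,
    hf.fderiv_projField he hy]
  rfl

omit he in
/-- `dR = [θ + β, R]` for the reflection `R` in the tangent space. -/
lemma hasDifferential_reflT (x : M) : ∃ L : Coord m →L[ℝ] CAlg m k,
    HasDifferential (reflT f) L x ∧ ∀ v, L v =
      (theta f x v + beta f x v) * reflT f x - reflT f x * (theta f x v + beta f x v) :=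
  ⟨_, HasDifferential.comp_left (g := reflTangentMat) (hasFDerivAt_reflTangentMat _)
      (hf.hasDifferential_tangentField x),
    fun v => (hf.isTangentData x).deriv_reflTangentMat v⟩

omit he in
lemma hasDifferential_reflC (x : M) : ∃ L : Coord m →L[ℝ] CAlg m k,
    HasDifferential (reflC f) L x ∧ ∀ v, L v =
      (theta f x v + beta f x v) * reflC f x - reflC f x * (theta f x v + beta f x v) := by
  have h := HasDifferential.comp_left (h := fun x => (f x, tangentField f x))
      (g := fun q : Ambient m k × (Ambient m k →L[ℝ] Ambient m k) => reflConeMat q.1 q.2)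
      (hasFDerivAt_reflConeMat (f x, tangentField f x))
      ((hf.hasDifferential x).prodMk (hf.hasDifferential_tangentField x))
  exact ⟨_, h, fun v => (hf.isTangentData x).deriv_reflConeMat v⟩

omit he in
lemma tr_conn (z : ℂ × ℂ) (x : M) (v : Coord m) : tr (conn f z x v) = -conn f z x v := by
  have h1 : tr (theta f x v) = -theta f x v := (hf.isTangentData x).thetaMat_tr v
  have h2 : tr (beta f x v) = -beta f x v := (hf.isTangentData x).betaMat_tr v
  rw [conn_apply, map_add, map_smul, map_smul, h1, h2, smul_neg, smul_neg, neg_add]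

/-- The Gauss and Ricci equations in a chart. -/
lemma betaField_bracket {c : ℝ} (hflat : HasFlatNormalBundle f) (hcurv : HasConstCurvature f c)
    (y : Coord m) (hy : y ∈ e.target) (v w : Coord m) :
    betaField (f ∘ e.symm) y v * betaField (f ∘ e.symm) y w -
      betaField (f ∘ e.symm) y w * betaField (f ∘ e.symm) y v = (c - 1) •
        (thetaField (f ∘ e.symm) y v * thetaField (f ∘ e.symm) y w -
          thetaField (f ∘ e.symm) y w * thetaField (f ∘ e.symm) y v) := by
  have h := hf.isLocalImmersion he
  exact (h.isTangentData hy).betaForm_bracket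
    (h.gauss hy fun X Y hXY => hcurv e he y hy X Y hXY)
    (fun v w n _ _ => h.ricci hy (hflat e he) v w n) v w

omit he in
/-- Local solutions of `dX = X (a θ + b β)` exist, for all flat parameters simultaneously. -/
theorem exists_local_parallel {c : ℝ} (hflat : HasFlatNormalBundle f)
    (hcurv : HasConstCurvature f c) (x₀ : M) : ∃ U H, IsLocalParallel f c x₀ U H := by
  set e := chartAt (Coord m) x₀ with he'
  have he : e ∈ atlas (Coord m) M := chart_mem_atlas _ x₀
  have hx₀ : x₀ ∈ e.source := mem_chart_source _ x₀
  have hs₀ : e.symm (e x₀) = x₀ := e.left_inv hx₀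
  have h := hf.isLocalImmersion he
  obtain ⟨ρ, hρ, hsub, H, hH, hHz, hH0, hprop⟩ :=
    h.exists_transport (hf.betaField_bracket he hflat hcurv) (e.map_source hx₀)
  refine ⟨e.source ∩ e ⁻¹' Metric.ball (e x₀) ρ, fun x z => H (e x) z,
    e.isOpen_inter_preimage Metric.isOpen_ball, ⟨hx₀, Metric.mem_ball_self hρ⟩, ?_,
    fun x => hHz _, fun z => hH0 z, ?_⟩
  · have h1 : ContMDiffOn (𝓡 m) (𝓡 m) ∞ e e.source :=
      contMDiffOn_of_mem_maximalAtlas (IsManifold.subset_maximalAtlas he)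
    have h2 : ContMDiffOn ((𝓡 m).prod 𝓘(ℝ, ℂ × ℂ)) (𝓡 m) ∞ (fun q : M × (ℂ × ℂ) => e q.1)
        ((e.source ∩ e ⁻¹' Metric.ball (e x₀) ρ) ×ˢ Set.univ) :=
      h1.comp contMDiffOn_fst fun q hq => hq.1.1
    exact hH.contMDiff.comp_contMDiffOn (h2.prodMk_space contMDiffOn_snd)
  · rintro x ⟨hx, hxb⟩
    obtain ⟨p1, p2, p3, p4, p5, p6, p7⟩ := hprop (e x) hxb
    have hs : e.symm (e x) = x := e.left_inv hx
    have hxt := e.map_source hx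
    rw [hf.projField_comp_symm he hxt, hf.projField_comp_symm he (e.map_source hx₀), hs, hs₀] at p4
    rw [hf.projField_comp_symm he hxt, hf.projField_comp_symm he (e.map_source hx₀),
      Function.comp_apply, Function.comp_apply, hs, hs₀] at p5
    rw [Function.comp_apply, Function.comp_apply, hs, hs₀] at p6
    refine ⟨p1, p2, p3, p4, p5, p6, fun z hz => ?_⟩
    rw [IsParallelAt]
    have hd : HasFDerivAt ((fun x => H (e x) z) ∘ e.symm)
        (ContinuousLinearMap.mul ℝ (CAlg m k) (H (e x) z) ∘L conn f z x ∘L chartDeriv e (e x))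
        (e x) := by
      have d1 : HasFDerivAt (H · z) (fderiv ℝ (H · z) (e x)) (e x) :=
        ((hH.comp (contDiff_id.prodMk contDiff_const)).differentiable (by simp) (e x)).hasFDerivAt
      have d2 : fderiv ℝ (H · z) (e x) =
          ContinuousLinearMap.mul ℝ (CAlg m k) (H (e x) z) ∘L conn f z x ∘L chartDeriv e (e x) := by
        ext1 v
        rw [p7 z hz v, hf.thetaMatField_comp_symm he hxt, hf.betaMatField_comp_symm he hxt, hs]
        rfl
      rw [d2] at d1
      refine d1.congr_of_eventuallyEq ?_
      filter_upwards [e.open_target.mem_nhds hxt] with y hy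
      simp [e.right_inv hy]
    have := HasDifferential.of_comp_symm he hxt
      (L := ContinuousLinearMap.mul ℝ (CAlg m k) (H (e x) z) ∘L conn f z x) hd
    rwa [hs] at this

end IsSphereImmersion

end SphereImmersion

/-! ### Loops with values in the algebra of matrices -/

section Loops

open CAlg

variable {m k : ℕ}

/-- The value of a loop, in the algebra of matrices. -/
def val (X : Maps m k) (l : ℂˣ) : CAlg m k := ofMat (X l : CMat m k)

lemma toMat_val (X : Maps m k) (l : ℂˣ) : (val X l).toMat = (X l : CMat m k) := rfl

lemma val_mul (X Y : Maps m k) (l : ℂˣ) : val (X * Y) l = val X l * val Y l := rfl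

lemma val_one (l : ℂˣ) : val (1 : Maps m k) l = 1 := rfl

lemma val_injective {X Y : Maps m k} (h : ∀ l, val X l = val Y l) : X = Y :=
  funext fun l => Units.ext (h l)

lemma tr_val_mul {X : Maps m k} (hX : X ∈ loopGroup m k) (l : ℂˣ) :
    tr (val X l) * val X l = 1 := (hX.2 l).1

lemma val_mul_tr {X : Maps m k} (hX : X ∈ loopGroup m k) (l : ℂˣ) :
    val X l * tr (val X l) = 1 :=
  (mul_eq_one_comm (M := CMat m k)).1 (hX.2 l).1

lemma det_val {X : Maps m k} (hX : X ∈ loopGroup m k) (l : ℂˣ) : det (val X l) = 1 := (hX.2 l).2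

lemma val_inv {X : Maps m k} (hX : X ∈ loopGroup m k) (l : ℂˣ) : val X⁻¹ l = tr (val X l) := by
  have h : val X⁻¹ l * val X l = 1 := by
    rw [← val_mul, inv_mul_cancel, val_one]
  rw [← mul_one (val X⁻¹ l), ← val_mul_tr hX l, ← mul_assoc, h, one_mul]

/-- The map `ℂˣ → GL` with given orthogonal values. -/
def loopOf (X : ℂˣ → CAlg m k) (h : ∀ l, X l * tr (X l) = 1) : Maps m k := fun l =>
  ⟨(X l).toMat, (tr (X l)).toMat, h l, mul_tr_eq_one (h l)⟩

lemma loopOf_mem {X : ℂˣ → CAlg m k} (h : ∀ l, X l * tr (X l) = 1)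
    (hX : ∀ i j, MDifferentiable 𝓘(ℂ, ℂ) 𝓘(ℂ, ℂ) fun l : ℂˣ => (X l).toMat i j)
    (hdet : ∀ l, det (X l) = 1) : loopOf X h ∈ loopGroup m k :=
  ⟨hX, fun l => ⟨mul_tr_eq_one (h l), hdet l⟩⟩

lemma const_mem_loopGroup {E : CAlg m k} (h : E * tr E = 1) (hdet : det E = 1) :
    loopOf (fun _ => E) (fun _ => h) ∈ loopGroup m k :=
  loopOf_mem _ (fun _ _ => mdifferentiable_const) fun _ => hdet

/-- The matrix `P`. -/
def algP (m k : ℕ) : CAlg m k := ofMat (matP m k : CMat m k)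

/-- The matrix `Q`. -/
def algQ (m k : ℕ) : CAlg m k := ofMat (matQ m k : CMat m k)

lemma algP_mul_self : algP m k * algP m k = 1 := (matP m k).val_inv

lemma algQ_mul_self : algQ m k * algQ m k = 1 := (matQ m k).val_inv

lemma tr_algP : tr (algP m k) = algP m k := Matrix.diagonal_transpose _

lemma tr_algQ : tr (algQ m k) = algQ m k := Matrix.diagonal_transpose _

/-- The involution of `ℂ^*` underlying the reality condition. -/
def realityMap (c : ℝ) (l : ℂˣ) : ℂˣ :=
  if c < 0 then -star l else if c < 1 then star l else (star l)⁻¹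

lemma val_rho (c : ℝ) (X : Maps m k) (l : ℂˣ) :
    val (rho m k c X) l = cj (val X (realityMap c l)) := by
  by_cases h0 : c < 0
  · simp only [rho, realityMap, h0, if_true]; rfl
  · by_cases h1 : c < 1
    · simp only [rho, realityMap, h0, h1, if_true, if_false]; rfl
    · simp only [rho, realityMap, h0, h1, if_false]; rfl

lemma mem_twistedLoops_iff {c : ℝ} {X : Maps m k} : X ∈ twistedLoops m k c ↔ X ∈ loopGroup m k ∧
    (∀ l, algP m k * val X (-l) * algP m k = val X l) ∧
    (∀ l, algQ m k * val X l⁻¹ * algQ m k = val X l) ∧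
    ∀ l, cj (val X (realityMap c l)) = val X l := by
  constructor
  · rintro ⟨⟨⟨h1, h2⟩, h3⟩, h4⟩
    refine ⟨h1, fun l => ?_, fun l => ?_, fun l => ?_⟩
    · exact congrArg (val · l) (show sigma m k X = X from h2)
    · exact congrArg (val · l) (show muInv m k X = X from h3)
    · rw [← val_rho]
      exact congrArg (val · l) (show rho m k c X = X from h4)
  · rintro ⟨h1, h2, h3, h4⟩
    refine ⟨⟨⟨h1, ?_⟩, ?_⟩, ?_⟩
    · exact val_injective (X := sigma m k X) (Y := X) h2
    · exact val_injective (X := muInv m k X) (Y := X) h3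
    · refine val_injective (X := rho m k c X) (Y := X) fun l => ?_
      rw [val_rho, h4]

/-- The matrix with given entries, as a continuous linear map of the entries. -/
def ofEntries (m k : ℕ) : (Idx m k → Idx m k → ℂ) →L[ℝ] CAlg m k :=
  LinearMap.toContinuousLinearMap
    { toFun := fun a => ofMat (Matrix.of a)
      map_add' := fun _ _ => rfl
      map_smul' := fun t a => toMat_injective (by
        ext i j
        rw [RingHom.id_apply, smul_apply_real]
        exact Complex.real_smul) }

section Smoothness

variable {E' H' N : Type*} [NormedAddCommGroup E'] [NormedSpace ℝ E'] [TopologicalSpace H']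
  {J : ModelWithCorners ℝ E' H'} [TopologicalSpace N] [ChartedSpace H' N]

lemma contMDiffOn_of_entries {X : N → CAlg m k} {U : Set N}
    (h : ∀ i j, ContMDiffOn J 𝓘(ℝ, ℂ) ∞ (fun x => (X x).toMat i j) U) :
    ContMDiffOn J 𝓘(ℝ, CAlg m k) ∞ X U := by
  have h1 : ContMDiffOn J 𝓘(ℝ, Idx m k → Idx m k → ℂ) ∞ (fun x i j => (X x).toMat i j) U :=
    contMDiffOn_pi_space.2 fun i => contMDiffOn_pi_space.2 fun j => h i j
  exact (ofEntries m k).contDiff.contMDiff.comp_contMDiffOn h1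

lemma ContMDiffOn.toMat {X : N → CAlg m k} {U : Set N} (h : ContMDiffOn J 𝓘(ℝ, CAlg m k) ∞ X U)
    (i j : Idx m k) : ContMDiffOn J 𝓘(ℝ, ℂ) ∞ (fun x => (X x).toMat i j) U :=
  ((entry i j).restrictScalars ℝ).contDiff.contMDiff.comp_contMDiffOn h

lemma contMDiffOn_mul {X Y : N → CAlg m k} {U : Set N} (hX : ContMDiffOn J 𝓘(ℝ, CAlg m k) ∞ X U)
    (hY : ContMDiffOn J 𝓘(ℝ, CAlg m k) ∞ Y U) :
    ContMDiffOn J 𝓘(ℝ, CAlg m k) ∞ (fun x => X x * Y x) U := by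
  have h : ContDiff ℝ ∞ fun q : CAlg m k × CAlg m k => q.1 * q.2 := contDiff_mul
  exact h.contMDiff.comp_contMDiffOn (hX.prodMk_space hY)

end Smoothness

/-- Holomorphic functions on `ℂ^*` are smooth. -/
lemma contMDiff_of_mdifferentiable {g : ℂˣ → ℂ} (hg : MDifferentiable 𝓘(ℂ, ℂ) 𝓘(ℂ, ℂ) g) :
    ContMDiff 𝓘(ℝ, ℂ) 𝓘(ℝ, ℂ) ∞ g := by
  intro l
  set e := chartAt ℂ l with he
  have hl : l ∈ e.source := mem_chart_source _ l
  have h1 : DifferentiableOn ℂ (g ∘ e.symm) e.target := fun w hw => by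
    have h2 : MDifferentiableAt 𝓘(ℂ, ℂ) 𝓘(ℂ, ℂ) e.symm w :=
      mdifferentiableAt_atlas_symm (chart_mem_atlas _ l) hw
    exact (mdifferentiableAt_iff_differentiableAt.1
      ((hg (e.symm w)).comp w h2)).differentiableWithinAt
  have h3 : ContDiffOn ℝ ∞ (g ∘ e.symm) e.target :=
    (h1.contDiffOn e.open_target).restrict_scalars ℝ
  have h4 : ContMDiffOn 𝓘(ℝ, ℂ) 𝓘(ℝ, ℂ) ∞ e e.source :=
    contMDiffOn_of_mem_maximalAtlas (IsManifold.subset_maximalAtlas (chart_mem_atlas _ l))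
  have h5 : ContMDiffOn 𝓘(ℝ, ℂ) 𝓘(ℝ, ℂ) ∞ ((g ∘ e.symm) ∘ e) e.source :=
    h3.contMDiffOn.comp h4 fun x hx => e.map_source hx
  refine (h5.contMDiffAt (e.open_source.mem_nhds hl)).congr_of_eventuallyEq ?_
  filter_upwards [e.open_source.mem_nhds hl] with x hx
  simp [e.left_inv hx]

lemma contMDiff_val {X : Maps m k} (hX : X ∈ loopGroup m k) :
    ContMDiff 𝓘(ℝ, ℂ) 𝓘(ℝ, CAlg m k) ∞ (val X) := by
  rw [← contMDiffOn_univ]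
  exact contMDiffOn_of_entries fun i j =>
    (contMDiff_of_mdifferentiable (hX.1 i j)).contMDiffOn

end Loops

/-! ### The spectral parameter -/

section Spectral

/-- The coefficients `(a, b)` of the connection form at the value `l` of the loop parameter, where
`r` and `s` are square roots of `c` and `1 - c`. This is a rational parametrisation of the quadric
`IsFlatParam c`, whose centre is `(-1, -1)`. -/
def spectral (r s : ℂ) (l : ℂ) : ℂ × ℂ := ((l + l⁻¹) * r / 2 - 1, (l - l⁻¹) * r / (2 * s) - 1)

variable {c : ℝ} {r s : ℂ}

lemma ne_zero_of_sq_eq_one_sub (hs : s ^ 2 = 1 - c) (hc1 : c ≠ 1) : s ≠ 0 := by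
  rintro rfl
  refine hc1 ?_
  have : (c : ℂ) = 1 := by linear_combination hs
  exact_mod_cast this

lemma isFlatParam_spectral (hr : r ^ 2 = c) (hs : s ^ 2 = 1 - c) (hc1 : c ≠ 1) (l : ℂˣ) :
    IsFlatParam c (spectral r s l) := by
  have hs0 := ne_zero_of_sq_eq_one_sub hs hc1
  have hl : (l : ℂ) * (l : ℂ)⁻¹ = 1 := mul_inv_cancel₀ l.ne_zero
  rw [IsFlatParam, spectral]
  have h1 : ((c : ℂ) - 1) * (((l : ℂ) - (l : ℂ)⁻¹) * r / (2 * s)) ^ 2 =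
      -(((l : ℂ) - (l : ℂ)⁻¹) ^ 2 * c / 4) := by
    rw [div_pow, mul_pow, mul_pow, hr, hs]
    have : (1 : ℂ) - c ≠ 0 := by rw [← hs]; exact pow_ne_zero 2 hs0
    field_simp
    ring
  linear_combination h1 + ((l : ℂ) + (l : ℂ)⁻¹) ^ 2 / 4 * hr + c * hl

/-- The parameters vanish at `λ₀`. -/
lemma spectral_zero (hr : r ^ 2 = c) (hs : s ^ 2 = 1 - c) (hc0 : c ≠ 0) (hc1 : c ≠ 1) {l : ℂ}
    (hl : l = (1 + s) / r) : spectral r s l = 0 := by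
  have hs0 := ne_zero_of_sq_eq_one_sub hs hc1
  have hr0 : r ≠ 0 := by
    rintro rfl
    refine hc0 ?_
    have : (c : ℂ) = 0 := by rw [← hr]; ring
    exact_mod_cast this
  have h1 : (1 + s) * (1 - s) = r ^ 2 := by rw [hr]; linear_combination -hs
  have h2 : 1 + s ≠ 0 := fun h => pow_ne_zero 2 hr0 (by rw [← h1, h, zero_mul])
  have h3 : l⁻¹ = (1 - s) / r := by
    rw [hl, inv_div, div_eq_div_iff h2 hr0]
    linear_combination -h1
  rw [spectral, h3, hl]
  ext1
  · simp only [Prod.fst_zero]; field_simp; ring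
  · simp only [Prod.snd_zero]; field_simp; ring

lemma conj_of_sq_nonneg {w : ℂ} {t : ℝ} (h : w ^ 2 = t) (ht : 0 ≤ t) : starRingEnd ℂ w = w := by
  have h1 := congrArg Complex.re h
  have h2 := congrArg Complex.im h
  simp only [sq, Complex.mul_re, Complex.mul_im, Complex.ofReal_re, Complex.ofReal_im] at h1 h2
  rw [Complex.conj_eq_iff_im]
  have h3 : w.re * w.im = 0 := by linarith
  rcases mul_eq_zero.1 h3 with h4 | h4
  · rw [h4] at h1
    nlinarith [sq_nonneg w.im]
  · exact h4

lemma conj_of_sq_neg {w : ℂ} {t : ℝ} (h : w ^ 2 = t) (ht : t < 0) : starRingEnd ℂ w = -w := by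
  have h1 : (Complex.I * w) ^ 2 = ((-t : ℝ) : ℂ) := by
    rw [mul_pow, Complex.I_sq, h]; push_cast; ring
  have h2 := conj_of_sq_nonneg h1 (by linarith)
  rw [map_mul, Complex.conj_I] at h2
  have h3 : Complex.I * (starRingEnd ℂ w + w) = 0 := by linear_combination -h2
  rcases mul_eq_zero.1 h3 with h4 | h4
  · exact absurd h4 Complex.I_ne_zero
  · linear_combination h4

lemma spectral_inv (l : ℂ) : spectral r s l⁻¹ =
    ((spectral r s l).1, -(spectral r s l).2 - 2) := by
  rw [spectral, spectral, inv_inv]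
  ext1
  · simp only; ring
  · simp only; ring

lemma spectral_neg (l : ℂ) : spectral r s (-l) =
    (-(spectral r s l).1 - 2, -(spectral r s l).2 - 2) := by
  rw [spectral, spectral, inv_neg]
  ext1
  · simp only; ring
  · simp only; ring

/-- Conjugation of the parameters `(a, b)` corresponds to the reality involution, which depends on
whether the square roots `r` and `s` are real or imaginary. -/
lemma conj_spectral (hr : r ^ 2 = c) (hs : s ^ 2 = 1 - c) (l : ℂˣ) :
    (starRingEnd ℂ (spectral r s (realityMap c l)).1, starRingEnd ℂ (spectral r s (realityMap c l)).2)
      = spectral r s l := by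
  have hs' : s ^ 2 = ((1 - c : ℝ) : ℂ) := by rw [hs]; push_cast; ring
  have e2 : starRingEnd ℂ (2 : ℂ) = 2 := Complex.conj_ofNat 2
  have e1 : ((star l : ℂˣ) : ℂ) = starRingEnd ℂ l := rfl
  rcases lt_trichotomy c 0 with h0 | h0 | h0
  · have hl : ((realityMap c l : ℂˣ) : ℂ) = -starRingEnd ℂ l := by
      rw [realityMap, if_pos h0]; simp [e1]
    rw [hl, spectral, spectral]
    ext1
    · simp [e2, conj_of_sq_neg hr h0]; ring
    · simp [e2, conj_of_sq_neg hr h0, conj_of_sq_nonneg hs' (by linarith)]; ring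
  · subst h0
    have hr0 : r = 0 := by simpa using hr
    simp [spectral, hr0]
  · by_cases h1 : c < 1
    · have hl : ((realityMap c l : ℂˣ) : ℂ) = starRingEnd ℂ l := by
        rw [realityMap, if_neg (by linarith), if_pos h1, e1]
      rw [hl, spectral, spectral]
      ext1
      · simp [e2, conj_of_sq_nonneg hr h0.le]
      · simp [e2, conj_of_sq_nonneg hr h0.le, conj_of_sq_nonneg hs' (by linarith)]
    · have hl : ((realityMap c l : ℂˣ) : ℂ) = (starRingEnd ℂ l)⁻¹ := by
        rw [realityMap, if_neg (by linarith), if_neg h1, Units.val_inv_eq_inv_val, e1]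
      rw [hl, spectral, spectral]
      rcases eq_or_lt_of_le (not_lt.1 h1) with h2 | h2
      · have hs0 : s = 0 := by simpa [← h2] using hs
        ext1
        · simp [e2, conj_of_sq_nonneg hr h0.le]; left; ring
        · simp [hs0]
      · ext1
        · simp [e2, conj_of_sq_nonneg hr h0.le]; left; ring
        · simp [e2, conj_of_sq_nonneg hr h0.le, conj_of_sq_neg hs' (by linarith)]; ring

lemma contMDiff_spectral {𝕜 : Type*} [NontriviallyNormedField 𝕜] [NormedAlgebra 𝕜 ℂ] (r s : ℂ) :
    ContMDiff 𝓘(𝕜, ℂ) 𝓘(𝕜, ℂ × ℂ) ∞ fun l : ℂˣ => spectral r s l := by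
  have h1 : ContMDiff 𝓘(𝕜, ℂ) 𝓘(𝕜, ℂ) ∞ (Units.val : ℂˣ → ℂ) := Units.contMDiff_val
  have h2 : ContMDiff 𝓘(𝕜, ℂ) 𝓘(𝕜, ℂ) ∞ fun l : ℂˣ => ((l⁻¹ : ℂˣ) : ℂ) :=
    h1.comp (contMDiff_inv 𝓘(𝕜, ℂ) ∞)
  have h3 : ContDiff 𝕜 ∞ fun q : ℂ × ℂ =>
      ((q.1 + q.2) * (r / 2) - 1, (q.1 - q.2) * (r / (2 * s)) - 1) :=
    (((contDiff_fst.add contDiff_snd).mul contDiff_const).sub contDiff_const).prodMk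
      (((contDiff_fst.sub contDiff_snd).mul contDiff_const).sub contDiff_const)
  have h4 := h3.contMDiff.comp (h1.prodMk_space h2)
  have e : (fun l : ℂˣ => spectral r s l) = (fun q : ℂ × ℂ =>
      ((q.1 + q.2) * (r / 2) - 1, (q.1 - q.2) * (r / (2 * s)) - 1)) ∘
      fun x : ℂˣ => ((x : ℂ), ((x⁻¹ : ℂˣ) : ℂ)) := by
    funext l
    simp [spectral, mul_div_assoc]
  rw [e]
  exact h4

end Spectral

/-! ### Global solutions -/

section Global

open CAlg

variable {m k : ℕ} {M : Type*} [TopologicalSpace M] [ChartedSpace (Coord m) M]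
  {f : M → Ambient m k} {c : ℝ} {r s : ℂ} {p : M}

lemma mdifferentiable_comp_spectral {H : ℂ × ℂ → CAlg m k} (hH : ContDiff ℂ ∞ H) (r s : ℂ)
    (i j : Idx m k) :
    MDifferentiable 𝓘(ℂ, ℂ) 𝓘(ℂ, ℂ) fun l : ℂˣ => (H (spectral r s l)).toMat i j :=
  (((entry i j).contDiff.comp hH).contMDiff.comp
    (contMDiff_spectral (𝕜 := ℂ) r s)).mdifferentiable (by simp)

/-- `Ψ` is a global family of solutions of `dX = X (a θ + b β)`, over the spectral curve, with
value `1` at `p`. Locally it is a constant loop times solutions that are defined for all `(a, b)`,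
which carries the smoothness in all variables. -/
structure IsGlobalParallel (f : M → Ambient m k) (c : ℝ) (r s : ℂ) (p : M)
    (Ψ : M → loopGroup m k) : Prop where
  eq_one : Ψ p = 1
  exists_local : ∀ x, ∃ U H, IsLocalParallel f c x U H ∧ ∀ y ∈ U, ∀ l : ℂˣ,
    val (Ψ y).1 l = val (Ψ x).1 l * H y (spectral r s l)

variable [IsManifold (𝓡 m) ∞ M]

section Constancy

variable [PreconnectedSpace M]

/-- If `A` and `C` are parallel for two parameters, and `N` satisfies the corresponding linear
equation, then `A N Cᵀ` is constant. -/
lemma mul_mul_tr_const (hf : IsSphereImmersion f) {A N C : M → CAlg m k} {z z' : ℂ × ℂ}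
    (hA : ∀ x, IsParallelAt f z A x) (hC : ∀ x, IsParallelAt f z' C x)
    (hN : ∀ x, ∃ L : Coord m →L[ℝ] CAlg m k, HasDifferential N L x ∧
      ∀ v, L v = N x * conn f z' x v - conn f z x v * N x) (x y : M) :
    A x * N x * tr (C x) = A y * N y * tr (C y) := by
  refine eq_of_hasDifferential_zero (m := m) (h := fun x => A x * N x * tr (C x)) (fun w => ?_) x y
  obtain ⟨L, hL, hL'⟩ := hN w
  refine (hA w).mul_mul_tr hL (hC w) (fun v => rfl) (fun v => rfl) fun v => ?_
  have e : tr (conn f z' w v) = -conn f z' w v := hf.tr_conn z' w v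
  change conn f z w v * N w + L v + N w * tr (conn f z' w v) = 0
  rw [hL', e]
  noncomm_ring

lemma eq_of_isParallel (hf : IsSphereImmersion f) {A C : M → CAlg m k} {z : ℂ × ℂ}
    (hA : ∀ x, IsParallelAt f z A x) (hC : ∀ x, IsParallelAt f z C x)
    (hC' : ∀ x, C x * tr (C x) = 1) (hp : A p = C p) (x : M) : A x = C x := by
  have h := mul_mul_tr_const hf (N := fun _ => 1) hA hC
    (fun x => ⟨0, HasDifferential.const _ _, fun v => by simp⟩) x p
  rw [mul_one, mul_one, hp, hC'] at h
  rw [← mul_one (A x), ← mul_tr_eq_one (hC' x), ← mul_assoc, h, one_mul]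

end Constancy

namespace IsGlobalParallel

variable {Ψ : M → loopGroup m k} (h : IsGlobalParallel f c r s p Ψ)
include h

lemma isParallelAt (hr : r ^ 2 = c) (hs : s ^ 2 = 1 - c) (hc1 : c ≠ 1) (l : ℂˣ) (x : M) :
    IsParallelAt f (spectral r s l) (fun y => val (Ψ y).1 l) x := by
  obtain ⟨U, H, hH, hU⟩ := h.exists_local x
  have h1 := hH.isParallelAt hH.mem (isFlatParam_spectral hr hs hc1 l)
  have h2 := h1.comp_left (g := fun X => val (Ψ x).1 l * X)
    (ContinuousLinearMap.mul ℝ (CAlg m k) (val (Ψ x).1 l)).hasFDerivAt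
  have h3 := h2.congr_of_eventuallyEq (g := fun y => val (Ψ y).1 l)
    (Filter.eventually_of_mem (hH.isOpen.mem_nhds hH.mem) fun y hy => hU y hy l)
  rw [IsParallelAt]
  convert h3 using 1
  ext1 v
  change val (Ψ x).1 l * conn f _ x v = val (Ψ x).1 l * (H x _ * conn f _ x v)
  rw [hH.eq_one, one_mul]

lemma mul_tr (l : ℂˣ) (x : M) : val (Ψ x).1 l * tr (val (Ψ x).1 l) = 1 := val_mul_tr (Ψ x).2 l

lemma val_base (l : ℂˣ) : val (Ψ p).1 l = 1 := by rw [h.eq_one]; rfl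

end IsGlobalParallel

lemma cj_theta (f : M → Ambient m k) (x : M) (v : Coord m) : cj (theta f x v) = theta f x v :=
  cj_complexify _

lemma cj_beta (f : M → Ambient m k) (x : M) (v : Coord m) : cj (beta f x v) = beta f x v :=
  cj_complexify _

namespace IsSphereImmersion

variable (hf : IsSphereImmersion f)
include hf

/-- The tangent space at a point where `f` is the middle basis vector and the tangent space is the
span of the first basis vectors. -/
lemma tangentField_base
    (hT : Set.range (mfderiv (𝓡 m) 𝓘(ℝ, Ambient m k) f p) =
      (Submodule.span ℝ (Set.range fun i : Fin m =>
        (EuclideanSpace.single (Sum.inl i) 1 : Ambient m k)) : Set (Ambient m k)))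
    (j : Idx m k) : tangentField f p (EuclideanSpace.single j 1) =
      Sum.elim (fun i => EuclideanSpace.single (Sum.inl i) 1) (fun _ => 0) j := by
  have hr : LinearMap.range (differential f p : Coord m →ₗ[ℝ] Ambient m k) =
      Submodule.span ℝ (Set.range fun i : Fin m =>
        (EuclideanSpace.single (Sum.inl i) 1 : Ambient m k)) := by
    apply SetLike.coe_injective
    rw [← hT]
    rfl
  rw [tangentField, tangentProj]
  simp only [hr]
  rcases j with i | j
  · exact Submodule.starProjection_eq_self_iff.2 (Submodule.subset_span ⟨i, rfl⟩)
  · refine (Submodule.starProjection_apply_eq_zero_iff _).2 ?_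
    rw [Submodule.mem_orthogonal]
    intro u hu
    induction hu using Submodule.span_induction with
    | mem u hu =>
      obtain ⟨i, rfl⟩ := hu
      simp [EuclideanSpace.inner_single_left]
    | zero => simp
    | add u v _ _ hu hv => rw [inner_add_left, hu, hv, add_zero]
    | smul t u _ hu => rw [inner_smul_left, hu, mul_zero]

lemma reflT_base
    (hT : Set.range (mfderiv (𝓡 m) 𝓘(ℝ, Ambient m k) f p) =
      (Submodule.span ℝ (Set.range fun i : Fin m =>
        (EuclideanSpace.single (Sum.inl i) 1 : Ambient m k)) : Set (Ambient m k))) :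
    reflT f p = algP m k := by
  apply toMat_injective
  ext i j
  rw [reflT, reflTangentMat, complexify_apply, reflTangent_apply, hf.tangentField_base hT]
  change _ = Matrix.diagonal _ i j
  rw [Matrix.diagonal_apply]
  rcases i with i | i <;> rcases j with j | j
  · by_cases hij : i = j
    · subst hij; simp; norm_num
    · simp [hij]
  · simp
  · simp
  · by_cases hij : i = j
    · subst hij; simp
    · simp [hij]

lemma reflC_base (hp : f p = EuclideanSpace.single (mid m k) 1)
    (hT : Set.range (mfderiv (𝓡 m) 𝓘(ℝ, Ambient m k) f p) =
      (Submodule.span ℝ (Set.range fun i : Fin m =>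
        (EuclideanSpace.single (Sum.inl i) 1 : Ambient m k)) : Set (Ambient m k))) :
    reflC f p = algQ m k := by
  apply toMat_injective
  ext i j
  rw [reflC, reflConeMat, complexify_apply, reflCone_apply, hf.tangentField_base hT, hp]
  change _ = Matrix.diagonal _ i j
  rw [Matrix.diagonal_apply]
  rcases i with i | i | i <;> rcases j with j | j | j
  all_goals try (simp [EuclideanSpace.inner_single_left]; done)
  · by_cases hij : i = j
    · subst hij; simp [EuclideanSpace.inner_single_left]; norm_num
    · simp [hij, EuclideanSpace.inner_single_left]
  · simp; norm_num
  · by_cases hij : i = j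
    · subst hij; simp [EuclideanSpace.inner_single_left]
    · simp [hij, EuclideanSpace.inner_single_left]

end IsSphereImmersion

namespace IsGlobalParallel

variable {Ψ : M → loopGroup m k} (h : IsGlobalParallel f c r s p Ψ) (hf : IsSphereImmersion f)
  [PreconnectedSpace M] (hr : r ^ 2 = c) (hs : s ^ 2 = 1 - c) (hc1 : c ≠ 1)
include h hf hr hs hc1

/-- The symmetry `σ`: the connection forms for `λ` and `-λ` are gauge equivalent by the reflection in
the tangent space. -/
lemma mul_reflT (hR : reflT f p = algP m k) (l : ℂˣ) (x : M) :
    algP m k * val (Ψ x).1 (-l) * reflT f x = val (Ψ x).1 l := by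
  have h1 := mul_mul_tr_const hf (N := reflT f) (h.isParallelAt hr hs hc1 l)
    (h.isParallelAt hr hs hc1 (-l)) (fun x => by
      obtain ⟨L, hL, hL'⟩ := hf.hasDifferential_reflT x
      refine ⟨L, hL, fun v => ?_⟩
      have e1 : reflT f x * theta f x v = -(theta f x v * reflT f x) :=
        (hf.isTangentData x).reflTangentMat_mul_theta v
      have e2 : reflT f x * beta f x v = -(beta f x v * reflT f x) :=
        (hf.isTangentData x).reflTangentMat_mul_beta v
      rw [hL', conn_apply, conn_apply, Units.val_neg, spectral_neg]
      simp only [mul_add, add_mul, mul_smul_comm, smul_mul_assoc, e1, e2]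
      module) x p
  rw [h.val_base, h.val_base, hR, tr_one, mul_one, one_mul] at h1
  rw [← h1]
  have h2 := mul_tr_eq_one (h.mul_tr (-l) x)
  have h3 : reflT f x * reflT f x = 1 := (hf.isTangentData x).reflTangentMat_mul_self
  rw [mul_assoc (val (Ψ x).1 l * reflT f x), h2, mul_one, mul_assoc, h3, mul_one]

/-- The symmetry `μ`, which corresponds to the reflection in the sum of the tangent space and the
position line. -/
lemma mul_reflC (hS : reflC f p = algQ m k) (l : ℂˣ) (x : M) :
    algQ m k * val (Ψ x).1 l⁻¹ * reflC f x = val (Ψ x).1 l := by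
  have h1 := mul_mul_tr_const hf (N := reflC f) (h.isParallelAt hr hs hc1 l)
    (h.isParallelAt hr hs hc1 l⁻¹) (fun x => by
      obtain ⟨L, hL, hL'⟩ := hf.hasDifferential_reflC x
      refine ⟨L, hL, fun v => ?_⟩
      have e1 : reflC f x * theta f x v = theta f x v * reflC f x :=
        (hf.isTangentData x).reflConeMat_mul_theta v
      have e2 : reflC f x * beta f x v = -(beta f x v * reflC f x) :=
        (hf.isTangentData x).reflConeMat_mul_beta v
      rw [hL', conn_apply, conn_apply, Units.val_inv_eq_inv_val, spectral_inv]
      simp only [mul_add, add_mul, mul_smul_comm, smul_mul_assoc, e1, e2]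
      module) x p
  rw [h.val_base, h.val_base, hS, tr_one, mul_one, one_mul] at h1
  rw [← h1]
  have h2 := mul_tr_eq_one (h.mul_tr l⁻¹ x)
  have h3 : reflC f x * reflC f x = 1 := (hf.isTangentData x).reflConeMat_mul_self
  rw [mul_assoc (val (Ψ x).1 l * reflC f x), h2, mul_one, mul_assoc, h3, mul_one]

/-- The reality condition. -/
lemma cj_val (l : ℂˣ) (x : M) : cj (val (Ψ x).1 (realityMap c l)) = val (Ψ x).1 l := by
  refine eq_of_isParallel (p := p) hf (A := fun x => cj (val (Ψ x).1 (realityMap c l)))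
    (z := spectral r s l) (fun x => ?_) (h.isParallelAt hr hs hc1 l) (h.mul_tr l) ?_ x
  · have h1 := HasDifferential.comp_left (g := fun X => cj X) cj.hasFDerivAt
      (h.isParallelAt hr hs hc1 (realityMap c l) x)
    rw [IsParallelAt]
    convert h1 using 1
    ext1 v
    change cj (val (Ψ x).1 (realityMap c l)) * conn f _ x v =
      cj (val (Ψ x).1 (realityMap c l) * conn f _ x v)
    rw [cj_mul, conn_apply, conn_apply, map_add, cj_smul, cj_smul, cj_theta, cj_beta,
      ← conj_spectral hr hs l]
  · simp only [h.val_base, cj_one]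

end IsGlobalParallel

/-- On a simply connected manifold the local solutions can be glued. For each parameter, the quotient
of two local solutions has vanishing differential; `exists_nhds_constant` makes it constant near a
point for all parameters at once. -/
theorem IsSphereImmersion.exists_global_parallel [SimplyConnectedSpace M]
    (hf : IsSphereImmersion f) (hflat : HasFlatNormalBundle f) (hcurv : HasConstCurvature f c)
    (hr : r ^ 2 = c) (hs : s ^ 2 = 1 - c) (hc1 : c ≠ 1) (p : M) :
    ∃ Ψ : M → loopGroup m k, IsGlobalParallel f c r s p Ψ := by
  have : LocallyPathConnectedSpace M := ChartedSpace.locallyPathConnectedSpace (Coord m) M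
  choose U H hH using fun x : M => hf.exists_local_parallel hflat hcurv x
  have h0 : ∀ x : M, ∃ Ψ : M → loopGroup m k, ∀ y ∈ U x, ∀ l : ℂˣ,
      val (Ψ y).1 l = H x y (spectral r s l) := by
    intro x
    classical
    refine ⟨fun y => if hy : y ∈ U x then
      ⟨_, loopOf_mem (fun l : ℂˣ => (hH x).mul_tr hy (spectral r s l))
        (mdifferentiable_comp_spectral ((hH x).holomorphic y) r s)
        fun l => (hH x).det_eq_one hy _⟩ else 1, fun y hy l => ?_⟩
    simp only [dif_pos hy]
    rfl
  choose Ψ hΨ using h0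
  obtain ⟨Φ, hΦ⟩ := exists_glue_of_locallyConstant U (fun x => (hH x).isOpen)
    (fun x => (hH x).mem) Ψ (fun i j x hx => by
      have hO : IsOpen (U i ∩ U j) := (hH i).isOpen.inter (hH j).isOpen
      obtain ⟨N, hN, hNU, hc⟩ := exists_nhds_constant (m := m) (V := CAlg m k) hO hx
      filter_upwards [hN] with y hy
      refine Subtype.ext (val_injective fun l => ?_)
      have key : ∀ w ∈ U i ∩ U j, val (Ψ i w * (Ψ j w)⁻¹ : loopGroup m k) l =
          H i w (spectral r s l) * 1 * tr (H j w (spectral r s l)) := by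
        intro w hw
        rw [mul_one, ← hΨ i w hw.1 l, ← hΨ j w hw.2 l, ← val_inv (Ψ j w).2]
        rfl
      rw [key y (hNU hy), key x hx]
      refine hc (fun w => H i w (spectral r s l) * 1 * tr (H j w (spectral r s l)))
        (fun w hw => ?_) y hy
      have hz := isFlatParam_spectral hr hs hc1 l
      refine ((hH i).isParallelAt hw.1 hz).mul_mul_tr (N := fun _ => 1)
        (HasDifferential.const _ _) ((hH j).isParallelAt hw.2 hz) (fun v => rfl) (fun v => rfl)
        fun v => ?_
      have e : tr (conn f (spectral r s l) w v) = -conn f (spectral r s l) w v :=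
        hf.tr_conn _ w v
      change conn f (spectral r s l) w v * 1 + 0 + 1 * tr (conn f (spectral r s l) w v) = 0
      rw [e, mul_one, one_mul, add_zero, add_neg_cancel])
  refine ⟨fun x => (Φ p)⁻¹ * Φ x, inv_mul_cancel _, fun x => ?_⟩
  obtain ⟨O, hO, hOo, hxO⟩ := eventually_nhds_iff.1 (hΦ x x (hH x).mem)
  refine ⟨U x ∩ O, H x, (hH x).mono ((hH x).isOpen.inter hOo) ⟨(hH x).mem, hxO⟩
    Set.inter_subset_left, fun y hy l => ?_⟩
  have h1 : Ψ x x = 1 := Subtype.ext (val_injective fun l => by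
    rw [hΨ x x (hH x).mem, (hH x).eq_one]; rfl)
  have h2 : Φ y = Φ x * Ψ x y := by
    have := hO y hy.2
    rw [h1, inv_one, mul_one] at this
    rw [← this, inv_mul_cancel_right]
  rw [← hΨ x y hy.1 l, h2]
  exact mul_assoc (val _ l) (val _ l) (val _ l) |>.symm

end Global

/-! ### The upper block of a matrix commuting with `Q` -/

section UpperDet

open CAlg

variable {m k : ℕ}

/-- The projection `(1 + Q) / 2` to the first `m + 1` coordinates. -/
def qUp (m k : ℕ) : CAlg m k := (1 / 2 : ℂ) • (1 + algQ m k)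

/-- The projection `(1 - Q) / 2` to the last `k` coordinates. -/
def qLow (m k : ℕ) : CAlg m k := (1 / 2 : ℂ) • (1 - algQ m k)

lemma qUp_mul_self : qUp m k * qUp m k = qUp m k := by
  have h := algQ_mul_self (m := m) (k := k)
  simp only [qUp, smul_mul_smul_comm, mul_add, add_mul, mul_one, one_mul, h]
  module

lemma qLow_mul_self : qLow m k * qLow m k = qLow m k := by
  have h := algQ_mul_self (m := m) (k := k)
  simp only [qLow, smul_mul_smul_comm, mul_sub, sub_mul, mul_one, one_mul, h]
  module

lemma qUp_mul_qLow : qUp m k * qLow m k = 0 := by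
  have h := algQ_mul_self (m := m) (k := k)
  simp only [qUp, qLow, smul_mul_smul_comm, mul_sub, add_mul, mul_one, one_mul, h]
  module

lemma qLow_mul_qUp : qLow m k * qUp m k = 0 := by
  have h := algQ_mul_self (m := m) (k := k)
  simp only [qUp, qLow, smul_mul_smul_comm, sub_mul, mul_add, mul_one, one_mul, h]
  module

lemma qUp_add_qLow : qUp m k + qLow m k = 1 := by
  rw [qUp, qLow]; module

/-- The determinant of the upper left block of size `m + 1`, as that of a full matrix with the identity
as its lower block. -/
def upperDet (X : CAlg m k) : ℂ := det (qUp m k * X * qUp m k + qLow m k)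

lemma continuous_upperDet : Continuous (upperDet : CAlg m k → ℂ) :=
  continuous_det.comp (((continuous_const.mul continuous_id).mul continuous_const).add
    continuous_const)

lemma upperDet_one : upperDet (1 : CAlg m k) = 1 := by
  rw [upperDet, mul_one, qUp_mul_self, qUp_add_qLow, det_one]

lemma qUp_comm {X : CAlg m k} (h : algQ m k * X = X * algQ m k) :
    qUp m k * X = X * qUp m k := by
  rw [qUp, smul_mul_assoc, mul_smul_comm, add_mul, mul_add, h, one_mul, mul_one]

lemma upperDet_mul {X Y : CAlg m k}
    (hY : algQ m k * Y = Y * algQ m k) : upperDet (X * Y) = upperDet X * upperDet Y := by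
  rw [upperDet, upperDet, upperDet, ← det_mul]
  congr 1
  have h2 := qUp_comm hY
  calc qUp m k * (X * Y) * qUp m k + qLow m k
      = qUp m k * X * Y * (qUp m k * qUp m k) + qLow m k := by rw [qUp_mul_self, mul_assoc _ X Y]
    _ = qUp m k * X * (Y * qUp m k) * qUp m k + qLow m k := by noncomm_ring
    _ = qUp m k * X * (qUp m k * qUp m k * Y) * qUp m k + qUp m k * X * (qUp m k * qLow m k) +
        qLow m k * qUp m k * Y * qUp m k + qLow m k * qLow m k := by
      rw [qUp_mul_self, h2, qUp_mul_qLow, qLow_mul_qUp, qLow_mul_self]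
      simp
    _ = _ := by noncomm_ring

lemma upperDet_tr (X : CAlg m k) : upperDet (tr X) = upperDet X := by
  have h1 : tr (qUp m k) = qUp m k := by rw [qUp, map_smul, map_add, tr_one, tr_algQ]
  have h2 : tr (qLow m k) = qLow m k := by rw [qLow, map_smul, map_sub, tr_one, tr_algQ]
  rw [upperDet, ← det_tr, map_add, tr_mul, tr_mul, tr_tr, h1, h2, ← mul_assoc, upperDet]

lemma algQ_comm_tr {X : CAlg m k} (h : algQ m k * X = X * algQ m k) :
    algQ m k * tr X = tr X * algQ m k := by
  have := congrArg tr h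
  rw [tr_mul, tr_mul, tr_algQ] at this
  exact this.symm

lemma upperDet_sq {X : CAlg m k} (h : algQ m k * X = X * algQ m k) (h1 : X * tr X = 1) :
    upperDet X = 1 ∨ upperDet X = -1 := by
  have h2 := upperDet_mul (X := X) (algQ_comm_tr h)
  rw [h1, upperDet_one, upperDet_tr] at h2
  exact mul_self_eq_one_iff.1 h2.symm

/-- On orthogonal matrices commuting with `Q`, the upper determinant is locally constant. -/
lemma eventually_upperDet_eq {N : Type*} [TopologicalSpace N] {X : N → CAlg m k} {x : N}
    (hX : ContinuousAt X x)
    (h : ∀ᶠ y in nhds x, algQ m k * X y = X y * algQ m k ∧ X y * tr (X y) = 1) :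
    ∀ᶠ y in nhds x, upperDet (X y) = upperDet (X x) := by
  have hc : ContinuousAt (fun y => upperDet (X y)) x := continuous_upperDet.continuousAt.comp hX
  have h0 := h.self_of_nhds
  have hd : ∀ᶠ y in nhds x, dist (upperDet (X y)) (upperDet (X x)) < 2 :=
    hc.eventually (Metric.ball_mem_nhds _ (by norm_num))
  filter_upwards [h, hd] with y hy hy'
  have h2 : dist (1 : ℂ) (-1) = 2 := by rw [dist_eq_norm]; norm_num
  rcases upperDet_sq hy.1 hy.2 with e | e <;> rcases upperDet_sq h0.1 h0.2 with e' | e' <;>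
    rw [e, e'] at hy' ⊢
  · rw [h2] at hy'; exact absurd hy' (lt_irrefl _)
  · rw [dist_comm, h2] at hy'; exact absurd hy' (lt_irrefl _)

/-- The matrix whose only nonzero entry is `1`, in the middle. -/
def midMat (m k : ℕ) : CAlg m k := positionMat (EuclideanSpace.single (mid m k) 1)

lemma mul_midMat_apply (X : CAlg m k) (i j : Idx m k) :
    (X * midMat m k).toMat i j = if j = mid m k then X.toMat i (mid m k) else 0 := by
  rw [toMat_mul, Matrix.mul_apply]
  simp only [midMat, positionMat_apply]
  split_ifs with h
  · rw [Finset.sum_eq_single (mid m k)]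
    · simp
    · intro b _ hb; simp [hb]
    · simp
  · simp

lemma mul_midMat_eq_positionMat_iff {X : CAlg m k} {u : Ambient m k} :
    X * midMat m k = positionMat u ↔ ∀ i, X.toMat i (mid m k) = ((u i : ℝ) : ℂ) := by
  constructor
  · intro h i
    have := congrArg (fun Y : CAlg m k => Y.toMat i (mid m k)) h
    simpa only [mul_midMat_apply, positionMat_apply, if_true] using this
  · intro h
    apply toMat_injective
    ext i j
    rw [mul_midMat_apply, positionMat_apply, h]

lemma mul_signDiag_apply (d : Idx m k → ℤˣ) (A : CAlg m k) (i j : Idx m k) :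
    (A * ofMat (signDiag d : CMat m k)).toMat i j = A.toMat i j * (((d j : ℤˣ) : ℤ) : ℂ) :=
  Matrix.mul_diagonal (fun i => ((d i : ℤ) : ℂ)) A.toMat i j

lemma signDiag_mul_apply (d : Idx m k → ℤˣ) (A : CAlg m k) (i j : Idx m k) :
    (ofMat (signDiag d : CMat m k) * A).toMat i j = (((d i : ℤˣ) : ℤ) : ℂ) * A.toMat i j :=
  Matrix.diagonal_mul (fun i => ((d i : ℤ) : ℂ)) A.toMat i j

lemma signDiag_comm_apply {d : Idx m k → ℤˣ} {K : CAlg m k}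
    (h : ofMat (signDiag d : CMat m k) * K = K * ofMat (signDiag d : CMat m k)) (i j : Idx m k) :
    (((d i : ℤˣ) : ℤ) : ℂ) * K.toMat i j = K.toMat i j * (((d j : ℤˣ) : ℤ) : ℂ) := by
  have h1 := congrArg (fun A : CAlg m k => A.toMat i j) h
  rwa [signDiag_mul_apply, mul_signDiag_apply] at h1

lemma toMat_qUp : (qUp m k).toMat = Matrix.fromBlocks 1 0 0 (Matrix.fromBlocks 1 0 0 0) := by
  ext i j
  change (1 / 2 : ℂ) * ((1 : CMat m k) i j + Matrix.diagonal _ i j) = _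
  rcases i with i | i | i <;> rcases j with j | j | j
  all_goals simp [Matrix.one_apply, Matrix.diagonal_apply]
  all_goals (try split_ifs) <;> norm_num

lemma toMat_qLow : (qLow m k).toMat = Matrix.fromBlocks 0 0 0 (Matrix.fromBlocks 0 0 0 1) := by
  ext i j
  change (1 / 2 : ℂ) * ((1 : CMat m k) i j - Matrix.diagonal _ i j) = _
  rcases i with i | i | i <;> rcases j with j | j | j
  all_goals simp [Matrix.one_apply, Matrix.diagonal_apply]
  all_goals (try split_ifs) <;> norm_num

lemma upperDet_fromBlocks (A : Matrix (Fin m) (Fin m) ℝ) (B : Matrix (Fin k) (Fin k) ℝ) :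
    upperDet (ofMat (Matrix.fromBlocks (A.map (algebraMap ℝ ℂ)) 0 0
      (Matrix.fromBlocks 1 0 0 (B.map (algebraMap ℝ ℂ)))) : CAlg m k) = ((A.det : ℝ) : ℂ) := by
  change ((qUp m k).toMat * _ * (qUp m k).toMat + (qLow m k).toMat).det = _
  rw [toMat_qUp, toMat_qLow]
  simp only [ofMat, Matrix.fromBlocks_multiply, Matrix.fromBlocks_add, Matrix.zero_mul,
    Matrix.mul_zero, add_zero, zero_add, Matrix.one_mul, Matrix.mul_one,
    Matrix.det_fromBlocks_zero₂₁, Matrix.det_one, mul_one]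
  rw [← RingHom.mapMatrix_apply, ← RingHom.map_det]
  rfl

lemma upperDet_blockHom (g : Matrix.specialOrthogonalGroup (Fin m) ℝ ×
    Matrix.specialOrthogonalGroup (Fin k) ℝ) : upperDet (ofMat (blockHom m k g)) = 1 := by
  refine (upperDet_fromBlocks (g.1 : Matrix (Fin m) (Fin m) ℝ)
    (g.2 : Matrix (Fin k) (Fin k) ℝ)).trans ?_
  rw [(Matrix.mem_specialOrthogonalGroup_iff.1 g.1.2).2, Complex.ofReal_one]

/-- The real orthogonal matrices `diag(A, 1, B)` with `det A = det B = 1`. -/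
lemma exists_blockHom_eq {K : CAlg m k} (hcj : cj K = K) (htr : K * tr K = 1) (hdet : det K = 1)
    (hP : algP m k * K = K * algP m k) (hQ : algQ m k * K = K * algQ m k)
    (hmid : K * midMat m k = midMat m k) (hup : upperDet K = 1) :
    ∃ g, blockHom m k g = K.toMat := by
  have hre : ∀ i j, (((K.toMat i j).re : ℝ) : ℂ) = K.toMat i j := fun i j => by
    have := congrArg (fun Y : CAlg m k => Y.toMat i j) hcj
    exact Complex.conj_eq_iff_re.1 this
  have hP' := fun i j => signDiag_comm_apply hP i j
  have hQ' := fun i j => signDiag_comm_apply hQ i j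
  have key : ∀ z : ℂ, z = -z → z = 0 := fun z hz => self_eq_neg.1 hz
  have z1 : ∀ i j, K.toMat (Sum.inl i) (Sum.inr j) = 0 := fun i j => by
    have := hP' (Sum.inl i) (Sum.inr j)
    simp at this
    exact key _ this
  have z2 : ∀ i j, K.toMat (Sum.inr j) (Sum.inl i) = 0 := fun i j => by
    have := hP' (Sum.inr j) (Sum.inl i)
    simp at this
    exact key _ this.symm
  have z3 : ∀ i j, K.toMat (Sum.inr (Sum.inl i)) (Sum.inr (Sum.inr j)) = 0 := fun i j => by
    have := hQ' (Sum.inr (Sum.inl i)) (Sum.inr (Sum.inr j))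
    simp at this
    exact key _ this
  have z4 : ∀ i j, K.toMat (Sum.inr (Sum.inr j)) (Sum.inr (Sum.inl i)) = 0 := fun i j => by
    have := hQ' (Sum.inr (Sum.inr j)) (Sum.inr (Sum.inl i))
    simp at this
    exact key _ this.symm
  have z5 : ∀ i j : Unit, K.toMat (Sum.inr (Sum.inl i)) (Sum.inr (Sum.inl j)) = 1 := fun i j => by
    have := (mul_midMat_eq_positionMat_iff (X := K)).1 hmid (mid m k)
    simpa using this
  set A : Matrix (Fin m) (Fin m) ℝ := Matrix.of fun i j => (K.toMat (Sum.inl i) (Sum.inl j)).re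
  set B : Matrix (Fin k) (Fin k) ℝ := Matrix.of fun i j =>
    (K.toMat (Sum.inr (Sum.inr i)) (Sum.inr (Sum.inr j))).re
  have hK : K.toMat = Matrix.fromBlocks (A.map (algebraMap ℝ ℂ)) 0 0
      (Matrix.fromBlocks 1 0 0 (B.map (algebraMap ℝ ℂ))) := by
    ext i j
    rcases i with i | i | i <;> rcases j with j | j | j
    all_goals simp [z1, z2, z3, z4, z5, A, B, hre]
  have hinj : Function.Injective (algebraMap ℝ ℂ) := (algebraMap ℝ ℂ).injective
  have hAB : A * A.transpose = 1 ∧ B * B.transpose = 1 := by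
    have h1 : K.toMat * K.toMat.transpose = 1 := htr
    rw [hK, Matrix.fromBlocks_transpose, Matrix.fromBlocks_transpose, Matrix.fromBlocks_multiply,
      Matrix.fromBlocks_multiply, ← Matrix.fromBlocks_one, ← Matrix.fromBlocks_one,
      Matrix.fromBlocks_inj] at h1
    obtain ⟨h2, -, -, h3⟩ := h1
    simp only [Matrix.transpose_zero, Matrix.zero_mul, Matrix.mul_zero, zero_add, add_zero] at h2 h3
    rw [Matrix.fromBlocks_inj] at h3
    obtain ⟨-, -, -, h3⟩ := h3
    constructor
    · apply Matrix.map_injective hinj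
      beta_reduce
      rw [Matrix.map_mul, Matrix.transpose_map, h2, Matrix.map_one _ (map_zero _) (map_one _)]
    · apply Matrix.map_injective hinj
      beta_reduce
      rw [Matrix.map_mul, Matrix.transpose_map, h3, Matrix.map_one _ (map_zero _) (map_one _)]
  have hA : A.det = 1 := by
    have h1 := upperDet_fromBlocks A B
    rw [← hK] at h1
    exact hinj (by rw [map_one]; exact h1.symm.trans hup)
  have hB : B.det = 1 := by
    have h1 : K.toMat.det = 1 := hdet
    rw [hK] at h1
    simp only [Matrix.det_fromBlocks_zero₂₁, Matrix.det_one, one_mul] at h1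
    rw [← RingHom.mapMatrix_apply, ← RingHom.map_det, ← RingHom.mapMatrix_apply,
      ← RingHom.map_det, hA, map_one, one_mul] at h1
    exact hinj (by rw [h1, map_one])
  refine ⟨⟨⟨A, Matrix.mem_specialOrthogonalGroup_iff.2
    ⟨(Matrix.mem_orthogonalGroup_iff _ _).2 hAB.1, hA⟩⟩, ⟨B, Matrix.mem_specialOrthogonalGroup_iff.2
    ⟨(Matrix.mem_orthogonalGroup_iff _ _).2 hAB.2, hB⟩⟩⟩, ?_⟩
  rw [hK]
  rfl

end UpperDet

/-! ### Adapted frames -/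

section Frames

open CAlg

variable {m k : ℕ} {M : Type*} [TopologicalSpace M] [ChartedSpace (Coord m) M]
  {f : M → Ambient m k} {c : ℝ} {r s : ℂ} {p : M} {Ψ : M → loopGroup m k} {x : M}

/-- `E` is an oriented orthonormal frame of `ℝ^{m+k+1}` whose first `m` columns span the tangent
space at `x`, whose middle column is the position vector and whose last `k` columns span the normal
space. The last condition fixes the orientation of the first `m + 1` columns after transport to the
base point by the solution `Ψ` at the loop parameter `1`. -/
structure IsAdaptedFrame (f : M → Ambient m k) (Ψ : M → loopGroup m k) (x : M)
    (E : CAlg m k) : Prop where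
  cj_eq : cj E = E
  mul_tr : E * tr E = 1
  det_eq_one : det E = 1
  reflT_mul : reflT f x * E = E * algP m k
  reflC_mul : reflC f x * E = E * algQ m k
  mul_midMat : E * midMat m k = positionMat (f x)
  upperDet_eq_one : upperDet (val (Ψ x).1 1 * E) = 1

variable [IsManifold (𝓡 m) ∞ M]

/-- The loop `λ ↦ Ψ_λ(x) E`. -/
def frameLoop (Ψ : M → loopGroup m k) (x : M) {E : CAlg m k} (h1 : E * tr E = 1)
    (h2 : det E = 1) : loopGroup m k :=
  Ψ x * ⟨_, const_mem_loopGroup h1 h2⟩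

lemma val_frameLoop {E : CAlg m k} (h1 : E * tr E = 1) (h2 : det E = 1) (l : ℂˣ) :
    val (frameLoop Ψ x h1 h2).1 l = val (Ψ x).1 l * E := rfl

section Connected

variable [PreconnectedSpace M]

variable (h : IsGlobalParallel f c r s p Ψ) (hf : IsSphereImmersion f)
  (hr : r ^ 2 = c) (hs : s ^ 2 = 1 - c) (hc1 : c ≠ 1)
include h hf hr hs hc1

lemma frameLoop_mem (hR : reflT f p = algP m k) (hS : reflC f p = algQ m k) {E : CAlg m k}
    (hE : IsAdaptedFrame f Ψ x E) :
    (frameLoop Ψ x hE.mul_tr hE.det_eq_one).1 ∈ twistedLoops m k c := by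
  refine mem_twistedLoops_iff.2 ⟨(frameLoop Ψ x hE.mul_tr hE.det_eq_one).2, fun l => ?_,
    fun l => ?_, fun l => ?_⟩
  · rw [val_frameLoop, val_frameLoop, ← h.mul_reflT hf hr hs hc1 hR l, mul_assoc, mul_assoc,
      ← hE.reflT_mul, ← mul_assoc, ← mul_assoc]
  · rw [val_frameLoop, val_frameLoop, ← h.mul_reflC hf hr hs hc1 hS l, mul_assoc, mul_assoc,
      ← hE.reflC_mul, ← mul_assoc, ← mul_assoc]
  · rw [val_frameLoop, val_frameLoop, cj_mul, h.cj_val hf hr hs hc1, hE.cj_eq]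

/-- Conjugation by `Q` at the loop parameter `1`. -/
lemma algQ_mul_val_one (hS : reflC f p = algQ m k) (x : M) :
    algQ m k * val (Ψ x).1 1 = val (Ψ x).1 1 * reflC f x := by
  have h1 := h.mul_reflC hf hr hs hc1 hS 1 x
  rw [inv_one] at h1
  have h2 : reflC f x * reflC f x = 1 := (hf.isTangentData x).reflConeMat_mul_self
  rw [← mul_one (algQ m k * val (Ψ x).1 1), ← h2, ← mul_assoc, h1]

lemma algQ_comm_val_mul (hS : reflC f p = algQ m k) {E : CAlg m k}
    (hE : reflC f x * E = E * algQ m k) :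
    algQ m k * (val (Ψ x).1 1 * E) = val (Ψ x).1 1 * E * algQ m k := by
  rw [← mul_assoc, algQ_mul_val_one h hf hr hs hc1 hS, mul_assoc, hE, mul_assoc]

/-- Two adapted frames at the same point differ by an element of `SO(m) × 1 × SO(k)`. -/
lemma IsAdaptedFrame.exists_blockHom_eq {E E' : CAlg m k}
    (hE : IsAdaptedFrame f Ψ x E) (hE' : IsAdaptedFrame f Ψ x E') :
    ∃ g, blockHom m k g = (tr E * E').toMat := by
  have hE1 := mul_tr_eq_one hE.mul_tr
  have hE1' := mul_tr_eq_one hE'.mul_tr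
  have hRt : tr (reflT f x) = reflT f x := (hf.isTangentData x).reflTangentMat_tr
  have hSt : tr (reflC f x) = reflC f x := (hf.isTangentData x).reflConeMat_tr
  have e1 : algQ m k * tr E = tr E * reflC f x := by
    have := congrArg tr hE.reflC_mul
    rw [tr_mul, tr_mul, tr_algQ, hSt] at this
    exact this.symm
  have e2 : algP m k * tr E = tr E * reflT f x := by
    have := congrArg tr hE.reflT_mul
    rw [tr_mul, tr_mul, tr_algP, hRt] at this
    exact this.symm
  have hQ : algQ m k * (tr E * E') = tr E * E' * algQ m k := by
    rw [← mul_assoc, e1, mul_assoc, hE'.reflC_mul, mul_assoc]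
  refine SpaceForm.exists_blockHom_eq ?_ ?_ ?_ ?_ hQ ?_ ?_
  · rw [cj_mul, ← tr_cj, hE.cj_eq, hE'.cj_eq]
  · rw [tr_mul, tr_tr, mul_assoc, ← mul_assoc E', hE'.mul_tr, one_mul, hE1]
  · rw [det_mul, det_tr, hE.det_eq_one, hE'.det_eq_one, one_mul]
  · rw [← mul_assoc, e2, mul_assoc, hE'.reflT_mul, mul_assoc]
  · rw [mul_assoc, hE'.mul_midMat, ← hE.mul_midMat, ← mul_assoc, hE1, one_mul]
  · have e : val (Ψ x).1 1 * E' = val (Ψ x).1 1 * E * (tr E * E') := by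
      rw [mul_assoc, ← mul_assoc E, hE.mul_tr, one_mul]
    have := hE'.upperDet_eq_one
    rw [e, upperDet_mul hQ,
      hE.upperDet_eq_one, one_mul] at this
    exact this

/-- Adapted frames are carried to adapted frames at nearby points, and back. -/
lemma exists_local_frame (hS : reflC f p = algQ m k) (x₀ : M) :
    ∃ U H, IsLocalParallel f c x₀ U H ∧
      (∀ y ∈ U, ∀ l : ℂˣ, val (Ψ y).1 l = val (Ψ x₀).1 l * H y (spectral r s l)) ∧
      ∀ x ∈ U, (∀ E, IsAdaptedFrame f Ψ x₀ E → IsAdaptedFrame f Ψ x (tr (H x (-1, -1)) * E)) ∧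
        ∀ E, IsAdaptedFrame f Ψ x E → IsAdaptedFrame f Ψ x₀ (H x (-1, -1) * E) := by
  obtain ⟨U, H, hH, hU⟩ := h.exists_local x₀
  set V : M → CAlg m k := fun x => H x (-1, -1) with hV
  -- the orthogonal matrix `g` compares the transports to `p` of frames at `x` and `x₀`; it commutes
  -- with `Q`, so that its upper determinant is locally constant
  set g : M → CAlg m k := fun x => val (Ψ x).1 1 * tr (V x) * tr (val (Ψ x₀).1 1) with hg
  have hSt : ∀ x, tr (reflC f x) = reflC f x := fun x => (hf.isTangentData x).reflConeMat_tr
  have hRt : ∀ x, tr (reflT f x) = reflT f x := fun x => (hf.isTangentData x).reflTangentMat_tr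
  have hVS : ∀ x ∈ U, tr (V x) * reflC f x₀ = reflC f x * tr (V x) := fun x hx => by
    have := congrArg tr (hH.mul_reflC hx)
    rw [tr_mul, tr_mul, hSt, hSt] at this
    exact this.symm
  have hVR : ∀ x ∈ U, tr (V x) * reflT f x₀ = reflT f x * tr (V x) := fun x hx => by
    have := congrArg tr (hH.mul_reflT hx)
    rw [tr_mul, tr_mul, hRt, hRt] at this
    exact this.symm
  have hV1 : ∀ x ∈ U, V x * tr (V x) = 1 := fun x hx => hH.mul_tr hx _
  have hV2 : ∀ x ∈ U, tr (V x) * V x = 1 := fun x hx => mul_tr_eq_one (hV1 x hx)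
  have hVc : ∀ x ∈ U, cj (V x) = V x := fun x hx => by
    have := hH.cj_eq hx (-1, -1)
    simpa using this
  have hVpos : ∀ x ∈ U, tr (V x) * positionMat (f x₀) = positionMat (f x) := fun x hx => by
    rw [← hH.mul_positionMat hx, ← mul_assoc, hV2 x hx, one_mul]
  have hgQ : ∀ x ∈ U, algQ m k * g x = g x * algQ m k ∧ g x * tr (g x) = 1 := by
    intro x hx
    constructor
    · have e1 : reflC f x₀ * tr (val (Ψ x₀).1 1) = tr (val (Ψ x₀).1 1) * algQ m k := by
        have := congrArg tr (algQ_mul_val_one h hf hr hs hc1 hS x₀)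
        rw [tr_mul, tr_mul, tr_algQ, hSt] at this
        exact this.symm
      rw [hg]
      simp only
      rw [← mul_assoc, ← mul_assoc, algQ_mul_val_one h hf hr hs hc1 hS, mul_assoc (val (Ψ x).1 1),
        ← hVS x hx, ← mul_assoc, mul_assoc _ (reflC f x₀), e1, mul_assoc, mul_assoc, mul_assoc]
    · have e1 : tr (val (Ψ x₀).1 1) * val (Ψ x₀).1 1 = 1 := mul_tr_eq_one (h.mul_tr 1 x₀)
      rw [hg]
      simp only [tr_mul, tr_tr]
      calc val (Ψ x).1 1 * tr (V x) * tr (val (Ψ x₀).1 1) *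
            (val (Ψ x₀).1 1 * (V x * tr (val (Ψ x).1 1)))
          = val (Ψ x).1 1 * tr (V x) * (tr (val (Ψ x₀).1 1) * val (Ψ x₀).1 1) *
            (V x * tr (val (Ψ x).1 1)) := by noncomm_ring
        _ = val (Ψ x).1 1 * (tr (V x) * V x) * tr (val (Ψ x).1 1) := by
          rw [e1]; noncomm_ring
        _ = 1 := by rw [hV2 x hx, mul_one, h.mul_tr]
  have hVx₀ : V x₀ = 1 := hH.eq_one _
  have hgx₀ : upperDet (g x₀) = 1 := by
    have : g x₀ = 1 := by
      rw [hg]; simp only [hVx₀, tr_one, mul_one, h.mul_tr]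
    rw [this, upperDet_one]
  have hgc : ContinuousAt g x₀ := by
    have c1 : ContinuousAt (fun y => val (Ψ y).1 1) x₀ :=
      (h.isParallelAt hr hs hc1 1 x₀).continuousAt
    have c2 : ContinuousAt V x₀ := by
      have c3 := hH.smooth.continuousOn.comp (f := fun y => (y, ((-1, -1) : ℂ × ℂ))) (s := U)
        (by fun_prop) fun y hy => ⟨hy, Set.mem_univ _⟩
      exact c3.continuousAt (hH.isOpen.mem_nhds hH.mem)
    exact (c1.mul (tr.continuous.continuousAt.comp c2)).mul continuousAt_const
  have hev := eventually_upperDet_eq hgc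
    (Filter.eventually_of_mem (hH.isOpen.mem_nhds hH.mem) hgQ)
  obtain ⟨O, hO, hOo, hxO⟩ := eventually_nhds_iff.1 hev
  refine ⟨U ∩ O, H, hH.mono (hH.isOpen.inter hOo) ⟨hH.mem, hxO⟩ Set.inter_subset_left,
    fun y hy => hU y hy.1, fun x hx => ?_⟩
  have hgx : upperDet (g x) = 1 := by rw [hO x hx.2, hgx₀]
  have hxU := hx.1
  have hgE : ∀ E, val (Ψ x).1 1 * (tr (V x) * E) = g x * (val (Ψ x₀).1 1 * E) := fun E => by
    have e1 : tr (val (Ψ x₀).1 1) * val (Ψ x₀).1 1 = 1 := mul_tr_eq_one (h.mul_tr 1 x₀)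
    rw [hg]
    simp only
    rw [mul_assoc, ← mul_assoc (tr (val (Ψ x₀).1 1)), e1, one_mul, mul_assoc]
  constructor
  · intro E hE
    refine ⟨?_, ?_, ?_, ?_, ?_, ?_, ?_⟩
    · rw [cj_mul, ← tr_cj, hVc x hxU, hE.cj_eq]
    · rw [tr_mul, tr_tr, mul_assoc, ← mul_assoc E, hE.mul_tr, one_mul, hV2 x hxU]
    · rw [det_mul, det_tr, hH.det_eq_one hxU, hE.det_eq_one, one_mul]
    · rw [← mul_assoc, ← hVR x hxU, mul_assoc, hE.reflT_mul, mul_assoc]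
    · rw [← mul_assoc, ← hVS x hxU, mul_assoc, hE.reflC_mul, mul_assoc]
    · rw [mul_assoc, hE.mul_midMat, hVpos x hxU]
    · rw [hgE, upperDet_mul (algQ_comm_val_mul h hf hr hs hc1 hS hE.reflC_mul), hgx,
        hE.upperDet_eq_one, one_mul]
  · intro E hE
    have hSV : reflC f x₀ * (V x * E) = V x * E * algQ m k := by
      rw [← mul_assoc, ← hH.mul_reflC hxU, mul_assoc, hE.reflC_mul, mul_assoc]
    refine ⟨?_, ?_, ?_, ?_, hSV, ?_, ?_⟩
    · rw [cj_mul, hVc x hxU, hE.cj_eq]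
    · rw [tr_mul, mul_assoc, ← mul_assoc E, hE.mul_tr, one_mul, hV1 x hxU]
    · rw [det_mul, hH.det_eq_one hxU, hE.det_eq_one, one_mul]
    · rw [← mul_assoc, ← hH.mul_reflT hxU, mul_assoc, hE.reflT_mul, mul_assoc]
    · rw [mul_assoc, hE.mul_midMat, hH.mul_positionMat hxU]
    · have := hE.upperDet_eq_one
      have e : E = tr (V x) * (V x * E) := by rw [← mul_assoc, hV2 x hxU, one_mul]
      rw [e, hgE, upperDet_mul (algQ_comm_val_mul h hf hr hs hc1 hS hSV), hgx,
        one_mul] at this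
      exact this

/-- Adapted frames exist at all points: the set where they do is open, closed and contains `p`. -/
theorem exists_adaptedFrame (hp : f p = EuclideanSpace.single (mid m k) 1)
    (hR : reflT f p = algP m k) (hS : reflC f p = algQ m k) (x : M) :
    ∃ E, IsAdaptedFrame f Ψ x E := by
  choose U H hH _ hUE using fun x₀ => exists_local_frame h hf hr hs hc1 hS x₀
  have hclopen : IsClopen {x | ∃ E, IsAdaptedFrame f Ψ x E} := by
    constructor
    · rw [← isOpen_compl_iff, isOpen_iff_mem_nhds]
      intro x₀ hx₀
      filter_upwards [(hH x₀).isOpen.mem_nhds (hH x₀).mem] with x hx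
      rintro ⟨E, hE⟩
      exact hx₀ ⟨_, (hUE x₀ x hx).2 E hE⟩
    · rw [isOpen_iff_mem_nhds]
      rintro x₀ ⟨E, hE⟩
      filter_upwards [(hH x₀).isOpen.mem_nhds (hH x₀).mem] with x hx
      exact ⟨_, (hUE x₀ x hx).1 E hE⟩
  have hne : {x | ∃ E, IsAdaptedFrame f Ψ x E}.Nonempty := by
    refine ⟨p, 1, cj_one, by rw [tr_one, mul_one], det_one, by rw [hR, mul_one, one_mul],
      by rw [hS, mul_one, one_mul], by rw [one_mul, hp, midMat], ?_⟩
    rw [h.val_base, mul_one, upperDet_one]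
  exact Set.eq_univ_iff_forall.1 (hclopen.eq_univ hne) x

end Connected

end Frames

/-! ### The Maurer–Cartan form of a map into the loop group -/

section MaurerCartan

open CAlg

variable {m k : ℕ} {M : Type*} [TopologicalSpace M] [ChartedSpace (Coord m) M]
  {c : ℝ} {Φ : M → twistedLoops m k c} {U : Set M} {x : M}

/-- The differential of `Φ_l`. -/
def loopDeriv (Φ : M → twistedLoops m k c) (l : ℂˣ) (x : M) : Coord m →L[ℝ] CAlg m k :=
  mfderiv (𝓡 m) 𝓘(ℝ, CAlg m k) (fun y => val (Φ y).1 l) x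

/-- The Maurer–Cartan form of `Φ_l`, with values in the algebra of matrices. -/
def mcForm (Φ : M → twistedLoops m k c) (l : ℂˣ) (x : M) (v : Coord m) : CAlg m k :=
  tr (val (Φ x).1 l) * loopDeriv Φ l x v

lemma loop_mul_tr (X : twistedLoops m k c) (l : ℂˣ) : val X.1 l * tr (val X.1 l) = 1 :=
  val_mul_tr (mem_twistedLoops_iff.1 X.2).1 l

lemma loop_tr_mul (X : twistedLoops m k c) (l : ℂˣ) : tr (val X.1 l) * val X.1 l = 1 :=
  tr_val_mul (mem_twistedLoops_iff.1 X.2).1 l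

lemma loopDeriv_eq (l : ℂˣ) (v : Coord m) : loopDeriv Φ l x v = val (Φ x).1 l * mcForm Φ l x v := by
  rw [mcForm, ← mul_assoc, loop_mul_tr, one_mul]

lemma maurerCartan_eq {l : ℂˣ} (h : HasDifferential (fun y => val (Φ y).1 l) (loopDeriv Φ l x) x)
    (v : Coord m) : maurerCartan Φ x v l = (mcForm Φ l x v).toMat := by
  have h1 : (((Φ x : Maps m k) l)⁻¹ : GL (Idx m k) ℂ).val = (tr (val (Φ x).1 l)).toMat :=
    congrArg toMat (val_inv (mem_twistedLoops_iff.1 (Φ x).2).1 l)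
  have h2 : (Matrix.of fun i j => mfderiv (𝓡 m) 𝓘(ℝ, ℂ)
      (fun y => ((Φ y : Maps m k) l : Matrix (Idx m k) (Idx m k) ℂ) i j) x v) =
      (loopDeriv Φ l x v).toMat := by
    ext i j
    have h3 := h.comp_left (g := fun X => X.toMat i j)
      ((entry i j).restrictScalars ℝ).hasFDerivAt
    exact DFunLike.congr_fun h3.mfderiv v
  rw [mcForm, toMat_mul]
  exact congrArg₂ HMul.hMul h1 h2

lemma HasDifferential.mul {A B : M → CAlg m k} {A' B' : Coord m →L[ℝ] CAlg m k}
    (hA : HasDifferential A A' x) (hB : HasDifferential B B' x) [IsManifold (𝓡 m) ∞ M] :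
    ∃ K : Coord m →L[ℝ] CAlg m k, HasDifferential (fun y => A y * B y) K x ∧
      ∀ v, K v = A' v * B x + A x * B' v := by
  have h := (hA.prodMk hB).comp_left (g := fun q : CAlg m k × CAlg m k => q.1 * q.2)
    ((hasFDerivAt_fst (𝕜 := ℝ)).mul' hasFDerivAt_snd)
  refine ⟨_, h, fun v => ?_⟩
  change A x * B' v + A' v * B x = _
  rw [add_comm]

lemma SmoothFrameOn.hasDifferential (h : SmoothFrameOn Φ U) (hU : IsOpen U) (hx : x ∈ U) (l : ℂˣ) :
    HasDifferential (fun y => val (Φ y).1 l) (loopDeriv Φ l x) x := by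
  have h1 : ContMDiffOn (𝓡 m) 𝓘(ℝ, CAlg m k) ∞ (fun y => val (Φ y).1 l) U := by
    refine contMDiffOn_of_entries fun i j => ?_
    have h2 : ContMDiffOn (𝓡 m) ((𝓡 m).prod 𝓘(ℝ, ℂ)) ∞ (fun y : M => (y, l)) U :=
      contMDiffOn_id.prodMk contMDiffOn_const
    exact (h i j).comp h2 fun y hy => ⟨hy, Set.mem_univ _⟩
  exact ((h1.contMDiffAt (hU.mem_nhds hx)).mdifferentiableAt (by simp)).hasMFDerivAt

lemma smoothFrameOn_of_val {H : M × ℂˣ → CAlg m k}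
    (hH : ContMDiffOn ((𝓡 m).prod 𝓘(ℝ, ℂ)) 𝓘(ℝ, CAlg m k) ∞ H (U ×ˢ Set.univ))
    (h : ∀ y ∈ U, ∀ l, val (Φ y).1 l = H (y, l)) : SmoothFrameOn Φ U := fun i j =>
  (ContMDiffOn.toMat hH i j).congr fun q hq => by
    rw [← h q.1 hq.1 q.2, toMat_val]

lemma sum_Icc_neg_one_one {V : Type*} [AddCommMonoid V] (g : ℤ → V) :
    ∑ n ∈ Finset.Icc (-1 : ℤ) 1, g n = g (-1) + g 0 + g 1 := by
  have : Finset.Icc (-1 : ℤ) 1 = {-1, 0, 1} := rfl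
  rw [this, Finset.sum_insert (by decide), Finset.sum_insert (by decide), Finset.sum_singleton,
    add_assoc]

/-- The condition on the connection order in terms of `mcForm`. -/
lemma hasConnectionOrderOn_iff (h : SmoothFrameOn Φ U) (hU : IsOpen U) :
    HasConnectionOrderOn (-1) 1 Φ U ↔ ∀ x ∈ U, ∀ v : Coord m, ∃ X Y Z : CAlg m k, ∀ l : ℂˣ,
      mcForm Φ l x v = (l : ℂ)⁻¹ • X + Y + (l : ℂ) • Z := by
  refine forall_congr' fun x => forall_congr' fun hx => forall_congr' fun v => ?_
  constructor
  · rintro ⟨A, hA⟩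
    refine ⟨ofMat (A (-1)), ofMat (A 0), ofMat (A 1), fun l => ?_⟩
    apply toMat_injective
    refine (maurerCartan_eq (h.hasDifferential hU hx l) v).symm.trans ((hA l).trans ?_)
    rw [sum_Icc_neg_one_one, zpow_neg_one, zpow_zero, zpow_one, one_smul]
    rfl
  · rintro ⟨X, Y, Z, hA⟩
    refine ⟨fun n => if n = -1 then X.toMat else if n = 0 then Y.toMat else Z.toMat, fun l => ?_⟩
    refine (maurerCartan_eq (h.hasDifferential hU hx l) v).trans ?_
    rw [hA, sum_Icc_neg_one_one, zpow_neg_one, zpow_zero, zpow_one, one_smul]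
    rfl

/-- Equality of classes modulo `SO(m) × 1 × SO(k)`. -/
lemma mk_eq_mk_iff {X Y : twistedLoops m k c} :
    (QuotientGroup.mk X : LoopQuot m k c) = QuotientGroup.mk Y ↔
      ∃ g, ∀ l, val Y.1 l = val X.1 l * ofMat (blockHom m k g) := by
  rw [QuotientGroup.eq]
  change (X.1⁻¹ * Y.1 ∈ constLoops m k) ↔ _
  constructor
  · rintro ⟨g, hg⟩
    refine ⟨g, fun l => ?_⟩
    have h1 : val (X.1⁻¹ * Y.1) l = ofMat (blockHom m k g) := by rw [← hg]; rfl
    rw [← h1, val_mul, val_inv (mem_twistedLoops_iff.1 X.2).1, ← mul_assoc, loop_mul_tr, one_mul]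
  · rintro ⟨g, hg⟩
    refine ⟨g, val_injective fun l => ?_⟩
    rw [val_mul, hg, val_inv (mem_twistedLoops_iff.1 X.2).1, ← mul_assoc, loop_tr_mul, one_mul]
    rfl

end MaurerCartan

/-! ### Existence -/

section Existence

open CAlg

variable {m k : ℕ} {M : Type*} [TopologicalSpace M] [ChartedSpace (Coord m) M]
  [IsManifold (𝓡 m) ∞ M] [PreconnectedSpace M]
  {f : M → Ambient m k} {c : ℝ} {r s : ℂ} {p : M} {Ψ : M → loopGroup m k}
  (h : IsGlobalParallel f c r s p Ψ) (hf : IsSphereImmersion f)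
  (hr : r ^ 2 = c) (hs : s ^ 2 = 1 - c) (hc1 : c ≠ 1)
include h hf hr hs hc1

/-- The solution is trivial at the loop parameter `λ₀`. -/
lemma val_eq_one (hc0 : c ≠ 0) {l₀ : ℂˣ} (hl₀ : (l₀ : ℂ) = (1 + s) / r) (x : M) :
    val (Ψ x).1 l₀ = 1 := by
  refine eq_of_isParallel (p := p) hf (C := fun _ => 1) (h.isParallelAt hr hs hc1 l₀) (fun x => ?_)
    (fun x => by rw [tr_one, mul_one]) (h.val_base l₀) x
  rw [spectral_zero hr hs hc0 hc1 hl₀, IsParallelAt]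
  convert HasDifferential.const (m := m) (1 : CAlg m k) x using 1
  ext1 v
  change (1 : CAlg m k) * ((0 : ℂ) • theta f x v + (0 : ℂ) • beta f x v) = 0
  simp

/-- A map into the quotient is obtained by multiplying the global solution with adapted frames. The
powers of `λ` in its Maurer–Cartan form are those of the parameters `spectral r s λ`. -/
theorem exists_connectionOrderMap (hc0 : c ≠ 0)
    (hp : f p = EuclideanSpace.single (mid m k) 1)
    (hR : reflT f p = algP m k) (hS : reflC f p = algQ m k) {l₀ : ℂˣ}
    (hl₀ : (l₀ : ℂ) = (1 + s) / r) :
    ∃ F : M → LoopQuot m k c, IsConnectionOrderMap (-1) 1 p F ∧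
      (∀ x i, midColumn l₀ (F x) i = ((f x i : ℝ) : ℂ)) ∧
      ∀ x (X : twistedLoops m k c) E, IsAdaptedFrame f Ψ x E →
        (∀ l, val X.1 l = val (Ψ x).1 l * E) → F x = QuotientGroup.mk X := by
  have hloop : ∀ x E, IsAdaptedFrame f Ψ x E → ∃ X : twistedLoops m k c,
      ∀ l, val X.1 l = val (Ψ x).1 l * E := fun x E hE =>
    ⟨⟨_, frameLoop_mem h hf hr hs hc1 hR hS hE⟩, fun l => rfl⟩
  have hclass : ∀ x (X Y : twistedLoops m k c) E E', IsAdaptedFrame f Ψ x E →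
      IsAdaptedFrame f Ψ x E' → (∀ l, val X.1 l = val (Ψ x).1 l * E) →
      (∀ l, val Y.1 l = val (Ψ x).1 l * E') →
      (QuotientGroup.mk X : LoopQuot m k c) = QuotientGroup.mk Y := by
    intro x X Y E E' hE hE' hX hY
    obtain ⟨g, hg⟩ := hE.exists_blockHom_eq h hf hr hs hc1 hE'
    refine mk_eq_mk_iff.2 ⟨g, fun l => ?_⟩
    have hg' : ofMat (blockHom m k g) = tr E * E' := hg
    rw [hg', hX, hY, mul_assoc, ← mul_assoc E, hE.mul_tr, one_mul]
  choose E hE using exists_adaptedFrame h hf hr hs hc1 hp hR hS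
  choose X hX using fun x => hloop x (E x) (hE x)
  refine ⟨fun x => QuotientGroup.mk (X x), ⟨?_, fun x₀ => ?_⟩, fun x i => ?_,
    fun x Y E' hE' hY => hclass x _ _ _ _ (hE x) hE' (hX x) hY⟩
  · refine hclass p _ _ _ 1 (hE p) ⟨cj_one, by rw [tr_one, mul_one], det_one,
      by rw [hR, mul_one, one_mul], by rw [hS, mul_one, one_mul], by rw [one_mul, hp, midMat], ?_⟩
      (hX p) fun l => ?_
    · rw [h.val_base, mul_one, upperDet_one]
    · rw [h.val_base, mul_one]; rfl
  · obtain ⟨U, H, hH, hU, hUE⟩ := exists_local_frame h hf hr hs hc1 hS x₀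
    have h1 : ∀ y, ∃ Y : twistedLoops m k c, y ∈ U → ∀ l : ℂˣ,
        val Y.1 l = val (Ψ y).1 l * (tr (H y (-1, -1)) * E x₀) := fun y => by
      by_cases hy : y ∈ U
      · obtain ⟨Y, hY⟩ := hloop y _ ((hUE y hy).1 _ (hE x₀))
        exact ⟨Y, fun _ => hY⟩
      · exact ⟨1, fun h => absurd h hy⟩
    choose Φ hΦ using h1
    have hsm : SmoothFrameOn Φ U := by
      refine smoothFrameOn_of_val (H := fun q => val (Ψ x₀).1 q.2 * H q.1 (spectral r s q.2) *
        (tr (H q.1 (-1, -1)) * E x₀)) ?_ fun y hy l => by rw [hΦ y hy, hU y hy]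
      have s1 : ContMDiffOn ((𝓡 m).prod 𝓘(ℝ, ℂ)) 𝓘(ℝ, CAlg m k) ∞
          (fun q : M × ℂˣ => val (Ψ x₀).1 q.2) (U ×ˢ Set.univ) :=
        (contMDiff_val (Ψ x₀).2).comp_contMDiffOn contMDiffOn_snd
      have s2 : ContMDiffOn ((𝓡 m).prod 𝓘(ℝ, ℂ)) 𝓘(ℝ, CAlg m k) ∞
          (fun q : M × ℂˣ => H q.1 (spectral r s q.2)) (U ×ˢ Set.univ) := by
        have t : ContMDiffOn ((𝓡 m).prod 𝓘(ℝ, ℂ)) ((𝓡 m).prod 𝓘(ℝ, ℂ × ℂ)) ∞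
            (fun q : M × ℂˣ => (q.1, spectral r s q.2)) (U ×ˢ Set.univ) :=
          contMDiffOn_fst.prodMk
            ((contMDiff_spectral (𝕜 := ℝ) r s).comp_contMDiffOn contMDiffOn_snd)
        exact hH.smooth.comp t fun q hq => ⟨hq.1, Set.mem_univ _⟩
      have s3 : ContMDiffOn ((𝓡 m).prod 𝓘(ℝ, ℂ)) 𝓘(ℝ, CAlg m k) ∞
          (fun q : M × ℂˣ => H q.1 (-1, -1)) (U ×ˢ Set.univ) := by
        have t : ContMDiffOn ((𝓡 m).prod 𝓘(ℝ, ℂ)) ((𝓡 m).prod 𝓘(ℝ, ℂ × ℂ)) ∞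
            (fun q : M × ℂˣ => (q.1, ((-1, -1) : ℂ × ℂ))) (U ×ˢ Set.univ) :=
          contMDiffOn_fst.prodMk contMDiffOn_const
        exact hH.smooth.comp t fun q hq => ⟨hq.1, Set.mem_univ _⟩
      have s4 : ContMDiffOn ((𝓡 m).prod 𝓘(ℝ, ℂ)) 𝓘(ℝ, CAlg m k) ∞
          (fun q : M × ℂˣ => tr (H q.1 (-1, -1))) (U ×ˢ Set.univ) :=
        (tr.restrictScalars ℝ).contDiff.contMDiff.comp_contMDiffOn s3
      exact contMDiffOn_mul (contMDiffOn_mul s1 s2) (contMDiffOn_mul s4 contMDiffOn_const)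
    refine ⟨U, hH.isOpen, hH.mem, Φ, hsm, (hasConnectionOrderOn_iff hsm hH.isOpen).2
      fun x hx v => ?_, fun y hy => ?_⟩
    · set W : M → CAlg m k := fun y => tr (H y (-1, -1)) * E x₀ with hW
      have hd : ∃ L : Coord m →L[ℝ] CAlg m k, HasDifferential W L x := by
        have s1 : ContMDiffOn (𝓡 m) 𝓘(ℝ, CAlg m k) ∞ (fun y => H y (-1, -1)) U := by
          have t : ContMDiffOn (𝓡 m) ((𝓡 m).prod 𝓘(ℝ, ℂ × ℂ)) ∞
            (fun q : M => (q, ((-1, -1) : ℂ × ℂ))) U := contMDiffOn_id.prodMk contMDiffOn_const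
          exact hH.smooth.comp t fun q hq => ⟨hq, Set.mem_univ _⟩
        have s2 : ContMDiffOn (𝓡 m) 𝓘(ℝ, CAlg m k) ∞ W U :=
          contMDiffOn_mul ((tr.restrictScalars ℝ).contDiff.contMDiff.comp_contMDiffOn s1)
            contMDiffOn_const
        exact ⟨_, ((s2.contMDiffAt (hH.isOpen.mem_nhds hx)).mdifferentiableAt
          (by simp)).hasMFDerivAt⟩
      obtain ⟨W', hW'⟩ := hd
      -- the coefficients of `λ⁻¹`, `1` and `λ` in `Wᵀ (a θ + b β) W + Wᵀ dW`
      refine ⟨tr (W x) * ((r / 2) • theta f x v - (r / (2 * s)) • beta f x v) * W x,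
        tr (W x) * (W' v - (theta f x v + beta f x v) * W x),
        tr (W x) * ((r / 2) • theta f x v + (r / (2 * s)) • beta f x v) * W x, fun l => ?_⟩
      obtain ⟨K, hK, hK'⟩ := HasDifferential.mul (h.isParallelAt hr hs hc1 l x) hW'
      have hK2 : HasDifferential (fun y => val (Φ y).1 l) K x :=
        hK.congr_of_eventuallyEq (Filter.eventually_of_mem (hH.isOpen.mem_nhds hx)
          fun y hy => hΦ y hy l)
      have hK3 : loopDeriv Φ l x = K := hK2.mfderiv
      have e1 := mul_tr_eq_one (h.mul_tr l x)
      have e2 : K v = val (Ψ x).1 l * (conn f (spectral r s l) x v * W x + W' v) := by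
        rw [hK', mul_add]
        exact congrArg (· + _) (mul_assoc _ _ _)
      rw [mcForm, hK3, e2, hΦ x hx l, tr_mul, mul_assoc, ← mul_assoc (tr (val (Ψ x).1 l)), e1,
        one_mul, conn_apply, spectral]
      change tr (W x) * _ = _
      simp only [mul_add, add_mul, mul_sub, sub_mul, smul_mul_assoc, mul_smul_comm, mul_assoc]
      module
    · exact hclass y _ _ _ _ (hE y) ((hUE y hy).1 _ (hE x₀)) (hX y) (hΦ y hy)
  · change (val (X x).1 l₀).toMat i (mid m k) = _
    rw [hX, val_eq_one h hf hr hs hc1 hc0 hl₀, one_mul]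
    exact mul_midMat_eq_positionMat_iff.1 (hE x).mul_midMat i

end Existence

/-! ### Symmetries of the Maurer–Cartan form -/

section Symmetries

open CAlg

variable {m k : ℕ} {M : Type*} [TopologicalSpace M] [ChartedSpace (Coord m) M]
  [IsManifold (𝓡 m) ∞ M] {c : ℝ} {Φ : M → twistedLoops m k c} {U : Set M} {x : M}

lemma SmoothFrameOn.tr_mcForm (h : SmoothFrameOn Φ U) (hU : IsOpen U) (hx : x ∈ U) (l : ℂˣ)
    (v : Coord m) : tr (mcForm Φ l x v) = -mcForm Φ l x v := by
  have h1 := h.hasDifferential hU hx l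
  have h2 := h1.comp_left (g := fun X => tr X) (tr.restrictScalars ℝ).hasFDerivAt
  obtain ⟨K, hK, hK'⟩ := h1.mul h2
  have h3 : HasDifferential (fun y => val (Φ y).1 l * tr (val (Φ y).1 l))
      (0 : Coord m →L[ℝ] CAlg m k) x := by
    simp only [loop_mul_tr]
    exact HasDifferential.const _ _
  have h4 := hK' v
  rw [hK.unique h3] at h4
  have h5 : (0 : CAlg m k) = loopDeriv Φ l x v * tr (val (Φ x).1 l) +
      val (Φ x).1 l * tr (loopDeriv Φ l x v) := h4
  rw [loopDeriv_eq, tr_mul] at h5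
  have e1 := loop_tr_mul (Φ x) l
  have h6 : tr (val (Φ x).1 l) * (val (Φ x).1 l * mcForm Φ l x v * tr (val (Φ x).1 l) +
      val (Φ x).1 l * (tr (mcForm Φ l x v) * tr (val (Φ x).1 l))) * val (Φ x).1 l =
      (tr (val (Φ x).1 l) * val (Φ x).1 l) * mcForm Φ l x v * (tr (val (Φ x).1 l) * val (Φ x).1 l) +
      (tr (val (Φ x).1 l) * val (Φ x).1 l) * tr (mcForm Φ l x v) *
        (tr (val (Φ x).1 l) * val (Φ x).1 l) := by noncomm_ring
  rw [← h5, e1, mul_zero, zero_mul, one_mul, mul_one, one_mul, mul_one] at h6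
  exact (neg_eq_of_add_eq_zero_right h6.symm).symm

/-- If conjugation by an involution `J` carries `Φ_{l'}` to `Φ_l`, it does so with the
Maurer–Cartan forms. -/
lemma SmoothFrameOn.conj_mcForm (h : SmoothFrameOn Φ U) (hU : IsOpen U) (hx : x ∈ U) {l l' : ℂˣ}
    {J : CAlg m k} (hJ : J * J = 1) (hJt : tr J = J)
    (hΦ : ∀ y, J * val (Φ y).1 l' * J = val (Φ y).1 l) (v : Coord m) :
    J * mcForm Φ l' x v * J = mcForm Φ l x v := by
  have h1 := (h.hasDifferential hU hx l').comp_left (g := fun X => J * X * J)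
    (g' := ((ContinuousLinearMap.mul ℝ (CAlg m k)).flip J) ∘L (ContinuousLinearMap.mul ℝ (CAlg m k) J))
    (ContinuousLinearMap.hasFDerivAt (𝕜 := ℝ) (E := CAlg m k) (F := CAlg m k)
      (((ContinuousLinearMap.mul ℝ (CAlg m k)).flip J) ∘L
        (ContinuousLinearMap.mul ℝ (CAlg m k) J)))
  simp only [hΦ] at h1
  have h2 : J * loopDeriv Φ l' x v * J = loopDeriv Φ l x v :=
    DFunLike.congr_fun (h1.unique (h.hasDifferential hU hx l)) v
  rw [mcForm, mcForm, ← h2, ← hΦ x, tr_mul, tr_mul, hJt]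
  calc J * (tr (val (Φ x).1 l') * loopDeriv Φ l' x v) * J
      = J * tr (val (Φ x).1 l') * 1 * loopDeriv Φ l' x v * J := by noncomm_ring
    _ = _ := by rw [← hJ]; noncomm_ring

lemma loop_conj_P (X : twistedLoops m k c) (l : ℂˣ) :
    algP m k * val X.1 (-l) * algP m k = val X.1 l :=
  (mem_twistedLoops_iff.1 X.2).2.1 l

lemma loop_conj_Q (X : twistedLoops m k c) (l : ℂˣ) :
    algQ m k * val X.1 l⁻¹ * algQ m k = val X.1 l :=
  (mem_twistedLoops_iff.1 X.2).2.2.1 l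

lemma SmoothFrameOn.mcForm_neg (h : SmoothFrameOn Φ U) (hU : IsOpen U) (hx : x ∈ U) (l : ℂˣ)
    (v : Coord m) : algP m k * mcForm Φ (-l) x v * algP m k = mcForm Φ l x v :=
  h.conj_mcForm hU hx algP_mul_self tr_algP (fun y => loop_conj_P (Φ y) l) v

lemma SmoothFrameOn.mcForm_inv (h : SmoothFrameOn Φ U) (hU : IsOpen U) (hx : x ∈ U) (l : ℂˣ)
    (v : Coord m) : algQ m k * mcForm Φ l⁻¹ x v * algQ m k = mcForm Φ l x v :=
  h.conj_mcForm hU hx algQ_mul_self tr_algQ (fun y => loop_conj_Q (Φ y) l) v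

lemma algP_conj_apply (A : CAlg m k) (i : Fin k) :
    (algP m k * A * algP m k).toMat (Sum.inr (Sum.inr i)) (mid m k) =
      A.toMat (Sum.inr (Sum.inr i)) (mid m k) := by
  refine (mul_signDiag_apply _ _ _ _).trans ((congrArg (· * _) (signDiag_mul_apply _ _ _ _)).trans ?_)
  simp

lemma algQ_conj_apply (A : CAlg m k) (i : Fin k) :
    (algQ m k * A * algQ m k).toMat (Sum.inr (Sum.inr i)) (mid m k) =
      -A.toMat (Sum.inr (Sum.inr i)) (mid m k) := by
  refine (mul_signDiag_apply _ _ _ _).trans ((congrArg (· * _) (signDiag_mul_apply _ _ _ _)).trans ?_)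
  simp

/-- A Maurer–Cartan form of connection order `(-1, 1)` maps the middle basis vector to the span of
the first `m` basis vectors. In the other components it is even in `λ` by the symmetry `σ`, hence
constant in `λ`, and changes sign under `λ ↦ λ⁻¹` by the symmetry `μ`. -/
lemma SmoothFrameOn.mcForm_apply_mid (h : SmoothFrameOn Φ U) (hU : IsOpen U)
    (ho : HasConnectionOrderOn (-1) 1 Φ U) (hx : x ∈ U) (l : ℂˣ) (v : Coord m)
    (j : Unit ⊕ Fin k) : (mcForm Φ l x v).toMat (Sum.inr j) (mid m k) = 0 := by
  rcases j with j | j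
  · have h1 := congrArg (fun A : CAlg m k => A.toMat (mid m k) (mid m k)) (h.tr_mcForm hU hx l v)
    exact self_eq_neg.1 h1
  · obtain ⟨X, Y, Z, hA⟩ := (hasConnectionOrderOn_iff h hU).1 ho x hx v
    set a : ℂˣ → ℂ := fun l => (mcForm Φ l x v).toMat (Sum.inr (Sum.inr j)) (mid m k) with ha
    have h1 : ∀ l, a (-l) = a l := fun l => by
      have := congrArg (fun A : CAlg m k => A.toMat (Sum.inr (Sum.inr j)) (mid m k))
        (h.mcForm_neg hU hx l v)
      beta_reduce at this
      rwa [algP_conj_apply] at this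
    have h2 : ∀ l, -a l⁻¹ = a l := fun l => by
      have := congrArg (fun A : CAlg m k => A.toMat (Sum.inr (Sum.inr j)) (mid m k))
        (h.mcForm_inv hU hx l v)
      beta_reduce at this
      rwa [algQ_conj_apply] at this
    set e := entry (m := m) (k := k) (Sum.inr (Sum.inr j)) (mid m k)
    have h3 : ∀ l : ℂˣ, a l = (l : ℂ)⁻¹ * e X + e Y + l * e Z := fun l => by
      have : a l = e (mcForm Φ l x v) := rfl
      rw [this, hA, map_add, map_add, map_smul, map_smul, smul_eq_mul, smul_eq_mul]
    have h4 : a 1 = 0 := by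
      have := h2 1
      rw [inv_one] at this
      exact self_eq_neg.1 this.symm
    have h5 := h1 1
    have h6 := h1 l
    change a l = 0
    rw [h3] at h4 h5 h6
    rw [h3] at h5 h6
    rw [h3]
    simp only [Units.val_neg, Units.val_one, inv_neg, inv_one] at h4 h5 h6
    linear_combination -(1 / 2) * h6 + (1 / 2) * h5 + h4

/-- The reality involution fixes `λ₀`. -/
lemma realityMap_eq {r s : ℂ} (hr : r ^ 2 = c) (hs : s ^ 2 = 1 - c) (hc0 : c ≠ 0) {l₀ : ℂˣ}
    (hl₀ : (l₀ : ℂ) = (1 + s) / r) : realityMap c l₀ = l₀ := by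
  have hs' : s ^ 2 = ((1 - c : ℝ) : ℂ) := by rw [hs]; push_cast; ring
  have e1 : ((star l₀ : ℂˣ) : ℂ) = starRingEnd ℂ l₀ := rfl
  apply Units.ext
  rcases lt_or_gt_of_ne hc0 with h0 | h0
  · rw [realityMap, if_pos h0, Units.val_neg, e1, hl₀, map_div₀, map_add, map_one,
      conj_of_sq_neg hr h0, conj_of_sq_nonneg hs' (by linarith), div_neg, neg_neg]
  · by_cases h1 : c < 1
    · rw [realityMap, if_neg (by linarith), if_pos h1, e1, hl₀, map_div₀, map_add, map_one,
        conj_of_sq_nonneg hr h0.le, conj_of_sq_nonneg hs' (by linarith)]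
    · have hr0 : r ≠ 0 := by
        rintro rfl
        refine hc0 ?_
        have : (c : ℂ) = 0 := by rw [← hr]; ring
        exact_mod_cast this
      have h2 : (1 + s) * (1 - s) = r ^ 2 := by rw [hr]; linear_combination -hs
      have h3 : (1 : ℂ) - s ≠ 0 := fun h => pow_ne_zero 2 hr0 (by rw [← h2, h, mul_zero])
      have h4 : starRingEnd ℂ s = -s := by
        rcases eq_or_lt_of_le (not_lt.1 h1) with h5 | h5
        · have : s = 0 := by simpa [← h5] using hs
          simp [this]
        · exact conj_of_sq_neg hs' (by linarith)
      rw [realityMap, if_neg (by linarith), if_neg h1, Units.val_inv_eq_inv_val, e1, hl₀,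
        map_div₀, map_add, map_one, conj_of_sq_nonneg hr h0.le, h4, inv_div, ← sub_eq_add_neg,
        div_eq_div_iff h3 hr0]
      linear_combination -h2

end Symmetries

/-! ### Real orthogonal frames -/

section RealFrames

open CAlg

variable {m k : ℕ} {g : CAlg m k}

/-- The real part of a column of a matrix. -/
def realColumn (g : CAlg m k) (j : Idx m k) : Ambient m k :=
  WithLp.toLp 2 fun i => (g.toMat i j).re

lemma realColumn_apply (hg : cj g = g) (i j : Idx m k) :
    ((realColumn g j i : ℝ) : ℂ) = g.toMat i j := by
  have := congrArg (fun Y : CAlg m k => Y.toMat i j) hg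
  exact Complex.conj_eq_iff_re.1 this

lemma tr_mul_positionMat_apply (hg : cj g = g) (w : Ambient m k) (j : Idx m k) :
    (tr g * positionMat w).toMat j (mid m k) = ((⟪realColumn g j, w⟫_ℝ : ℝ) : ℂ) := by
  rw [toMat_mul, Matrix.mul_apply, PiLp.inner_apply, Complex.ofReal_sum]
  refine Finset.sum_congr rfl fun i _ => ?_
  rw [toMat_tr, Matrix.transpose_apply, positionMat_apply, if_pos rfl, ← realColumn_apply hg]
  simp [mul_comm]

lemma positionMat_injective {u w : Ambient m k} (h : positionMat u = positionMat w) : u = w := by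
  ext i
  have := congrArg (fun A : CAlg m k => A.toMat i (mid m k)) h
  simp only [positionMat_apply, if_true] at this
  exact_mod_cast this

/-- Vectors are determined by their inner products with the columns of an orthogonal matrix. -/
lemma tr_mul_positionMat_ext (hg : cj g = g) {u w : Ambient m k}
    (h : ∀ j, ⟪realColumn g j, u⟫_ℝ = ⟪realColumn g j, w⟫_ℝ) (hg1 : g * tr g = 1) : u = w := by
  have h1 : tr g * positionMat u = tr g * positionMat w := by
    apply toMat_injective
    ext i j
    by_cases hj : j = mid m k
    · subst hj
      rw [tr_mul_positionMat_apply hg, tr_mul_positionMat_apply hg, h]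
    · rw [toMat_mul, toMat_mul, Matrix.mul_apply, Matrix.mul_apply]
      simp [positionMat_apply, hj]
  apply positionMat_injective
  rw [← one_mul (positionMat u), ← hg1, mul_assoc, h1, ← mul_assoc, hg1, one_mul]

lemma complexify_mul_apply (hg : cj g = g) (A : Ambient m k →L[ℝ] Ambient m k) (i j : Idx m k) :
    (complexify A * g).toMat i j = ((A (realColumn g j) i : ℝ) : ℂ) := by
  have h1 : complexify A * positionMat (realColumn g j) = positionMat (A (realColumn g j)) := by
    rw [positionMat, positionMat, ← map_mul]
    congr 1
    ext1 u
    simp only [mul_apply_eq_comp, outer_apply, map_smul]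
  have h2 := congrArg (fun Y : CAlg m k => Y.toMat i (mid m k)) h1
  simp only [toMat_mul, Matrix.mul_apply, positionMat_apply, if_true] at h2
  rw [← h2, toMat_mul, Matrix.mul_apply]
  exact Finset.sum_congr rfl fun q _ => by rw [realColumn_apply hg]

lemma inner_realColumn (hg : cj g = g) (hg1 : tr g * g = 1) (i j : Idx m k) :
    ⟪realColumn g i, realColumn g j⟫_ℝ = if i = j then 1 else 0 := by
  have h1 := congrArg (fun Y : CAlg m k => Y.toMat i j) hg1
  simp only [toMat_mul, Matrix.mul_apply, toMat_tr, Matrix.transpose_apply, toMat_one,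
    Matrix.one_apply] at h1
  have h2 : ((⟪realColumn g i, realColumn g j⟫_ℝ : ℝ) : ℂ) = ∑ q, g.toMat q i * g.toMat q j := by
    rw [PiLp.inner_apply, Complex.ofReal_sum]
    refine Finset.sum_congr rfl fun q _ => ?_
    rw [← realColumn_apply hg, ← realColumn_apply hg]
    simp [mul_comm]
  rw [h1] at h2
  split_ifs at h2 ⊢ <;> exact_mod_cast h2

lemma mul_algP_apply (A : CAlg m k) (i j : Idx m k) : (A * algP m k).toMat i j =
    Sum.elim (fun _ => A.toMat i j) (fun _ => -A.toMat i j) j := by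
  refine (mul_signDiag_apply _ _ _ _).trans ?_
  rcases j with j | j <;> simp

lemma mul_algQ_apply (A : CAlg m k) (i j : Idx m k) : (A * algQ m k).toMat i j =
    Sum.elim (fun _ => A.toMat i j) (Sum.elim (fun _ => A.toMat i j) (fun _ => -A.toMat i j)) j := by
  refine (mul_signDiag_apply _ _ _ _).trans ?_
  rcases j with j | j | j <;> simp

end RealFrames

/-! ### Lifts of an immersion -/

section Lifts

open CAlg

variable {m k : ℕ} {M : Type*} [TopologicalSpace M] [ChartedSpace (Coord m) M]
  {f : M → Ambient m k} {c : ℝ} {r s : ℂ} {l₀ : ℂˣ} {Φ : M → twistedLoops m k c} {U : Set M} {x : M}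

/-- `Φ` is a local map into the twisted loop group of connection order `(-1, 1)`, whose middle
column at `λ₀` is `f`. -/
structure IsLift (f : M → Ambient m k) (l₀ : ℂˣ) (Φ : M → twistedLoops m k c) (U : Set M) :
    Prop where
  isOpen : IsOpen U
  smooth : SmoothFrameOn Φ U
  order : HasConnectionOrderOn (-1) 1 Φ U
  column : ∀ y ∈ U, val (Φ y).1 l₀ * midMat m k = positionMat (f y)

variable [IsManifold (𝓡 m) ∞ M]

namespace IsLift

variable (h : IsLift f l₀ Φ U) (hf : IsSphereImmersion f) (hx : x ∈ U)
include h hx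

lemma loopDeriv_mul_midMat (hf : IsSphereImmersion f) (v : Coord m) :
    loopDeriv Φ l₀ x v * midMat m k = positionMat (differential f x v) := by
  have h1 := (h.smooth.hasDifferential h.isOpen hx l₀).comp_left (g := fun X => X * midMat m k)
    (ContinuousLinearMap.hasFDerivAt (𝕜 := ℝ) (E := CAlg m k) (F := CAlg m k)
      ((ContinuousLinearMap.mul ℝ (CAlg m k)).flip (midMat m k)))
  have h2 := HasDifferential.comp_left (g := positionMat) (hasFDerivAt_positionMat _)
      (hf.hasDifferential x)
  have h3 := h1.congr_of_eventuallyEq (Filter.eventually_of_mem (h.isOpen.mem_nhds hx)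
    fun y hy => (h.column y hy).symm)
  exact DFunLike.congr_fun (h3.unique h2) v

variable (hg : cj (val (Φ x).1 l₀) = val (Φ x).1 l₀)
include hf hg

lemma inner_realColumn_differential (v : Coord m) (j : Idx m k) :
    ((⟪realColumn (val (Φ x).1 l₀) j, differential f x v⟫_ℝ : ℝ) : ℂ) =
      (mcForm Φ l₀ x v).toMat j (mid m k) := by
  rw [← tr_mul_positionMat_apply hg, ← h.loopDeriv_mul_midMat hx hf, ← mul_assoc, ← mcForm,
    mul_midMat_apply, if_pos rfl]

lemma inner_realColumn_differential_inr (v : Coord m) (j : Unit ⊕ Fin k) :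
    ⟪realColumn (val (Φ x).1 l₀) (Sum.inr j), differential f x v⟫_ℝ = 0 := by
  have h1 := h.inner_realColumn_differential hf hx hg v (Sum.inr j)
  rw [h.smooth.mcForm_apply_mid h.isOpen h.order hx] at h1
  exact_mod_cast h1

/-- The first `m` columns of `Φ_{λ₀}` are tangent: the tangent space lies in their span, by
`SmoothFrameOn.mcForm_apply_mid`, and has dimension `m`. -/
lemma exists_differential_eq (i : Fin m) :
    ∃ v, differential f x v = realColumn (val (Φ x).1 l₀) (Sum.inl i) := by
  have hg1 := loop_mul_tr (Φ x) l₀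
  have hg2 := loop_tr_mul (Φ x) l₀
  set g := val (Φ x).1 l₀
  set a : Coord m →ₗ[ℝ] (Fin m → ℝ) := LinearMap.pi fun i =>
    (innerSL ℝ (realColumn g (Sum.inl i))).toLinearMap ∘ₗ (differential f x).toLinearMap
  have ha : ∀ v i, a v i = ⟪realColumn g (Sum.inl i), differential f x v⟫_ℝ := fun _ _ => rfl
  have hinj : Function.Injective a := by
    rw [injective_iff_map_eq_zero]
    intro v hv
    have h1 : differential f x v = 0 := by
      refine tr_mul_positionMat_ext hg (fun j => ?_) hg1
      rw [inner_zero_right]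
      rcases j with j | j
      · rw [← ha, hv]; rfl
      · exact h.inner_realColumn_differential_inr hf hx hg v j
    exact (injective_iff_map_eq_zero (differential f x)).1 (hf.injective_mfderiv x) v h1
  have hsurj : Function.Surjective a :=
    (LinearMap.injective_iff_surjective_of_finrank_eq_finrank (by simp)).1 hinj
  obtain ⟨v, hv⟩ := hsurj (Pi.single i 1)
  refine ⟨v, tr_mul_positionMat_ext hg (fun j => ?_) hg1⟩
  rw [inner_realColumn hg hg2]
  rcases j with j | j
  · rw [← ha, hv, Pi.single_apply]
    simp
  · rw [h.inner_realColumn_differential_inr hf hx hg]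
    simp

lemma tangentField_realColumn (j : Idx m k) :
    tangentField f x (realColumn (val (Φ x).1 l₀) j) =
      Sum.elim (fun _ => realColumn (val (Φ x).1 l₀) j) (fun _ => 0) j := by
  rw [tangentField, tangentProj]
  rcases j with j | j
  · obtain ⟨v, hv⟩ := h.exists_differential_eq hf hx hg j
    exact Submodule.starProjection_eq_self_iff.2 ⟨v, hv⟩
  · refine (Submodule.starProjection_apply_eq_zero_iff _).2 ?_
    rw [Submodule.mem_orthogonal]
    rintro _ ⟨v, rfl⟩
    rw [real_inner_comm]
    exact h.inner_realColumn_differential_inr hf hx hg v j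

lemma reflT_mul : reflT f x * val (Φ x).1 l₀ = val (Φ x).1 l₀ * algP m k := by
  apply toMat_injective
  ext i j
  rw [reflT, reflTangentMat, complexify_mul_apply hg, mul_algP_apply, reflTangent_apply,
    h.tangentField_realColumn hf hx hg, ← realColumn_apply hg]
  rcases j with j | j
  · rw [Sum.elim_inl, Sum.elim_inl, two_smul, add_sub_cancel_right]
  · rw [Sum.elim_inr, Sum.elim_inr, smul_zero, zero_sub, ← Complex.ofReal_neg]
    rfl

lemma reflC_mul : reflC f x * val (Φ x).1 l₀ = val (Φ x).1 l₀ * algQ m k := by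
  have hfm : f x = realColumn (val (Φ x).1 l₀) (mid m k) := by
    ext i
    have h1 := mul_midMat_eq_positionMat_iff.1 (h.column x hx) i
    rw [← realColumn_apply hg] at h1
    exact_mod_cast h1.symm
  apply toMat_injective
  ext i j
  rw [reflC, reflConeMat, complexify_mul_apply hg, mul_algQ_apply, reflCone_apply,
    h.tangentField_realColumn hf hx hg, ← realColumn_apply hg]
  nth_rewrite 1 [hfm]
  rw [inner_realColumn hg (loop_tr_mul (Φ x) l₀)]
  rcases j with j | j | j
  · rw [Sum.elim_inl, Sum.elim_inl, two_smul, add_sub_cancel_right, if_neg (by simp), zero_smul,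
      smul_zero, add_zero]
  · rw [Sum.elim_inr, Sum.elim_inr, Sum.elim_inl, if_pos rfl, hfm, one_smul]
    have e : ∀ u : Ambient m k, (2 : ℝ) • (0 : Ambient m k) - u + (2 : ℝ) • u = u := fun u => by
      module
    exact congrArg (fun u : Ambient m k => ((u i : ℝ) : ℂ)) (e _)
  · rw [Sum.elim_inr, Sum.elim_inr, Sum.elim_inr, if_neg (by simp), zero_smul, smul_zero, add_zero,
      zero_sub, ← Complex.ofReal_neg]
    rfl

end IsLift

/-- If `N Φ_{λ₀} = Φ_{λ₀} J` and `dN = 2 B N`, then `B` corresponds, under `Φ_{λ₀}`, to the part of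
the Maurer–Cartan form that anticommutes with `J`. Applied to `dN = [ρ, N]`, where `B` is the part
of `ρ` that anticommutes with `N`. -/
lemma IsLift.mul_mcForm_sub (h : IsLift f l₀ Φ U) (hx : x ∈ U) {N : M → CAlg m k} {J : CAlg m k}
    (hJ : J * J = 1) (hN : ∀ y ∈ U, N y * val (Φ y).1 l₀ = val (Φ y).1 l₀ * J)
    {N' : Coord m →L[ℝ] CAlg m k} (hN' : HasDifferential N N' x) {v : Coord m} {B : CAlg m k}
    (hB : N' v = (2 : ℂ) • (B * N x)) :
    (2 : ℂ) • (B * val (Φ x).1 l₀) =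
      val (Φ x).1 l₀ * (mcForm Φ l₀ x v - J * mcForm Φ l₀ x v * J) := by
  have h0 := h.smooth.hasDifferential h.isOpen hx l₀
  obtain ⟨K, hK, hK'⟩ := hN'.mul h0
  obtain ⟨K₂, hK₂, hK₂'⟩ := h0.mul (HasDifferential.const (m := m) J x)
  have h1 := hK.congr_of_eventuallyEq (Filter.eventually_of_mem (h.isOpen.mem_nhds hx)
    fun y hy => (hN y hy).symm)
  have h2 := hK' v
  rw [h1.unique hK₂, hK₂', hB, loopDeriv_eq, smul_mul_assoc, mul_assoc B, hN x hx,
    ← mul_assoc (N x), hN x hx] at h2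
  have h3 := congrArg (· * J) h2
  have e1 : (val (Φ x).1 l₀ * mcForm Φ l₀ x v * J + val (Φ x).1 l₀ * 0) * J =
    val (Φ x).1 l₀ * mcForm Φ l₀ x v * (J * J) := by noncomm_ring
  have e2 : ((2 : ℂ) • (B * (val (Φ x).1 l₀ * J)) + val (Φ x).1 l₀ * J * mcForm Φ l₀ x v) * J =
      (2 : ℂ) • (B * (val (Φ x).1 l₀ * (J * J))) +
        val (Φ x).1 l₀ * (J * mcForm Φ l₀ x v * J) := by
    rw [add_mul, smul_mul_assoc]; noncomm_ring
  have h4 : val (Φ x).1 l₀ * mcForm Φ l₀ x v = (2 : ℂ) • (B * val (Φ x).1 l₀) +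
      val (Φ x).1 l₀ * (J * mcForm Φ l₀ x v * J) := by
    have := e1.symm.trans (h3.trans e2)
    rwa [hJ, mul_one, mul_one] at this
  rw [mul_sub, h4, add_sub_cancel_right]

/-- The Maurer–Cartan forms of a lift at different loop parameters are related by the connection
form `a θ + b β`. -/
lemma IsLift.conn_mul (h : IsLift f l₀ Φ U) (hf : IsSphereImmersion f)
    (hr : r ^ 2 = c) (hs : s ^ 2 = 1 - c) (hc0 : c ≠ 0) (hc1 : c ≠ 1)
    (hl₀ : (l₀ : ℂ) = (1 + s) / r) (hx : x ∈ U) (l : ℂˣ) (v : Coord m) :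
    conn f (spectral r s l) x v * val (Φ x).1 l₀ =
      val (Φ x).1 l₀ * (mcForm Φ l x v - mcForm Φ l₀ x v) := by
  have hg : ∀ y, cj (val (Φ y).1 l₀) = val (Φ y).1 l₀ := fun y => by
    have := (mem_twistedLoops_iff.1 (Φ y).2).2.2.2 l₀
    rwa [realityMap_eq hr hs hc0 hl₀] at this
  obtain ⟨R', hR, hR'⟩ := hf.hasDifferential_reflT x
  obtain ⟨S', hS, hS'⟩ := hf.hasDifferential_reflC x
  have t1 : reflT f x * theta f x v = -(theta f x v * reflT f x) :=
    (hf.isTangentData x).reflTangentMat_mul_theta v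
  have t2 : reflT f x * beta f x v = -(beta f x v * reflT f x) :=
    (hf.isTangentData x).reflTangentMat_mul_beta v
  have t3 : reflC f x * theta f x v = theta f x v * reflC f x :=
    (hf.isTangentData x).reflConeMat_mul_theta v
  have t4 : reflC f x * beta f x v = -(beta f x v * reflC f x) :=
    (hf.isTangentData x).reflConeMat_mul_beta v
  -- the two reflections single out `θ + β` and `β`, in terms of the Maurer–Cartan form at `λ₀`
  have k1 := h.mul_mcForm_sub hx (N := reflT f) (v := v) (B := theta f x v + beta f x v)
    algP_mul_self (fun y hy => h.reflT_mul hf hy (hg y)) hR (by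
      rw [hR', mul_add, t1, t2, add_mul]; module)
  have k2 := h.mul_mcForm_sub hx (N := reflC f) (v := v) (B := beta f x v)
    algQ_mul_self (fun y hy => h.reflC_mul hf hy (hg y)) hS (by
      rw [hS', mul_add, t3, t4, add_mul]; module)
  have p1 := h.smooth.mcForm_neg h.isOpen hx (-l₀) v
  have p2 := h.smooth.mcForm_inv h.isOpen hx l₀⁻¹ v
  rw [neg_neg] at p1
  rw [inv_inv] at p2
  rw [p1] at k1
  rw [p2] at k2
  obtain ⟨X, Y, Z, hA⟩ := (hasConnectionOrderOn_iff h.smooth h.isOpen).1 h.order x hx v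
  simp only [hA, Units.val_neg, Units.val_inv_eq_inv_val, inv_neg, inv_inv] at k1 k2 ⊢
  have hsp := spectral_zero hr hs hc0 hc1 hl₀
  have s1 : ((l₀ : ℂ) + (l₀ : ℂ)⁻¹) * r / 2 - 1 = 0 := congrArg Prod.fst hsp
  have s2 : ((l₀ : ℂ) - (l₀ : ℂ)⁻¹) * r / (2 * s) - 1 = 0 := congrArg Prod.snd hsp
  have e1 : (((l : ℂ) + (l : ℂ)⁻¹) * r / 2 - 1) * ((l₀ : ℂ) + (l₀ : ℂ)⁻¹) =
      ((l : ℂ) + (l : ℂ)⁻¹) - ((l₀ : ℂ) + (l₀ : ℂ)⁻¹) := by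
    linear_combination ((l : ℂ) + (l : ℂ)⁻¹) * s1
  have e2 : (((l : ℂ) - (l : ℂ)⁻¹) * r / (2 * s) - 1) * ((l₀ : ℂ) - (l₀ : ℂ)⁻¹) =
      ((l : ℂ) - (l : ℂ)⁻¹) - ((l₀ : ℂ) - (l₀ : ℂ)⁻¹) := by
    linear_combination ((l : ℂ) - (l : ℂ)⁻¹) * s2
  set g := val (Φ x).1 l₀
  have hβ : beta f x v * g = (1 / 2 : ℂ) • ((l₀ : ℂ) - (l₀ : ℂ)⁻¹) • (g * Z - g * X) := by
    have : beta f x v * g = (1 / 2 : ℂ) • ((2 : ℂ) • (beta f x v * g)) := by module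
    rw [this, k2]
    simp only [mul_add, mul_sub, mul_smul_comm]
    module
  have hθ : theta f x v * g = (1 / 2 : ℂ) • ((l₀ : ℂ) + (l₀ : ℂ)⁻¹) • (g * Z + g * X) := by
    have : theta f x v * g = (1 / 2 : ℂ) • ((2 : ℂ) • ((theta f x v + beta f x v) * g)) -
        beta f x v * g := by rw [add_mul]; module
    rw [this, k1, hβ]
    simp only [mul_add, mul_sub, mul_smul_comm]
    module
  rw [conn_apply, spectral]
  simp only
  rw [add_mul, smul_mul_assoc, smul_mul_assoc, hβ, hθ]
  generalize ((l : ℂ) + (l : ℂ)⁻¹) * r / 2 - 1 = a at e1 ⊢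
  generalize ((l : ℂ) - (l : ℂ)⁻¹) * r / (2 * s) - 1 = b at e2 ⊢
  have e3 : a • (1 / 2 : ℂ) • ((l₀ : ℂ) + (l₀ : ℂ)⁻¹) • (g * Z + g * X) +
      b • (1 / 2 : ℂ) • ((l₀ : ℂ) - (l₀ : ℂ)⁻¹) • (g * Z - g * X) =
      (1 / 2 : ℂ) • ((a * ((l₀ : ℂ) + (l₀ : ℂ)⁻¹)) • (g * Z + g * X) +
        (b * ((l₀ : ℂ) - (l₀ : ℂ)⁻¹)) • (g * Z - g * X)) := by module
  rw [e3, e1, e2]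
  simp only [mul_add, mul_sub, mul_smul_comm]
  module

/-- For a lift `Φ`, the loops `Φ_λ Φ_{λ₀}⁻¹` are solutions of `dX = X (a θ + b β)`. -/
lemma IsLift.isParallelAt (h : IsLift f l₀ Φ U) (hf : IsSphereImmersion f)
    (hr : r ^ 2 = c) (hs : s ^ 2 = 1 - c) (hc0 : c ≠ 0) (hc1 : c ≠ 1)
    (hl₀ : (l₀ : ℂ) = (1 + s) / r) (hx : x ∈ U) (l : ℂˣ) :
    IsParallelAt f (spectral r s l) (fun y => val (Φ y).1 l * tr (val (Φ y).1 l₀)) x := by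
  have h1 := (h.smooth.hasDifferential h.isOpen hx l₀).comp_left (g := fun X => tr X)
    (tr.restrictScalars ℝ).hasFDerivAt
  obtain ⟨K, hK, hK'⟩ := (h.smooth.hasDifferential h.isOpen hx l).mul h1
  rw [IsParallelAt]
  convert hK using 1
  ext1 v
  refine Eq.trans ?_ (hK' v).symm
  change val (Φ x).1 l * tr (val (Φ x).1 l₀) * conn f (spectral r s l) x v =
    loopDeriv Φ l x v * tr (val (Φ x).1 l₀) + val (Φ x).1 l * tr (loopDeriv Φ l₀ x v)
  have hg1 := loop_mul_tr (Φ x) l₀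
  have hg2 := loop_tr_mul (Φ x) l₀
  have h2 : conn f (spectral r s l) x v = val (Φ x).1 l₀ *
      (mcForm Φ l x v - mcForm Φ l₀ x v) * tr (val (Φ x).1 l₀) := by
    rw [← h.conn_mul hf hr hs hc0 hc1 hl₀ hx l v, mul_assoc, hg1, mul_one]
  rw [h2, loopDeriv_eq, loopDeriv_eq, tr_mul, h.smooth.tr_mcForm h.isOpen hx]
  have e1 : val (Φ x).1 l * tr (val (Φ x).1 l₀) * (val (Φ x).1 l₀ *
      (mcForm Φ l x v - mcForm Φ l₀ x v) * tr (val (Φ x).1 l₀)) =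
      val (Φ x).1 l * (tr (val (Φ x).1 l₀) * val (Φ x).1 l₀) *
      (mcForm Φ l x v - mcForm Φ l₀ x v) * tr (val (Φ x).1 l₀) := by noncomm_ring
  rw [e1, hg2]
  noncomm_ring

lemma upperDet_val_eq_of_mk_eq {X Y : twistedLoops m k c}
    (h : (QuotientGroup.mk X : LoopQuot m k c) = QuotientGroup.mk Y) :
    upperDet (val Y.1 1) = upperDet (val X.1 1) := by
  have hQ : ∀ X : twistedLoops m k c, algQ m k * val X.1 1 = val X.1 1 * algQ m k := fun X => by
    have h1 := loop_conj_Q X 1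
    rw [inv_one] at h1
    rw [← mul_one (algQ m k * val X.1 1), ← algQ_mul_self, ← mul_assoc, h1]
  obtain ⟨g, hg⟩ := mk_eq_mk_iff.1 h
  have hB : ofMat (blockHom m k g) = tr (val X.1 1) * val Y.1 1 := by
    rw [hg, ← mul_assoc, loop_tr_mul, one_mul]
  have hBQ : algQ m k * ofMat (blockHom m k g) = ofMat (blockHom m k g) * algQ m k := by
    rw [hB, ← mul_assoc, algQ_comm_tr (hQ X), mul_assoc, hQ Y, mul_assoc]
  rw [hg, upperDet_mul hBQ, upperDet_blockHom, mul_one]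

/-- `X_λ X_{λ₀}⁻¹` depends only on the class of the loop `X`. -/
lemma mul_tr_eq_of_mk_eq {X Y : twistedLoops m k c}
    (h : (QuotientGroup.mk X : LoopQuot m k c) = QuotientGroup.mk Y) (l l₀ : ℂˣ) :
    val Y.1 l * tr (val Y.1 l₀) = val X.1 l * tr (val X.1 l₀) := by
  obtain ⟨g, hg⟩ := mk_eq_mk_iff.1 h
  have hB : ofMat (blockHom m k g) = tr (val X.1 l₀) * val Y.1 l₀ := by
    rw [hg, ← mul_assoc, loop_tr_mul, one_mul]
  have h1 : ofMat (blockHom m k g) * tr (ofMat (blockHom m k g)) = 1 := by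
    rw [hB, tr_mul, tr_tr, mul_assoc, ← mul_assoc (val Y.1 l₀), loop_mul_tr, one_mul, loop_tr_mul]
  rw [hg l, hg l₀, tr_mul, mul_assoc, ← mul_assoc (ofMat (blockHom m k g)), h1, one_mul]

/-- Every map `F` as in the uniqueness claim is the class of the global solution times an adapted
frame. -/
theorem exists_adaptedFrame_of_connectionOrderMap [PreconnectedSpace M] {p : M}
    {Ψ : M → loopGroup m k} (hΨ : IsGlobalParallel f c r s p Ψ) (hf : IsSphereImmersion f)
    (hr : r ^ 2 = c) (hs : s ^ 2 = 1 - c) (hc0 : c ≠ 0) (hc1 : c ≠ 1)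
    (hl₀ : (l₀ : ℂ) = (1 + s) / r) {F : M → LoopQuot m k c} (hF : IsConnectionOrderMap (-1) 1 p F)
    (hFf : ∀ x i, midColumn l₀ (F x) i = ((f x i : ℝ) : ℂ)) (x : M) :
    ∃ (X : twistedLoops m k c) (E : CAlg m k), F x = QuotientGroup.mk X ∧
      IsAdaptedFrame f Ψ x E ∧ ∀ l, val X.1 l = val (Ψ x).1 l * E := by
  obtain ⟨hFp, hloc⟩ := hF
  have hlift : ∀ x, ∃ U Φ, x ∈ U ∧ IsLift f l₀ Φ U ∧ ∀ y ∈ U, F y = QuotientGroup.mk (Φ y) := by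
    intro x
    obtain ⟨U, hU, hxU, Φ, hΦ, ho, hFU⟩ := hloc x
    refine ⟨U, Φ, hxU, ⟨hU, hΦ, ho, fun y hy => ?_⟩, hFU⟩
    refine mul_midMat_eq_positionMat_iff.2 fun i => ?_
    rw [← hFf, hFU y hy]
    rfl
  choose U Φ hxU hΦ hFU using hlift
  choose X hX using fun x => QuotientGroup.mk_surjective (F x)
  have hXΦ : ∀ x, ∀ y ∈ U x, (QuotientGroup.mk (X y) : LoopQuot m k c) =
      QuotientGroup.mk (Φ x y) := fun x y hy => (hX y).trans (hFU x y hy)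
  have hXp : (QuotientGroup.mk (1 : twistedLoops m k c) : LoopQuot m k c) =
      QuotientGroup.mk (X p) := hFp.symm.trans (hX p).symm
  -- `F_λ F_{λ₀}⁻¹` is well defined and solves the same equation as `Ψ_λ`
  have hW : ∀ (l : ℂˣ) x, val (X x).1 l * tr (val (X x).1 l₀) = val (Ψ x).1 l := by
    intro l
    refine eq_of_isParallel (p := p) hf (A := fun x => val (X x).1 l * tr (val (X x).1 l₀))
      (fun x => ?_) (hΨ.isParallelAt hr hs hc1 l) (hΨ.mul_tr l) ?_
    · refine HasDifferential.congr_of_eventuallyEq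
        (h := fun y => val (Φ x y).1 l * tr (val (Φ x y).1 l₀)) ?_
        (Filter.eventually_of_mem ((hΦ x).isOpen.mem_nhds (hxU x)) fun y hy =>
          (mul_tr_eq_of_mk_eq (hXΦ x y hy) l l₀).symm)
      have h1 := (hΦ x).isParallelAt hf hr hs hc0 hc1 hl₀ (hxU x) l
      rw [IsParallelAt, mul_tr_eq_of_mk_eq (hXΦ x x (hxU x)) l l₀] at h1
      exact h1
    · rw [mul_tr_eq_of_mk_eq hXp, hΨ.val_base]
      change (1 : CAlg m k) * tr 1 = 1
      rw [tr_one, mul_one]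
  -- the upper determinant of `F` at `λ = 1` is well defined and locally constant
  have hdet : ∀ x, upperDet (val (X x).1 1) = 1 := by
    have hlc : IsLocallyConstant fun x => upperDet (val (X x).1 1) := by
      rw [IsLocallyConstant.iff_eventually_eq]
      intro x
      have h1 := eventually_upperDet_eq (X := fun y => val (Φ x y).1 1) (x := x)
        ((hΦ x).smooth.hasDifferential (hΦ x).isOpen (hxU x) 1).continuousAt
        (Filter.Eventually.of_forall fun y => ⟨by
          have h1 := loop_conj_Q (Φ x y) 1
          rw [inv_one] at h1
          rw [← mul_one (algQ m k * val (Φ x y).1 1), ← algQ_mul_self, ← mul_assoc, h1],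
          loop_mul_tr _ _⟩)
      filter_upwards [h1, (hΦ x).isOpen.mem_nhds (hxU x)] with y hy hyU
      rw [← upperDet_val_eq_of_mk_eq (hXΦ x y hyU), hy, upperDet_val_eq_of_mk_eq (hXΦ x x (hxU x))]
    intro x
    rw [hlc.apply_eq_of_preconnectedSpace x p, upperDet_val_eq_of_mk_eq hXp]
    exact upperDet_one
  have hmem := mem_twistedLoops_iff.1 (Φ x x).2
  have hg : cj (val (Φ x x).1 l₀) = val (Φ x x).1 l₀ := by
    have := hmem.2.2.2 l₀
    rwa [realityMap_eq hr hs hc0 hl₀] at this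
  have hΨΦ : ∀ l, val (Φ x x).1 l = val (Ψ x).1 l * val (Φ x x).1 l₀ := fun l => by
    rw [← hW, ← mul_tr_eq_of_mk_eq (hXΦ x x (hxU x)), mul_assoc, loop_tr_mul, mul_one]
  refine ⟨Φ x x, val (Φ x x).1 l₀, hFU x x (hxU x), ⟨hg, loop_mul_tr _ _, det_val hmem.1 _,
    (hΦ x).reflT_mul hf (hxU x) hg, (hΦ x).reflC_mul hf (hxU x) hg, (hΦ x).column x (hxU x), ?_⟩,
    hΨΦ⟩
  rw [← hΨΦ, upperDet_val_eq_of_mk_eq (hXΦ x x (hxU x)), hdet]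

end Lifts

end SpaceForm

end

theorem lemma3p1 (m k : ℕ) {M : Type*} [TopologicalSpace M] [T2Space M]
    [ChartedSpace (EuclideanSpace ℝ (Fin m)) M] [IsManifold (𝓡 m) ∞ M] [SimplyConnectedSpace M]
    (p : M) (f : M → SpaceForm.Ambient m k) (c : ℝ) (hc0 : c ≠ 0) (hc1 : c ≠ 1)
    (hf : SpaceForm.IsSphereImmersion f)
    (hflat : SpaceForm.HasFlatNormalBundle f)
    (hcurv : SpaceForm.HasConstCurvature f c)
    (hp : f p = EuclideanSpace.single (SpaceForm.mid m k) 1)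
    (hT : Set.range (mfderiv (𝓡 m) 𝓘(ℝ, SpaceForm.Ambient m k) f p) =
      (Submodule.span ℝ (Set.range fun i : Fin m =>
        (EuclideanSpace.single (Sum.inl i) 1 : SpaceForm.Ambient m k)) :
        Set (SpaceForm.Ambient m k)))
    (r s : ℂ) (hr : r ^ 2 = c) (hs : s ^ 2 = 1 - c)
    (l₀ : ℂˣ) (hl₀ : (l₀ : ℂ) = (1 + s) / r) :
    ∃! F : M → SpaceForm.LoopQuot m k c,
      SpaceForm.IsConnectionOrderMap (-1) 1 p F ∧
      ∀ x i, SpaceForm.midColumn l₀ (F x) i = ((f x i : ℝ) : ℂ) := by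
  obtain ⟨Ψ, hΨ⟩ := hf.exists_global_parallel hflat hcurv hr hs hc1 p
  have hR := hf.reflT_base hT
  have hS := hf.reflC_base hp hT
  obtain ⟨F, hF, hFf, hchar⟩ :=
    SpaceForm.exists_connectionOrderMap hΨ hf hr hs hc1 hc0 hp hR hS hl₀
  refine ⟨F, ⟨hF, hFf⟩, fun F' ⟨hF', hF'f⟩ => funext fun x => ?_⟩
  obtain ⟨X, E, hX, hE, hXE⟩ :=
    SpaceForm.exists_adaptedFrame_of_connectionOrderMap hΨ hf hr hs hc0 hc1 hl₀ hF' hF'f x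
  rw [hX, hchar x X E hE hXE]
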